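/- **Conventions.** Minkowski space $\mathsf E^3$ is $\mathbb R^{2,1}$ with form $x^2+y^2-z^2$; a causal vector is future-pointing if $z>0$. Anti-de Sitter space $\mathsf{AdS}^3$ is $\mathrm{PSL}(2,\mathbb R)$ with the bi-invariant Lorentzian metric given on $\mathfrak{sl}(2,\mathbb R)$ by $A\cdot A=-\det A$; its double cover is $\mathrm{SL}(2,\mathbb R)$. Each tangent space $T_p(\mathsf{AdS}^3)$ is identified isometrically with $\mathfrak{sl}(2,\mathbb R)$ by left translation and with $\mathsf E^3$ by $\begin{pmatrix}a&b\\c&-a\end{pmatrix}\mapsto(a,\tfrac{b+c}2,\tfrac{b-c}2)$. Fix one of the two orientations of $\mathsf{AdS}^3$, given by the volume form $\varepsilon\,\mathsf{Det}$ with $\varepsilon=\pm1$. For a future-pointing null vector $v$ let $\mathcal W(v)$ be the open half-plane of vectors $w\in v^\perp$ with $\varepsilon\,\mathsf{Det}(v,u,w)>0$ for a future-pointing $u\notin v^\perp$ (the choice of $u$ does not matter). For $\mathbf s\in\mathsf E^3$ spacelike, the *Minkowski crooked plane* $\mathcal C_\varepsilon(\mathbf 0,\mathbf s)$ is the union of the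 stem $\{x\in\mathbf s^\perp: x\cdot x\le 0\}$ and of the wings $\mathcal W(v_1),\mathcal W(v_2)$, where $v_1,v_2$ are future-pointing generators of the two null lines in $\mathbf s^\perp$. For $p\in\mathsf{AdS}^3$ and a unit spacelike $\mathbf s\in T_p(\mathsf{AdS}^3)$, the *$\mathsf{AdS}$-crooked plane* $\mathsf C_\varepsilon(p,\mathbf s)$ is the union of the stem, i.e. of the non-spacelike geodesics through $p$ contained in the totally geodesic surface $\mathsf{Exp}_p(\mathbf s^\perp)$, and of the two wings $\mathsf{Exp}_p(\mathcal W(v_i))$. The tangent cone of a set at $p$ consists of the initial velocities of smooth paths $[0,\delta)\to\mathsf{AdS}^3$ that start at $p$ and stay in the set. $\mathsf{Ein}^3$ is the projectivized null cone of $X^2+Y^2-Z^2-UV$ on $\mathbb R^{3,2}$, $I_{\mathscr S}[X:Y:Z:U:V]=[X:Y:Z:V:U]$, and $\Psi:\mathrm{SL}(2,\mathbb R)\to\mathsf{Ein}^3$ is $\Psi\begin{pmatrix}a&b\\c&d\end{pmatrix}=[a-d:b+c:b-c:a+d-2:a+d+2]$. Photons are projectivized isotropic 2-planes; the lightcone $L(q)$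 is the union of the photons through $q$. A *stem configuration* $(q_0,q_\infty;q_1,q_2)$ consists of a vertex $q_0$ and a covertex $q_\infty$ not on a common photon, and of distinct hingepoints $q_1,q_2\in L(q_0)\cap L(q_\infty)$. The photons $q_0q_j$ and $q_\infty q_j$ are the hinges and cohinges; they cut the Einstein hypersphere $W$ spanned by the four points into four squares. The stem consists of the hinges, the cohinges and the two squares that meet timelike circles through $q_0$ and $q_\infty$. For each $j$ the photons $q_0q_j$ and $q_\infty q_j$ separate $L(q_j)$ into two bigons. A *crooked surface* with this stem configuration is the union of the stem and of two wings, one bigon of $L(q_1)$ and one of $L(q_2)$, lying on opposite sides of $W$ in the Minkowski patch $\mathsf{Ein}^3\setminus L(q_\infty)$. (So a stem configuration carries exactly two crooked surfaces, corresponding to the two orientations.) The configuration, or a crooked surface with it, is *$I_{\mathscr S}$-adapted* if $I_{\mathscr S}$ interchanges $q_0$ and $q_\infty$ and fixes $q_1$ and $q_2$. **Main Theorem.** (1) For either orientation $\varepsilon$, every $p\in\mathsf{AdS}^3$ and every unit spacelike $\mathbf s\in T_p(\mathsf{AdS}^3)$, the tangent cone at $p$ of $\mathsf C_\varepsilon(p,\mathbf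 s)$ is the crooked plane $\mathcal C_\varepsilon(\mathbf 0,\mathbf s)\subset T_p(\mathsf{AdS}^3)\cong\mathsf E^3$, and $\mathsf C_\varepsilon(p,\mathbf s)=\mathsf{Exp}_p\big(\mathcal C_\varepsilon(\mathbf 0,\mathbf s)\big)$. (2) $\Psi$ is a topological embedding. For all such $\varepsilon,p,\mathbf s$, let $\mathfrak C_\varepsilon(p,\mathbf s)$ be the closure in $\mathsf{Ein}^3$ of the image under $\Psi$ of the preimage of $\mathsf C_\varepsilon(p,\mathbf s)$ in $\mathrm{SL}(2,\mathbb R)$. For each lift $\hat p\in\mathrm{SL}(2,\mathbb R)$ of $p$, $\mathfrak C_\varepsilon(p,\mathbf s)$ is an $I_{\mathscr S}$-adapted crooked surface with vertex $\Psi(\hat p)$ and covertex $\Psi(-\hat p)$. (3) Conversely, every $I_{\mathscr S}$-adapted crooked surface in $\mathsf{Ein}^3$ equals $\mathfrak C_\varepsilon(p,\mathbf s)$ for some orientation $\varepsilon$, some $p\in\mathsf{AdS}^3$ and some unit spacelike $\mathbf s\in T_p(\mathsf{AdS}^3)$. Moreover, for each fixed orientation $\varepsilon$ and each $I_{\mathscr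 S}$-adapted stem configuration, there are $p$ and $\mathbf s$ such that $\mathfrak C_\varepsilon(p,\mathbf s)$ is a crooked surface with that stem configuration. -/

import Mathlib

open Module Set
open scoped LinearAlgebra.Projectivization ContDiff

noncomputable section

namespace CrookedSurfaces

/-! ### Minkowski space and its crooked planes -/

/-- Minkowski space `E³` with its Lorentzian vector space structure `ℝ^{2,1}`. -/
abbrev E3 : Type := Fin 3 → ℝ

/-- The Lorentzian inner product, with quadratic form `x² + y² - z²`. -/
def lor (v w : E3) : ℝ := v 0 * w 0 + v 1 * w 1 - v 2 * w 2

/-- The standard volume form on `ℝ^{2,1}`. -/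
def vol (u v w : E3) : ℝ := (Matrix.of ![u, v, w]).det

/-- Future-pointing (nonzero) causal vectors. -/
def FuturePointing (v : E3) : Prop := lor v v ≤ 0 ∧ 0 < v 2

/-- The two null directions orthogonal to a spacelike vector `s`, each represented by all of its
future-pointing generators. -/
def hingeDirections (s : E3) : Set E3 := {v | lor v v = 0 ∧ 0 < v 2 ∧ lor v s = 0}

/-- For a future-pointing null vector `v` and the orientation `ε · vol`, the component of
`v^⊥ ∖ ℝv` on which `ε · vol(v, u, ·)` is positive, where `u` is a future-pointing vector outside
`v^⊥`. -/
def nullHalfPlane (ε : ℤˣ) (v : E3) : Set E3 :=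
  {w | lor w v = 0 ∧ ∃ u, FuturePointing u ∧ lor u v ≠ 0 ∧ 0 < ((ε : ℤ) : ℝ) * vol v u w}

/-- The crooked plane in Minkowski space with vertex `p` and (spacelike) direction vector `s`:
the union of the stem and of the two wings. The sign `ε` is the chosen orientation. -/
def minkCrookedPlane (ε : ℤˣ) (p s : E3) : Set E3 :=
  {x | lor (x - p) s = 0 ∧ lor (x - p) (x - p) ≤ 0} ∪
    ⋃ v ∈ hingeDirections s, (fun w => p + w) '' nullHalfPlane ε v

/-! ### Anti-de Sitter space -/

/-- The double cover of anti-de Sitter space. -/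
abbrev SL2 : Type := Matrix.SpecialLinearGroup (Fin 2) ℝ

/-- Anti-de Sitter space, as the group `PSL(2,ℝ)`. -/
abbrev AdS : Type := Matrix.ProjectiveSpecialLinearGroup (Fin 2) ℝ

/-- The double covering `SL(2,ℝ) → PSL(2,ℝ)`. -/
def adsProj (g : SL2) : AdS := QuotientGroup.mk g

/-- The Lie algebra of traceless real `2 × 2` matrices. -/
abbrev sl2 : Type := LieAlgebra.SpecialLinear.sl (Fin 2) ℝ

/-- The tangent space of `AdS` at `p`, identified with the Lie algebra by left translation by `p`:
the element `ξ` stands for the vector `ĝ ξ` tangent to `SL(2,ℝ)` at a lift `ĝ` of `p`. -/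
abbrev TangentAdS (_p : AdS) : Type := sl2

/-- The bi-invariant Lorentzian metric, with quadratic form `-det A = tr (A²) / 2`. -/
def adsInner (A B : sl2) : ℝ := (1 / 2) * (A.1 * B.1).trace

theorem sl2_apply_one_one (A : sl2) : A.1 1 1 = -A.1 0 0 := by
  have h : A.1.trace = 0 := A.2
  rw [Matrix.trace_fin_two] at h
  linarith

/-- The linear identification of the tangent spaces of `AdS` with Minkowski space. -/
def coords : sl2 ≃ₗ[ℝ] E3 where
  toFun A := ![A.1 0 0, (A.1 0 1 + A.1 1 0) / 2, (A.1 0 1 - A.1 1 0) / 2]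
  map_add' A B := by
    ext i; fin_cases i <;> simp <;> ring
  map_smul' c A := by
    ext i; fin_cases i <;> simp <;> ring
  invFun v := ⟨!![v 0, v 1 + v 2; v 1 - v 2, -v 0], by
    show Matrix.trace (_ : Matrix (Fin 2) (Fin 2) ℝ) = 0
    simp [Matrix.trace_fin_two]⟩
  left_inv A := by
    have h := sl2_apply_one_one A
    apply Subtype.ext
    ext i j
    fin_cases i <;> fin_cases j <;> simp [h] <;> ring
  right_inv v := by
    ext i; fin_cases i <;> simp

/-- The identification is isometric. -/
theorem lor_coords (A B : sl2) : lor (coords A) (coords B) = adsInner A B := by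
  have hA := sl2_apply_one_one A
  have hB := sl2_apply_one_one B
  simp only [lor, coords, adsInner, LinearEquiv.coe_mk, LinearMap.coe_mk, AddHom.coe_mk,
    Matrix.trace_fin_two, Matrix.mul_apply, Fin.sum_univ_two, hA, hB]
  simp
  ring

theorem hasDerivAt_exp_entry (ξ : Matrix (Fin 2) (Fin 2) ℝ) (i j : Fin 2) (t : ℝ) :
    HasDerivAt (fun τ : ℝ => NormedSpace.exp (τ • ξ) i j)
      ((NormedSpace.exp (t • ξ) * ξ) i j) t := by
  let _ : NormedRing (Matrix (Fin 2) (Fin 2) ℝ) := Matrix.linftyOpNormedRing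
  let _ : NormedAlgebra ℝ (Matrix (Fin 2) (Fin 2) ℝ) := Matrix.linftyOpNormedAlgebra
  have h := hasDerivAt_exp_smul_const (𝕂 := ℝ) ξ t
  exact (hasDerivAt_pi.1 ((hasDerivAt_pi.1 h) i)) j

theorem det_exp_sl2 (ξ : sl2) : (NormedSpace.exp ξ.1).det = 1 := by
  have h1 := sl2_apply_one_one ξ
  set E : ℝ → Matrix (Fin 2) (Fin 2) ℝ := fun τ => NormedSpace.exp (τ • ξ.1) with hE
  have hd : ∀ t, HasDerivAt (fun τ => E τ 0 0 * E τ 1 1 - E τ 0 1 * E τ 1 0) 0 t := by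
    intro t
    have := ((hasDerivAt_exp_entry ξ.1 0 0 t).mul (hasDerivAt_exp_entry ξ.1 1 1 t)).sub
      ((hasDerivAt_exp_entry ξ.1 0 1 t).mul (hasDerivAt_exp_entry ξ.1 1 0 t))
    refine this.congr_deriv ?_
    simp only [Matrix.mul_apply, Fin.sum_univ_two, h1]
    ring
  have hc := is_const_of_deriv_eq_zero (fun t => (hd t).differentiableAt)
    (fun t => (hd t).deriv) 1 0
  rw [Matrix.det_fin_two]
  simpa [hE] using hc

/-- The exponential of a traceless matrix, as an element of `SL(2,ℝ)`. -/
def expSL (ξ : sl2) : SL2 := ⟨NormedSpace.exp ξ.1, det_exp_sl2 ξ⟩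

/-- The exponential map `T_p AdS → AdS`. -/
def adsExp (p : AdS) (ξ : TangentAdS p) : AdS := p * adsProj (expSL ξ)

/-- The geodesic with initial point `p` and initial velocity `ξ`, a left coset of a one-parameter
subgroup. By `isGeodesic_iff` below these are exactly the geodesics of the Lorentzian metric. -/
def adsGeodesic (p : AdS) (ξ : TangentAdS p) (t : ℝ) : AdS := adsExp p (t • ξ)

/-- The flat form of signature `(2,2)` on `2 × 2` matrices, with quadratic form `-det`. It induces
the bi-invariant Lorentzian metric on the hypersurface `SL(2,ℝ)`. -/
def ambientForm (X Y : Matrix (Fin 2) (Fin 2) ℝ) : ℝ :=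
  (1 / 2) * ((X * Y).trace - X.trace * Y.trace)

theorem ambientForm_self (X : Matrix (Fin 2) (Fin 2) ℝ) : ambientForm X X = -X.det := by
  simp only [ambientForm, Matrix.trace_fin_two, Matrix.mul_apply, Fin.sum_univ_two,
    Matrix.det_fin_two]
  ring

theorem ambientForm_left_translate (g : SL2) (A B : sl2) :
    ambientForm (g.1 * A.1) (g.1 * B.1) = adsInner A B := by
  have hA := sl2_apply_one_one A
  have hB := sl2_apply_one_one B
  have hg : g.1.det = 1 := g.2
  rw [Matrix.det_fin_two] at hg
  simp only [ambientForm, adsInner, Matrix.trace_fin_two, Matrix.mul_apply, Fin.sum_univ_two,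
    hA, hB]
  linear_combination (A.1 0 0 * B.1 0 0 + (A.1 0 1 * B.1 1 0 + A.1 1 0 * B.1 0 1) / 2) * hg

/-- Geodesics of the Levi-Civita connection of `AdS`: curves which lift to curves in the
hypersurface `SL(2,ℝ)` whose acceleration is everywhere normal to the hypersurface. -/
def IsGeodesic (γ : ℝ → AdS) : Prop :=
  ∃ g : ℝ → SL2, (∀ t, adsProj (g t) = γ t) ∧
    (∀ i j, ContDiff ℝ 2 (fun t => (g t).1 i j)) ∧
    ∀ (t : ℝ) (ξ : sl2),
      ambientForm (Matrix.of fun i j => deriv (deriv fun τ => (g τ).1 i j) t) ((g t).1 * ξ.1) = 0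

theorem isGeodesic_iff (γ : ℝ → AdS) :
    IsGeodesic γ ↔ ∃ (p : AdS) (ξ : TangentAdS p), γ = adsGeodesic p ξ := by
  constructor
  · rintro ⟨g, hg, hC, hN⟩
    have hdet : ∀ t, (g t).1 0 0 * (g t).1 1 1 - (g t).1 0 1 * (g t).1 1 0 = 1 := fun t => by
      rw [← Matrix.det_fin_two]; exact (g t).2
    let f : Fin 2 → Fin 2 → ℝ → ℝ := fun i j t => (g t).1 i j
    have h1 : ∀ i j t, HasDerivAt (f i j) (deriv (f i j) t) t := fun i j t =>
      ((hC i j).differentiable (by norm_num) t).hasDerivAt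
    have hC1 : ∀ i j, ContDiff ℝ 1 (deriv (f i j)) := fun i j =>
      ((contDiff_succ_iff_deriv (n := 1)).1 (by simpa using! hC i j)).2.2
    have h2 : ∀ i j t, HasDerivAt (deriv (f i j)) (deriv (deriv (f i j)) t) t := fun i j t =>
      ((hC1 i j).differentiable (by norm_num) t).hasDerivAt
    have e1 : ∀ t, deriv (f 0 0) t * f 1 1 t + f 0 0 t * deriv (f 1 1) t
        - (deriv (f 0 1) t * f 1 0 t + f 0 1 t * deriv (f 1 0) t) = 0 := fun t => by
      have hd := ((h1 0 0 t).mul (h1 1 1 t)).sub ((h1 0 1 t).mul (h1 1 0 t))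
      have hc : HasDerivAt (f 0 0 * f 1 1 - f 0 1 * f 1 0) 0 t := by
        have : f 0 0 * f 1 1 - f 0 1 * f 1 0 = fun _ => (1 : ℝ) := by
          funext τ; exact hdet τ
        rw [this]; exact hasDerivAt_const t 1
      exact hd.unique hc
    have e2 : ∀ t, deriv (deriv (f 0 0)) t * f 1 1 t + 2 * deriv (f 0 0) t * deriv (f 1 1) t
        + f 0 0 t * deriv (deriv (f 1 1)) t - deriv (deriv (f 0 1)) t * f 1 0 t
        - 2 * deriv (f 0 1) t * deriv (f 1 0) t - f 0 1 t * deriv (deriv (f 1 0)) t = 0 := by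
      intro t
      have hd := (((h2 0 0 t).mul (h1 1 1 t)).add ((h1 0 0 t).mul (h2 1 1 t))).sub
        (((h2 0 1 t).mul (h1 1 0 t)).add ((h1 0 1 t).mul (h2 1 0 t)))
      have hc : HasDerivAt (deriv (f 0 0) * f 1 1 + f 0 0 * deriv (f 1 1)
          - (deriv (f 0 1) * f 1 0 + f 0 1 * deriv (f 1 0))) 0 t := by
        have : deriv (f 0 0) * f 1 1 + f 0 0 * deriv (f 1 1)
          - (deriv (f 0 1) * f 1 0 + f 0 1 * deriv (f 1 0)) = fun _ => (0 : ℝ) := by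
          funext τ; exact e1 τ
        rw [this]; exact hasDerivAt_const t 0
      linear_combination hd.unique hc
    have key : ∀ t (v : E3),
        v 0 * (f 1 1 t * deriv (deriv (f 0 0)) t - f 0 1 t * deriv (deriv (f 1 0)) t
          + f 1 0 t * deriv (deriv (f 0 1)) t - f 0 0 t * deriv (deriv (f 1 1)) t)
        + (v 1 + v 2) * (f 0 0 t * deriv (deriv (f 1 0)) t - f 1 0 t * deriv (deriv (f 0 0)) t)
        + (v 1 - v 2) * (f 1 1 t * deriv (deriv (f 0 1)) t - f 0 1 t * deriv (deriv (f 1 1)) t)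
        = 0 := by
      intro t v
      have h := hN t (coords.symm v)
      simp [ambientForm, coords, Matrix.trace_fin_two, Matrix.mul_apply] at h
      simp only [f]
      linear_combination h
    have k0 : ∀ t, _ := fun t => key t ![1, 0, 0]
    have k1 : ∀ t, _ := fun t => key t ![0, 1, 1]
    have k2 : ∀ t, _ := fun t => key t ![0, 1, -1]
    simp at k0 k1 k2
    have cst : ∀ (w : ℝ → ℝ), (∀ t, HasDerivAt w 0 t) → ∀ t, w t = w 0 := fun w hw t =>
      is_const_of_deriv_eq_zero (fun t => (hw t).differentiableAt) (fun t => (hw t).deriv) t 0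
    have cα := cst (f 1 1 * deriv (f 0 0) - f 0 1 * deriv (f 1 0)) fun t =>
      (((h1 1 1 t).mul (h2 0 0 t)).sub ((h1 0 1 t).mul (h2 1 0 t))).congr_deriv (by
        linear_combination (1 / 2 : ℝ) * e2 t + (1 / 2 : ℝ) * k0 t)
    have cβ := cst (f 1 1 * deriv (f 0 1) - f 0 1 * deriv (f 1 1)) fun t =>
      (((h1 1 1 t).mul (h2 0 1 t)).sub ((h1 0 1 t).mul (h2 1 1 t))).congr_deriv (by
        linear_combination k2 t)
    have cγ := cst (f 0 0 * deriv (f 1 0) - f 1 0 * deriv (f 0 0)) fun t =>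
      (((h1 0 0 t).mul (h2 1 0 t)).sub ((h1 1 0 t).mul (h2 0 0 t))).congr_deriv (by
        linear_combination k1 t)
    simp only [Pi.sub_apply, Pi.mul_apply] at cα cβ cγ
    obtain ⟨α, hα⟩ : ∃ α, α = f 1 1 0 * deriv (f 0 0) 0 - f 0 1 0 * deriv (f 1 0) 0 := ⟨_, rfl⟩
    obtain ⟨β, hβ⟩ : ∃ β, β = f 1 1 0 * deriv (f 0 1) 0 - f 0 1 0 * deriv (f 1 1) 0 := ⟨_, rfl⟩
    obtain ⟨δ, hδ⟩ : ∃ δ, δ = f 0 0 0 * deriv (f 1 0) 0 - f 1 0 0 * deriv (f 0 0) 0 := ⟨_, rfl⟩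
    rw [← hα] at cα
    rw [← hβ] at cβ
    rw [← hδ] at cγ
    let ξ : sl2 := ⟨!![α, β; δ, -α], by
      show Matrix.trace (_ : Matrix (Fin 2) (Fin 2) ℝ) = 0
      simp [Matrix.trace_fin_two]⟩
    have hdet' : ∀ t, f 0 0 t * f 1 1 t - f 0 1 t * f 1 0 t = 1 := hdet
    have d00 : ∀ t, HasDerivAt (f 0 0) (f 0 0 t * α + f 0 1 t * δ) t := fun t =>
      (h1 0 0 t).congr_deriv (by
        linear_combination (-deriv (f 0 0) t) * hdet' t + f 0 0 t * cα t + f 0 1 t * cγ t)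
    have d10 : ∀ t, HasDerivAt (f 1 0) (f 1 0 t * α + f 1 1 t * δ) t := fun t =>
      (h1 1 0 t).congr_deriv (by
        linear_combination (-deriv (f 1 0) t) * hdet' t + f 1 0 t * cα t + f 1 1 t * cγ t)
    have cα' : ∀ t, f 0 0 t * deriv (f 1 1) t - f 1 0 t * deriv (f 0 1) t = -α := fun t => by
      linear_combination e1 t - cα t
    have d01 : ∀ t, HasDerivAt (f 0 1) (f 0 0 t * β - f 0 1 t * α) t := fun t =>
      (h1 0 1 t).congr_deriv (by
        linear_combination (-deriv (f 0 1) t) * hdet' t + f 0 0 t * cβ t + f 0 1 t * cα' t)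
    have d11 : ∀ t, HasDerivAt (f 1 1) (f 1 0 t * β - f 1 1 t * α) t := fun t =>
      (h1 1 1 t).congr_deriv (by
        linear_combination (-deriv (f 1 1) t) * hdet' t + f 1 0 t * cβ t + f 1 1 t * cα' t)
    let E : Fin 2 → Fin 2 → ℝ → ℝ := fun i j t => NormedSpace.exp (t • ξ.1) i j
    have hE : ∀ i j t, HasDerivAt (E i j) (E i 0 t * ξ.1 0 j + E i 1 t * ξ.1 1 j) t :=
      fun i j t => (hasDerivAt_exp_entry ξ.1 i j t).congr_deriv (by
        simp [E, Matrix.mul_apply])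
    have hE0 : ∀ i j, E i j 0 = (1 : Matrix (Fin 2) (Fin 2) ℝ) i j := fun i j => by simp [E]
    have hEdet : ∀ t, E 0 0 t * E 1 1 t - E 0 1 t * E 1 0 t = 1 := fun t => by
      have := det_exp_sl2 (t • ξ)
      rw [Matrix.det_fin_two] at this
      exact this
    have x00 : ξ.1 0 0 = α := rfl
    have x01 : ξ.1 0 1 = β := rfl
    have x10 : ξ.1 1 0 = δ := rfl
    have x11 : ξ.1 1 1 = -α := rfl
    have row : ∀ (u v : ℝ → ℝ), (∀ t, HasDerivAt u (u t * α + v t * δ) t) →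
        (∀ t, HasDerivAt v (u t * β - v t * α) t) → ∀ t,
        u t = u 0 * E 0 0 t + v 0 * E 1 0 t ∧ v t = u 0 * E 0 1 t + v 0 * E 1 1 t := by
      intro u v hu hv t
      have c1 := cst (u * E 1 1 - v * E 1 0) (fun t =>
        (((hu t).mul (hE 1 1 t)).sub ((hv t).mul (hE 1 0 t))).congr_deriv (by
          rw [x00, x01, x10, x11]; ring)) t
      have c2 := cst (v * E 0 0 - u * E 0 1) (fun t =>
        (((hv t).mul (hE 0 0 t)).sub ((hu t).mul (hE 0 1 t))).congr_deriv (by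
          rw [x00, x01, x10, x11]; ring)) t
      simp [hE0] at c1 c2
      constructor
      · linear_combination (-u t) * hEdet t + E 0 0 t * c1 + E 1 0 t * c2
      · linear_combination (-v t) * hEdet t + E 0 1 t * c1 + E 1 1 t * c2
    refine ⟨adsProj (g 0), ξ, ?_⟩
    funext t
    rw [← hg t]
    show adsProj (g t) = adsProj (g 0) * adsProj (expSL (t • ξ))
    have : g t = g 0 * expSL (t • ξ) := by
      apply Subtype.ext
      have r0 := row (f 0 0) (f 0 1) d00 d01 t
      have r1 := row (f 1 0) (f 1 1) d10 d11 t
      ext i j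
      rw [Matrix.SpecialLinearGroup.coe_mul, Matrix.mul_apply, Fin.sum_univ_two]
      fin_cases i <;> fin_cases j
      · exact r0.1
      · exact r0.2
      · exact r1.1
      · exact r1.2
    rw [this]
    rfl
  · rintro ⟨p, ξ, rfl⟩
    induction p using QuotientGroup.induction_on with
    | H q =>
    have x11 := sl2_apply_one_one ξ
    let F : Fin 2 → Fin 2 → ℝ → ℝ := fun i j t => (q * expSL (t • ξ)).1 i j
    have hM : ∀ t : ℝ, (q * expSL (t • ξ)).1 = q.1 * NormedSpace.exp (t • ξ.1) :=
      fun t => Matrix.SpecialLinearGroup.coe_mul _ _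
    have hF : ∀ i j t, HasDerivAt (F i j) (F i 0 t * ξ.1 0 j + F i 1 t * ξ.1 1 j) t := by
      intro i j t
      have h := ((hasDerivAt_exp_entry ξ.1 0 j t).const_mul (q.1 i 0)).add
        ((hasDerivAt_exp_entry ξ.1 1 j t).const_mul (q.1 i 1))
      refine (h.congr_deriv ?_).congr_of_eventuallyEq (Filter.Eventually.of_forall fun τ => ?_)
      · simp only [F, hM, Matrix.mul_apply, Fin.sum_univ_two]; ring
      · simp only [F, hM, Matrix.mul_apply, Fin.sum_univ_two, Pi.add_apply]
    have hdF : ∀ i j, deriv (F i j) = fun t => F i 0 t * ξ.1 0 j + F i 1 t * ξ.1 1 j :=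
      fun i j => funext fun t => (hF i j t).deriv
    have hF2 : ∀ i j t, HasDerivAt (deriv (F i j))
        ((ξ.1 0 0 * ξ.1 0 0 + ξ.1 0 1 * ξ.1 1 0) * F i j t) t := by
      intro i j t
      rw [hdF]
      refine (((hF i 0 t).mul_const _).add ((hF i 1 t).mul_const _)).congr_deriv ?_
      fin_cases j <;> simp [x11] <;> ring
    refine ⟨fun t => q * expSL (t • ξ), fun t => rfl, fun i j => ?_, fun t η => ?_⟩
    · have hcF : ∀ i j, Continuous (F i j) := fun i j =>
        continuous_iff_continuousAt.2 fun t => (hF i j t).continuousAt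
      have : ContDiff ℝ (1 + 1) (F i j) := by
        rw [contDiff_succ_iff_deriv]
        refine ⟨fun t => (hF i j t).differentiableAt, by simp, ?_⟩
        rw [contDiff_one_iff_deriv]
        refine ⟨fun t => (hF2 i j t).differentiableAt, ?_⟩
        rw [show deriv (deriv (F i j)) = _ from funext fun t => (hF2 i j t).deriv]
        exact continuous_const.mul (hcF i j)
      simpa [one_add_one_eq_two] using! this
    · have : (Matrix.of fun i j => deriv (deriv fun τ => (q * expSL (τ • ξ)).1 i j) t)
          = (ξ.1 0 0 * ξ.1 0 0 + ξ.1 0 1 * ξ.1 1 0) • (q * expSL (t • ξ)).1 := by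
        ext i j
        exact (hF2 i j t).deriv
      rw [this]
      have hd : (q * expSL (t • ξ)).1.det = 1 := (q * expSL (t • ξ)).2
      rw [Matrix.det_fin_two] at hd
      have y11 := sl2_apply_one_one η
      generalize (q * expSL (t • ξ)).1 = M
      simp [ambientForm, Matrix.trace_fin_two, Matrix.mul_apply, y11]
      ring

/-! ### Crooked planes in anti-de Sitter space -/

/-- The totally geodesic plane `Exp_p(s^⊥)`. -/
def stemPlane (p : AdS) (s : TangentAdS p) : Set AdS := adsExp p '' {ξ | adsInner ξ s = 0}

/-- The stem: the union of the non-spacelike geodesics through `p` lying in `Exp_p(s^⊥)`. -/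
def adsStem (p : AdS) (s : TangentAdS p) : Set AdS :=
  {x | ∃ ξ : TangentAdS p, adsInner ξ ξ ≤ 0 ∧ (∀ t, adsGeodesic p ξ t ∈ stemPlane p s) ∧
    ∃ t, x = adsGeodesic p ξ t}

/-- The wing attached to the null geodesic through `p` with future-pointing direction `v`, for the
orientation of `AdS` given by the bi-invariant volume form `ε · vol`. -/
def adsWing (ε : ℤˣ) (p : AdS) (v : TangentAdS p) : Set AdS :=
  adsExp p '' {w | coords w ∈ nullHalfPlane ε (coords v)}

/-- The crooked plane in `AdS` with vertex `p` and direction vector `s`: the union of the stem and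
of the wings attached to its two hinges. -/
def adsCrookedPlane (ε : ℤˣ) (p : AdS) (s : TangentAdS p) : Set AdS :=
  adsStem p s ∪ ⋃ v ∈ {v : TangentAdS p | coords v ∈ hingeDirections (coords s)}, adsWing ε p v

/-- The tangent cone at `p` of a subset `A` of `AdS`: the initial velocities of the smooth paths
`[0,δ) → A` starting at `p`. (Paths in `AdS` are given by their lifts to `SL(2,ℝ)`.) -/
def tangentCone (A : Set AdS) (p : AdS) : Set (TangentAdS p) :=
  {ξ | ∃ (δ : ℝ) (g : ℝ → SL2), 0 < δ ∧ adsProj (g 0) = p ∧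
    (∀ t ∈ Ico 0 δ, adsProj (g t) ∈ A) ∧
    (∀ i j, ContDiffOn ℝ ∞ (fun t => (g t).1 i j) (Ico 0 δ)) ∧
    ∀ i j, HasDerivWithinAt (fun t => (g t).1 i j) (((g 0).1 * ξ.1) i j) (Ico 0 δ) 0}

/-! ### The Einstein universe -/

/-- The space `ℝ^{3,2}`, with coordinates `(X, Y, Z, U, V)`. -/
abbrev R32 : Type := Fin 5 → ℝ

/-- The quadratic form `X² + Y² - Z² - UV`. -/
def einQ (v : R32) : ℝ := v 0 ^ 2 + v 1 ^ 2 - v 2 ^ 2 - v 3 * v 4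

/-- The quotient topology on the projective space of `ℝ^{3,2}`. -/
instance : TopologicalSpace (ℙ ℝ R32) :=
  inferInstanceAs (TopologicalSpace (Quotient (projectivizationSetoid ℝ R32)))

/-- The Einstein universe `Ein³`: the lines contained in the null cone. -/
abbrev Ein3 : Type := {x : ℙ ℝ R32 // ∀ v ∈ x.submodule, einQ v = 0}

theorem einQ_smul (c : ℝ) (v : R32) : einQ (c • v) = c ^ 2 * einQ v := by
  simp [einQ]; ring

/-- The point of `Ein³` with given homogeneous coordinates. -/
def Ein3.mk (v : R32) (hv : v ≠ 0) (hQ : einQ v = 0) : Ein3 :=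
  ⟨Projectivization.mk ℝ v hv, by
    intro w hw
    rw [Projectivization.submodule_mk, Submodule.mem_span_singleton] at hw
    obtain ⟨c, rfl⟩ := hw
    rw [einQ_smul, hQ, mul_zero]⟩

/-- The points of `Ein³` lying in a linear subspace of `ℝ^{3,2}`. -/
def einSection (F : Submodule ℝ R32) : Set Ein3 := {x | x.1.submodule ≤ F}

/-- The linear map interchanging the coordinates `U` and `V`. -/
def swapUV : R32 ≃ₗ[ℝ] R32 := LinearEquiv.funCongrLeft ℝ ℝ (Equiv.swap (3 : Fin 5) 4)

theorem einQ_swapUV (v : R32) : einQ (swapUV v) = einQ v := by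
  have h0 : swapUV v 0 = v 0 := by
    simp [swapUV, LinearEquiv.funCongrLeft, LinearMap.funLeft, Equiv.swap_apply_def]
  have h1 : swapUV v 1 = v 1 := by
    simp [swapUV, LinearEquiv.funCongrLeft, LinearMap.funLeft, Equiv.swap_apply_def]
  have h2 : swapUV v 2 = v 2 := by
    simp [swapUV, LinearEquiv.funCongrLeft, LinearMap.funLeft, Equiv.swap_apply_def]
  have h3 : swapUV v 3 = v 4 := by
    simp [swapUV, LinearEquiv.funCongrLeft, LinearMap.funLeft]
  have h4 : swapUV v 4 = v 3 := by
    simp [swapUV, LinearEquiv.funCongrLeft, LinearMap.funLeft]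
  simp only [einQ, h0, h1, h2, h3, h4]
  ring

/-- The involution `[X:Y:Z:U:V] ↦ [X:Y:Z:V:U]` of `Ein³`. -/
def involution (x : Ein3) : Ein3 :=
  ⟨Projectivization.map swapUV.toLinearMap swapUV.injective x.1, by
    obtain ⟨x, hx⟩ := x
    induction x using Projectivization.ind with
    | h v hv =>
    intro w hw
    rw [Projectivization.map_mk, Projectivization.submodule_mk,
      Submodule.mem_span_singleton] at hw
    obtain ⟨c, rfl⟩ := hw
    rw [einQ_smul, LinearEquiv.coe_coe, einQ_swapUV,
      hx v (by rw [Projectivization.submodule_mk]; exact Submodule.mem_span_singleton_self v),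
      mul_zero]⟩

/-- The coordinates `(a - d, b + c, b - c, a + d - 2, a + d + 2)` of the map `Ψ`. -/
def psiVec (g : SL2) : R32 :=
  ![g.1 0 0 - g.1 1 1, g.1 0 1 + g.1 1 0, g.1 0 1 - g.1 1 0,
    g.1 0 0 + g.1 1 1 - 2, g.1 0 0 + g.1 1 1 + 2]

theorem psiVec_ne_zero (g : SL2) : psiVec g ≠ 0 := by
  intro h
  have h3 := congrFun h 3
  have h4 := congrFun h 4
  simp [psiVec] at h3 h4
  linarith

theorem einQ_psiVec (g : SL2) : einQ (psiVec g) = 0 := by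
  have hg : g.1.det = 1 := g.2
  rw [Matrix.det_fin_two] at hg
  simp [einQ, psiVec]
  linear_combination (-4 : ℝ) * hg

/-- The map `Ψ : SL(2,ℝ) → Ein³`. -/
def psi (g : SL2) : Ein3 := Ein3.mk (psiVec g) (psiVec_ne_zero g) (einQ_psiVec g)

/-! ### Crooked surfaces -/

/-- Photons: projectivized isotropic `2`-planes. -/
def IsPhoton (φ : Set Ein3) : Prop :=
  ∃ P : Submodule ℝ R32, finrank ℝ P = 2 ∧ (∀ v ∈ P, einQ v = 0) ∧ φ = einSection P

/-- The lightcone of `p`: the union of the photons through `p`. -/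
def lightcone (p : Ein3) : Set Ein3 := {x | ∃ φ, IsPhoton φ ∧ p ∈ φ ∧ x ∈ φ}

/-- The Minkowski patch of `p`. -/
def minkowskiPatch (p : Ein3) : Set Ein3 := (lightcone p)ᶜ

/-- The photon through two distinct incident points `p`, `q`. -/
def photonThrough (p q : Ein3) : Set Ein3 := {x | ∃ φ, IsPhoton φ ∧ p ∈ φ ∧ q ∈ φ ∧ x ∈ φ}

/-- Timelike circles: projectivized null cones of `3`-dimensional subspaces of
signature `(1,2)`. -/
def IsTimelikeCircle (K : Set Ein3) : Prop :=
  ∃ F N : Submodule ℝ R32, finrank ℝ F = 3 ∧ N ≤ F ∧ finrank ℝ N = 2 ∧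
    (∀ v ∈ N, v ≠ 0 → einQ v < 0) ∧ (∃ v ∈ F, 0 < einQ v) ∧ K = einSection F

/-- A stem configuration `(q₀, q_∞; q₁, q₂)`; the hingepoints `q₁`, `q₂` are `hingept 0`,
`hingept 1`. -/
structure StemConfiguration where
  vertex : Ein3
  covertex : Ein3
  hingept : Fin 2 → Ein3
  not_incident : covertex ∉ lightcone vertex
  hingept_ne : hingept 0 ≠ hingept 1
  hingept_mem : ∀ j, hingept j ∈ lightcone vertex ∩ lightcone covertex

namespace StemConfiguration

variable (c : StemConfiguration)

/-- The hinge through the hingepoint `q_j`. -/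
def hinge (j : Fin 2) : Set Ein3 := photonThrough c.vertex (c.hingept j)

/-- The cohinge through the hingepoint `q_j`. -/
def cohinge (j : Fin 2) : Set Ein3 := photonThrough c.covertex (c.hingept j)

/-- The Einstein hypersphere containing the configuration. -/
def hypersphere : Set Ein3 :=
  einSection (c.vertex.1.submodule ⊔ c.covertex.1.submodule ⊔
    (c.hingept 0).1.submodule ⊔ (c.hingept 1).1.submodule)

/-- The union of the hinges and the cohinges. -/
def edges : Set Ein3 := ⋃ j, (c.hinge j ∪ c.cohinge j)

/-- The squares into which the hinges and cohinges decompose the hypersphere. -/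
def IsSquare (T : Set Ein3) : Prop :=
  ∃ x ∈ c.hypersphere \ c.edges, T = connectedComponentIn (c.hypersphere \ c.edges) x

/-- The squares containing timelike directions emanating from the vertex and the covertex: those
which meet a timelike circle through the vertex and the covertex. -/
def IsStemSquare (T : Set Ein3) : Prop :=
  c.IsSquare T ∧ ∃ K, IsTimelikeCircle K ∧ c.vertex ∈ K ∧ c.covertex ∈ K ∧ (T ∩ K).Nonempty

/-- The bigons into which the hinge and the cohinge through `q_j` separate its lightcone. -/
def IsBigon (j : Fin 2) (B : Set Ein3) : Prop :=
  ∃ x ∈ lightcone (c.hingept j) \ (c.hinge j ∪ c.cohinge j),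
    B = connectedComponentIn (lightcone (c.hingept j) \ (c.hinge j ∪ c.cohinge j)) x

/-- `S` is a crooked surface with stem configuration `c`: the union of the stem (two squares
together with the hinges and cohinges) and of two wings. The wings are bigons of the lightcones of
the two hingepoints, lying on opposite sides of the hypersphere in the Minkowski patch of the
covertex. -/
def IsCrookedSurface (S : Set Ein3) : Prop :=
  ∃ W₁ W₂ : Set Ein3, c.IsBigon 0 W₁ ∧ c.IsBigon 1 W₂ ∧
    (∀ x ∈ W₁, ∀ y ∈ W₂,
      y ∉ connectedComponentIn (minkowskiPatch c.covertex \ c.hypersphere) x) ∧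
    S = ⋃₀ {T | c.IsStemSquare T} ∪ c.edges ∪ W₁ ∪ W₂

/-- The involution interchanges the vertex and the covertex and fixes both hingepoints. -/
def IsAdapted : Prop :=
  involution c.vertex = c.covertex ∧ involution c.covertex = c.vertex ∧
    ∀ j, involution (c.hingept j) = c.hingept j

end StemConfiguration

/-- The closure in `Ein³` of the image under `Ψ` of the inverse image in `SL(2,ℝ)` of an
`AdS`-crooked plane. -/
def completedCrookedPlane (ε : ℤˣ) (p : AdS) (s : TangentAdS p) : Set Ein3 :=
  closure (psi '' (adsProj ⁻¹' adsCrookedPlane ε p s))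

end CrookedSurfaces

end

noncomputable section

namespace CrookedSurfaces

/-! ### The exponential of a traceless matrix -/

/-! The argument rests on homogeneity. Unit spacelike vectors form a single adjoint orbit
(`exists_conj_eq`), so with `p = [g]` and `s = Ad(h) diag(1,-1)` the map `x ↦ g h x h⁻¹` carries one
model crooked plane, with vertex `1` and direction `diag(1,-1)`, to the given one. In the model,
traceless matrices `(a, b; c, -a)` satisfy `ξ² = (a² + bc)·1`, so `exp ξ` lies in the span of `1`
and `ξ`. The crooked cone (stem `a = 0`, `bc ≤ 0`; wings `c = 0`, `εa > 0` and `b = 0`, `εa < 0`)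
therefore exponentiates, up to sign, onto the semialgebraic set `crookedSheet` of `SL(2,ℝ)`
(`mem_crookedSheet_iff`). For the tangent cone, the paths `exp (tξ)` realize every vector of the
crooked cone. Conversely, the difference quotients of a path in the sheet satisfy the weak form of
the cone conditions, which is closed and describes the same set.

On the conformal side a vector of `ℝ^{3,2}` is a pair of a `2 × 2` matrix `M` and a number `t`, with
quadratic form `4 (t² - det M)`. Then `Ψ(g)` is the class of `(g, 1)`, the involution is `t ↦ -t`,
and `SL(2,ℝ) × SL(2,ℝ)` acts isometrically by `M ↦ k M h⁻¹`. For the stem configuration with vertex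
`Ψ(1)` and covertex `Ψ(-1)` everything is explicit: the hypersphere is `X = 0`, the stem squares
make up `X = 0`, `Y² < Z²`, and the bigons of the two lightcones `Y = ±Z` are told apart by the sign
of `X(U+V)`. This yields exactly two crooked surfaces `stdSurface σ`. The one with `σ = ε` pulls
back under `Ψ` to the sheet and is the closure of its image (`closure_psi_image_crookedSheet`).

For the converse, an adapted configuration has vertex `Ψ(g)`, and its hingepoints have `t = 0`.
Incidence with `Ψ(g)` makes `g⁻¹M` nilpotent, so each hingepoint amounts to a line in `ℝ²`. Two
distinct lines are spanned by the columns of some `h ∈ SL(2,ℝ)`, and `(gh, h)` then carries the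
standard configuration to the given one (`exists_biAct_eq`). -/

theorem exp_smul_eq_of_hasDerivAt (ξ : Matrix (Fin 2) (Fin 2) ℝ)
    (F : ℝ → Matrix (Fin 2) (Fin 2) ℝ) (h0 : F 0 = 1)
    (hF : ∀ t i j, HasDerivAt (fun τ => F τ i j) ((F t * ξ) i j) t) (t : ℝ) :
    NormedSpace.exp (t • ξ) = F t := by
  let _ : NormedRing (Matrix (Fin 2) (Fin 2) ℝ) := Matrix.linftyOpNormedRing
  let _ : NormedAlgebra ℝ (Matrix (Fin 2) (Fin 2) ℝ) := Matrix.linftyOpNormedAlgebra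
  have hd : ∀ τ, HasDerivAt F (F τ * ξ) τ := fun τ =>
    hasDerivAt_pi.2 fun i => hasDerivAt_pi.2 fun j => hF τ i j
  -- Uniqueness for `F' = Fξ`: the product `F(τ) exp(-τξ)` is constant.
  have hc : ∀ τ, HasDerivAt (fun τ => F τ * NormedSpace.exp (τ • (-ξ))) 0 τ := fun τ =>
    ((hd τ).mul (hasDerivAt_exp_smul_const' (𝕂 := ℝ) (-ξ) τ)).congr_deriv (by
      rw [neg_mul, mul_neg, mul_assoc, add_neg_cancel])
  have h := is_const_of_deriv_eq_zero (fun τ => (hc τ).differentiableAt)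
    (fun τ => (hc τ).deriv) t 0
  simp only [h0, zero_smul, NormedSpace.exp_zero, mul_one] at h
  have hE : NormedSpace.exp (t • -ξ) * NormedSpace.exp (t • ξ) = 1 := by
    rw [← Matrix.exp_add_of_commute, smul_neg, neg_add_cancel, NormedSpace.exp_zero]
    rw [smul_neg]; exact (Commute.refl _).neg_left
  calc NormedSpace.exp (t • ξ) = F t * NormedSpace.exp (t • -ξ) * NormedSpace.exp (t • ξ) := by
        rw [h, one_mul]
    _ = F t := by rw [mul_assoc, hE, mul_one]

theorem sl2_mul_self (ξ : sl2) :
    ξ.1 * ξ.1 = (ξ.1 0 0 ^ 2 + ξ.1 0 1 * ξ.1 1 0) • (1 : Matrix (Fin 2) (Fin 2) ℝ) := by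
  have h := sl2_apply_one_one ξ
  ext i j
  fin_cases i <;> fin_cases j <;> simp [Matrix.mul_apply, Fin.sum_univ_two, h] <;> ring

/-- By Cayley–Hamilton `ξ² = q·1` with `q = -det ξ`, so `f·1 + g·ξ` solves `F' = Fξ` as soon as `f'
= q g` and `g' = f`. The sign of `q` decides between hyperbolic, elliptic and parabolic solutions.
-/
theorem exp_eq_of_hasDerivAt (ξ : sl2) (f g : ℝ → ℝ) (hf0 : f 0 = 1) (hg0 : g 0 = 0)
    (hf : ∀ t, HasDerivAt f ((ξ.1 0 0 ^ 2 + ξ.1 0 1 * ξ.1 1 0) * g t) t)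
    (hg : ∀ t, HasDerivAt g (f t) t) :
    NormedSpace.exp ξ.1 = f 1 • (1 : Matrix (Fin 2) (Fin 2) ℝ) + g 1 • ξ.1 := by
  have := exp_smul_eq_of_hasDerivAt ξ.1 (fun t => f t • (1 : Matrix (Fin 2) (Fin 2) ℝ) + g t • ξ.1)
    (by simp [hf0, hg0]) (fun t i j => by
      rw [add_mul, smul_mul_assoc, smul_mul_assoc, sl2_mul_self, one_mul]
      refine (((hf t).mul_const ((1 : Matrix (Fin 2) (Fin 2) ℝ) i j)).add
        ((hg t).mul_const (ξ.1 i j))).congr_deriv ?_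
      simp only [Matrix.add_apply, Matrix.smul_apply, smul_eq_mul]
      ring) 1
  rwa [one_smul] at this

theorem exp_hyperbolic (ξ : sl2) (κ : ℝ) (hκ : κ ≠ 0)
    (h : ξ.1 0 0 ^ 2 + ξ.1 0 1 * ξ.1 1 0 = κ ^ 2) :
    NormedSpace.exp ξ.1 =
      Real.cosh κ • (1 : Matrix (Fin 2) (Fin 2) ℝ) + (Real.sinh κ / κ) • ξ.1 := by
  have := exp_eq_of_hasDerivAt ξ (fun t => Real.cosh (t * κ)) (fun t => Real.sinh (t * κ) / κ)
    (by simp) (by simp)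
    (fun t => ((hasDerivAt_id t).mul_const κ).cosh.congr_deriv (by
      rw [h]; field_simp; simp [mul_comm]))
    (fun t => (((hasDerivAt_id t).mul_const κ).sinh.div_const κ).congr_deriv (by
      field_simp; simp [mul_comm]))
  simpa using this

theorem exp_elliptic (ξ : sl2) (θ : ℝ) (hθ : θ ≠ 0)
    (h : ξ.1 0 0 ^ 2 + ξ.1 0 1 * ξ.1 1 0 = -θ ^ 2) :
    NormedSpace.exp ξ.1 =
      Real.cos θ • (1 : Matrix (Fin 2) (Fin 2) ℝ) + (Real.sin θ / θ) • ξ.1 := by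
  have := exp_eq_of_hasDerivAt ξ (fun t => Real.cos (t * θ)) (fun t => Real.sin (t * θ) / θ)
    (by simp) (by simp)
    (fun t => ((hasDerivAt_id t).mul_const θ).cos.congr_deriv (by
      rw [h]; field_simp; simp [mul_comm]))
    (fun t => (((hasDerivAt_id t).mul_const θ).sin.div_const θ).congr_deriv (by
      field_simp; simp [mul_comm]))
  simpa using this

theorem exp_parabolic (ξ : sl2) (h : ξ.1 0 0 ^ 2 + ξ.1 0 1 * ξ.1 1 0 = 0) :
    NormedSpace.exp ξ.1 = 1 + ξ.1 := by
  have := exp_eq_of_hasDerivAt ξ (fun _ => 1) (fun t => t) rfl rfl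
    (fun t => (hasDerivAt_const t 1).congr_deriv (by rw [h, zero_mul]))
    (fun t => hasDerivAt_id t)
  simpa using this

theorem exists_exp_eq (ξ : sl2) :
    ∃ a b : ℝ, NormedSpace.exp ξ.1 = a • (1 : Matrix (Fin 2) (Fin 2) ℝ) + b • ξ.1 := by
  rcases lt_trichotomy (ξ.1 0 0 ^ 2 + ξ.1 0 1 * ξ.1 1 0) 0 with h | h | h
  · refine ⟨_, _, exp_elliptic ξ (√(-(ξ.1 0 0 ^ 2 + ξ.1 0 1 * ξ.1 1 0))) ?_ ?_⟩
    · exact (Real.sqrt_pos.2 (by linarith)).ne'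
    · rw [Real.sq_sqrt (by linarith)]; ring
  · exact ⟨1, 1, by rw [exp_parabolic ξ h]; simp⟩
  · refine ⟨_, _, exp_hyperbolic ξ (√(ξ.1 0 0 ^ 2 + ξ.1 0 1 * ξ.1 1 0)) ?_ ?_⟩
    · exact (Real.sqrt_pos.2 h).ne'
    · rw [Real.sq_sqrt h.le]

theorem expSL_zero : expSL 0 = 1 := by
  apply Subtype.ext
  simp [expSL]

/-! ### The projection `SL(2,ℝ) → PSL(2,ℝ)` -/

theorem adsProj_surjective : Function.Surjective adsProj := QuotientGroup.mk_surjective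

/-- Central elements are scalar matrices `r·1` with `r² = 1`. -/
theorem adsProj_eq_iff (g g' : SL2) : adsProj g = adsProj g' ↔ g' = g ∨ g' = -g := by
  unfold adsProj
  rw [QuotientGroup.eq, Matrix.SpecialLinearGroup.mem_center_iff]
  constructor
  · rintro ⟨r, hr, h⟩
    rw [Fintype.card_fin] at hr
    rcases mul_self_eq_one_iff.1 ((pow_two r).symm.trans hr) with rfl | rfl
    · left
      have : g⁻¹ * g' = 1 := Subtype.ext (by simpa using h.symm)
      exact (inv_mul_eq_one.1 this).symm
    · right
      have : g⁻¹ * g' = -1 := Subtype.ext (by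
        rw [← h, Matrix.SpecialLinearGroup.coe_neg, map_neg]; simp)
      rw [inv_mul_eq_iff_eq_mul] at this
      simpa using this
  · rintro (rfl | rfl)
    · exact ⟨1, by simp, by simp⟩
    · exact ⟨-1, by simp, by rw [map_neg]; simp⟩

/-! ### Conjugation on the Lie algebra -/

theorem sl2_ext {A B : sl2} (h00 : A.1 0 0 = B.1 0 0) (h01 : A.1 0 1 = B.1 0 1)
    (h10 : A.1 1 0 = B.1 1 0) : A = B := by
  apply Subtype.ext
  ext i j
  fin_cases i <;> fin_cases j
  · exact h00
  · exact h01
  · exact h10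
  · exact (sl2_apply_one_one A).trans ((congrArg Neg.neg h00).trans (sl2_apply_one_one B).symm)

/-- The traceless matrix with given entries. -/
def mkSl2 (a b c : ℝ) : sl2 := ⟨!![a, b; c, -a], by
  show Matrix.trace (_ : Matrix (Fin 2) (Fin 2) ℝ) = 0
  simp [Matrix.trace_fin_two]⟩

@[simp] theorem mkSl2_00 (a b c : ℝ) : (mkSl2 a b c).1 0 0 = a := rfl
@[simp] theorem mkSl2_01 (a b c : ℝ) : (mkSl2 a b c).1 0 1 = b := rfl
@[simp] theorem mkSl2_10 (a b c : ℝ) : (mkSl2 a b c).1 1 0 = c := rfl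
@[simp] theorem mkSl2_11 (a b c : ℝ) : (mkSl2 a b c).1 1 1 = -a := rfl

/-- The adjoint action of `SL(2,ℝ)` on its Lie algebra. -/
def conj (h : SL2) (ξ : sl2) : sl2 := ⟨h.1 * ξ.1 * (h⁻¹).1, by
  show Matrix.trace (_ : Matrix (Fin 2) (Fin 2) ℝ) = 0
  have hh : (h⁻¹).1 * h.1 = 1 := congrArg Subtype.val (inv_mul_cancel h)
  rw [Matrix.trace_mul_comm, ← mul_assoc, hh, one_mul]
  exact ξ.2⟩

theorem conj_mul (h h' : SL2) (ξ : sl2) : conj (h * h') ξ = conj h (conj h' ξ) := by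
  apply Subtype.ext
  simp only [conj, mul_inv_rev, Matrix.SpecialLinearGroup.coe_mul, mul_assoc]

theorem conj_one (ξ : sl2) : conj 1 ξ = ξ := by
  apply Subtype.ext
  simp [conj]

theorem conj_surjective (h : SL2) : Function.Surjective (conj h) := fun ξ =>
  ⟨conj h⁻¹ ξ, by rw [← conj_mul, mul_inv_cancel, conj_one]⟩

theorem SL2_det (h : SL2) : h.1 0 0 * h.1 1 1 - h.1 0 1 * h.1 1 0 = 1 := by
  rw [← Matrix.det_fin_two]; exact h.2

@[simp] theorem SL2_inv_00 (h : SL2) : (h⁻¹).1 0 0 = h.1 1 1 := by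
  rw [Matrix.SpecialLinearGroup.coe_inv, Matrix.adjugate_fin_two]; rfl
@[simp] theorem SL2_inv_01 (h : SL2) : (h⁻¹).1 0 1 = -h.1 0 1 := by
  rw [Matrix.SpecialLinearGroup.coe_inv, Matrix.adjugate_fin_two]; rfl
@[simp] theorem SL2_inv_10 (h : SL2) : (h⁻¹).1 1 0 = -h.1 1 0 := by
  rw [Matrix.SpecialLinearGroup.coe_inv, Matrix.adjugate_fin_two]; rfl
@[simp] theorem SL2_inv_11 (h : SL2) : (h⁻¹).1 1 1 = h.1 0 0 := by
  rw [Matrix.SpecialLinearGroup.coe_inv, Matrix.adjugate_fin_two]; rfl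

theorem adsInner_eq (A B : sl2) :
    adsInner A B = A.1 0 0 * B.1 0 0 + (A.1 0 1 * B.1 1 0 + A.1 1 0 * B.1 0 1) / 2 := by
  have hA := sl2_apply_one_one A
  have hB := sl2_apply_one_one B
  simp only [adsInner, Matrix.trace_fin_two, Matrix.mul_apply, Fin.sum_univ_two, hA, hB]
  ring

theorem adsInner_conj (h : SL2) (A B : sl2) : adsInner (conj h A) (conj h B) = adsInner A B := by
  have hh : (h⁻¹).1 * h.1 = 1 := congrArg Subtype.val (inv_mul_cancel h)
  have : h.1 * A.1 * (h⁻¹).1 * (h.1 * B.1 * (h⁻¹).1) = h.1 * (A.1 * B.1 * (h⁻¹).1) := by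
    calc _ = h.1 * A.1 * ((h⁻¹).1 * h.1) * B.1 * (h⁻¹).1 := by simp only [mul_assoc]
      _ = _ := by rw [hh, mul_one]; simp only [mul_assoc]
  simp only [adsInner, conj, this]
  rw [Matrix.trace_mul_comm, mul_assoc, hh, mul_one]

@[simp] theorem coords_0 (A : sl2) : coords A 0 = A.1 0 0 := rfl
@[simp] theorem coords_1 (A : sl2) : coords A 1 = (A.1 0 1 + A.1 1 0) / 2 := rfl
@[simp] theorem coords_2 (A : sl2) : coords A 2 = (A.1 0 1 - A.1 1 0) / 2 := rfl

theorem vol_coords (A B C : sl2) : 2 * vol (coords A) (coords B) (coords C) =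
    -(A.1 0 0 * (B.1 0 1 * C.1 1 0 - B.1 1 0 * C.1 0 1)
      - A.1 0 1 * (B.1 0 0 * C.1 1 0 - B.1 1 0 * C.1 0 0)
      + A.1 1 0 * (B.1 0 0 * C.1 0 1 - B.1 0 1 * C.1 0 0)) := by
  simp only [vol, Matrix.det_fin_three, Matrix.of_apply, Matrix.cons_val', Matrix.cons_val_zero,
    Matrix.cons_val_one, coords_0, coords_1, coords_2, Matrix.cons_val]
  ring

theorem conj_00 (h : SL2) (A : sl2) : (conj h A).1 0 0 =
    (h.1 0 0 * h.1 1 1 + h.1 0 1 * h.1 1 0) * A.1 0 0 - h.1 0 0 * h.1 1 0 * A.1 0 1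
      + h.1 0 1 * h.1 1 1 * A.1 1 0 := by
  simp only [conj, Matrix.mul_apply, Fin.sum_univ_two, SL2_inv_00, SL2_inv_10,
    sl2_apply_one_one A]
  ring

theorem conj_01 (h : SL2) (A : sl2) : (conj h A).1 0 1 =
    -2 * h.1 0 0 * h.1 0 1 * A.1 0 0 + h.1 0 0 ^ 2 * A.1 0 1 - h.1 0 1 ^ 2 * A.1 1 0 := by
  simp only [conj, Matrix.mul_apply, Fin.sum_univ_two, SL2_inv_01, SL2_inv_11,
    sl2_apply_one_one A]
  ring

theorem conj_10 (h : SL2) (A : sl2) : (conj h A).1 1 0 =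
    2 * h.1 1 0 * h.1 1 1 * A.1 0 0 - h.1 1 0 ^ 2 * A.1 0 1 + h.1 1 1 ^ 2 * A.1 1 0 := by
  simp only [conj, Matrix.mul_apply, Fin.sum_univ_two, SL2_inv_00, SL2_inv_10,
    sl2_apply_one_one A]
  ring

/-- With the adjugate as inverse, conjugation is polynomial in the entries of `h` and has
determinant `(det h)³` on the Lie algebra. -/
theorem vol_conj (h : SL2) (A B C : sl2) :
    vol (coords (conj h A)) (coords (conj h B)) (coords (conj h C))
      = vol (coords A) (coords B) (coords C) := by
  have hd := SL2_det h
  have key : 2 * vol (coords (conj h A)) (coords (conj h B)) (coords (conj h C))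
      = (h.1 0 0 * h.1 1 1 - h.1 0 1 * h.1 1 0) ^ 3 *
        (2 * vol (coords A) (coords B) (coords C)) := by
    rw [vol_coords, vol_coords]
    simp only [conj_00, conj_01, conj_10]
    ring
  rw [hd] at key
  linarith

/-! ### Crooked planes in an adapted frame -/

/-- The crooked plane in the Lie algebra with vertex `0` and direction vector `diag(1,-1)`. -/
def crookedCone (ε : ℤˣ) : Set sl2 :=
  {ξ | (ξ.1 0 0 = 0 ∧ ξ.1 0 1 * ξ.1 1 0 ≤ 0) ∨ (ξ.1 1 0 = 0 ∧ 0 < ((ε : ℤ) : ℝ) * ξ.1 0 0) ∨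
    (ξ.1 0 1 = 0 ∧ ((ε : ℤ) : ℝ) * ξ.1 0 0 < 0)}

/-- Cauchy–Schwarz in the spacelike coordinates, bounded by the timelike ones. -/
theorem lor_nonpos {u v : E3} (hu : FuturePointing u) (hv : FuturePointing v) : lor u v ≤ 0 := by
  obtain ⟨hu, hu2⟩ := hu
  obtain ⟨hv, hv2⟩ := hv
  simp only [lor] at *
  have h1 : (u 0 * v 0 + u 1 * v 1) ^ 2 ≤ (u 2 * v 2) ^ 2 := by
    have : (u 0 ^ 2 + u 1 ^ 2) * (v 0 ^ 2 + v 1 ^ 2) ≤ u 2 ^ 2 * v 2 ^ 2 :=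
      mul_le_mul (by linarith) (by linarith) (by positivity) (by positivity)
    nlinarith [sq_nonneg (u 0 * v 1 - u 1 * v 0)]
  have := (abs_le.1 (abs_le_of_sq_le_sq h1 (by positivity))).2
  linarith

theorem SL2_col_pos (h : SL2) (j : Fin 2) : 0 < h.1 0 j ^ 2 + h.1 1 j ^ 2 := by
  have hd := SL2_det h
  by_contra hn
  have h0 : h.1 0 j = 0 := by nlinarith [sq_nonneg (h.1 0 j), sq_nonneg (h.1 1 j)]
  have h1 : h.1 1 j = 0 := by nlinarith [sq_nonneg (h.1 0 j), sq_nonneg (h.1 1 j)]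
  fin_cases j <;> simp_all

/-- Conjugation preserves the time orientation: the last coordinate comes out as `r/2` times the
squared length of the first column of `h`, which is nonzero. -/
theorem futurePointing_upper (h : SL2) {r : ℝ} (hr : 0 < r) :
    FuturePointing (coords (conj h (mkSl2 0 r 0))) := by
  constructor
  · rw [lor_coords, adsInner_conj, adsInner_eq]; simp
  · rw [coords_2, conj_01, conj_10]
    have := mul_pos hr (SL2_col_pos h 0)
    simp only [mkSl2_00, mkSl2_01, mkSl2_10]
    linarith

theorem futurePointing_lower (h : SL2) {r : ℝ} (hr : 0 < r) :
    FuturePointing (coords (conj h (mkSl2 0 0 (-r)))) := by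
  constructor
  · rw [lor_coords, adsInner_conj, adsInner_eq]; simp
  · rw [coords_2, conj_01, conj_10]
    have := mul_pos hr (SL2_col_pos h 1)
    simp only [mkSl2_00, mkSl2_01, mkSl2_10]
    linarith

/-- For `v = r E₁₂` the plane `v^⊥` is `c = 0`, and on it `vol(v, u, ξ)` is `-r u₁₀ ξ₀₀ / 2`. A
future-pointing `u` outside `v^⊥` pairs negatively with `v`, which means `u₁₀ < 0`; hence the sign
is that of `ξ₀₀`, whatever `u` is. -/
theorem mem_nullHalfPlane_upper (ε : ℤˣ) (h : SL2) {r : ℝ} (hr : 0 < r) (ξ : sl2) :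
    coords (conj h ξ) ∈ nullHalfPlane ε (coords (conj h (mkSl2 0 r 0))) ↔
      ξ.1 1 0 = 0 ∧ 0 < ((ε : ℤ) : ℝ) * ξ.1 0 0 := by
  simp only [nullHalfPlane, mem_ofPred_eq, lor_coords, adsInner_conj]
  have hin : adsInner ξ (mkSl2 0 r 0) = ξ.1 1 0 * r / 2 := by rw [adsInner_eq]; simp
  constructor
  · rintro ⟨h0, u, hu, hne, hpos⟩
    have h10 : ξ.1 1 0 = 0 := by
      rw [hin] at h0; simpa [hr.ne'] using h0
    refine ⟨h10, ?_⟩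
    obtain ⟨υ', rfl⟩ := coords.surjective u
    obtain ⟨υ, rfl⟩ := conj_surjective h υ'
    have hle := lor_nonpos hu (futurePointing_upper h hr)
    rw [lor_coords, adsInner_conj, adsInner_eq] at hle hne
    simp only [mkSl2_00, mkSl2_01, mkSl2_10, mul_zero, zero_add] at hle hne
    have hlt : υ.1 1 0 < 0 := by
      have h2 := lt_of_le_of_ne hle hne
      by_contra hc
      nlinarith [mul_nonneg (not_lt.1 hc) hr.le]
    have hv := vol_coords (mkSl2 0 r 0) υ ξ
    rw [vol_conj] at hpos
    simp only [mkSl2_00, mkSl2_01, mkSl2_10, h10] at hv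
    have : 0 < (r * -υ.1 1 0) * (((ε : ℤ) : ℝ) * ξ.1 0 0) := by
      have : (r * -υ.1 1 0) * (((ε : ℤ) : ℝ) * ξ.1 0 0) =
        2 * (((ε : ℤ) : ℝ) * vol (coords (mkSl2 0 r 0)) (coords υ) (coords ξ)) := by
        linear_combination (-((ε : ℤ) : ℝ)) * hv
      linarith
    exact (mul_pos_iff_of_pos_left (by nlinarith)).1 this
  · rintro ⟨h10, hpos⟩
    -- The auxiliary vector `u` is the other future null direction of the frame.
    refine ⟨by rw [hin, h10]; simp, _, futurePointing_lower h one_pos, ?_, ?_⟩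
    · rw [lor_coords, adsInner_conj, adsInner_eq]; simpa using hr.ne'
    · rw [vol_conj]
      have hv := vol_coords (mkSl2 0 r 0) (mkSl2 0 0 (-1)) ξ
      simp only [mkSl2_00, mkSl2_01, mkSl2_10, h10] at hv
      have := mul_pos hr hpos
      have e : 2 * (((ε : ℤ) : ℝ) * vol (coords (mkSl2 0 r 0)) (coords (mkSl2 0 0 (-1)))
          (coords ξ)) = r * (((ε : ℤ) : ℝ) * ξ.1 0 0) := by
        linear_combination ((ε : ℤ) : ℝ) * hv
      linarith

theorem mem_nullHalfPlane_lower (ε : ℤˣ) (h : SL2) {r : ℝ} (hr : 0 < r) (ξ : sl2) :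
    coords (conj h ξ) ∈ nullHalfPlane ε (coords (conj h (mkSl2 0 0 (-r)))) ↔
      ξ.1 0 1 = 0 ∧ ((ε : ℤ) : ℝ) * ξ.1 0 0 < 0 := by
  simp only [nullHalfPlane, mem_ofPred_eq, lor_coords, adsInner_conj]
  have hin : adsInner ξ (mkSl2 0 0 (-r)) = ξ.1 0 1 * -r / 2 := by rw [adsInner_eq]; simp
  constructor
  · rintro ⟨h0, u, hu, hne, hpos⟩
    have h01 : ξ.1 0 1 = 0 := by
      rw [hin] at h0; simpa [hr.ne'] using h0
    refine ⟨h01, ?_⟩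
    obtain ⟨υ', rfl⟩ := coords.surjective u
    obtain ⟨υ, rfl⟩ := conj_surjective h υ'
    have hle := lor_nonpos hu (futurePointing_lower h hr)
    rw [lor_coords, adsInner_conj, adsInner_eq] at hle hne
    simp only [mkSl2_00, mkSl2_01, mkSl2_10, mul_zero, zero_add, add_zero] at hle hne
    have hlt : 0 < υ.1 0 1 := by
      have h2 := lt_of_le_of_ne hle hne
      by_contra hc
      nlinarith [mul_nonneg (neg_nonneg.2 (not_lt.1 hc)) hr.le]
    have hv := vol_coords (mkSl2 0 0 (-r)) υ ξ
    rw [vol_conj] at hpos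
    simp only [mkSl2_00, mkSl2_01, mkSl2_10, h01] at hv
    have : 0 < (r * υ.1 0 1) * -(((ε : ℤ) : ℝ) * ξ.1 0 0) := by
      have : (r * υ.1 0 1) * -(((ε : ℤ) : ℝ) * ξ.1 0 0) =
        2 * (((ε : ℤ) : ℝ) * vol (coords (mkSl2 0 0 (-r))) (coords υ) (coords ξ)) := by
        linear_combination (-((ε : ℤ) : ℝ)) * hv
      linarith
    exact neg_pos.1 ((mul_pos_iff_of_pos_left (by positivity)).1 this)
  · rintro ⟨h01, hneg⟩
    refine ⟨by rw [hin, h01]; simp, _, futurePointing_upper h one_pos, ?_, ?_⟩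
    · rw [lor_coords, adsInner_conj, adsInner_eq]; simpa using hr.ne'
    · rw [vol_conj]
      have hv := vol_coords (mkSl2 0 0 (-r)) (mkSl2 0 1 0) ξ
      simp only [mkSl2_00, mkSl2_01, mkSl2_10, h01] at hv
      have := mul_pos hr (neg_pos.2 hneg)
      have e : 2 * (((ε : ℤ) : ℝ) * vol (coords (mkSl2 0 0 (-r))) (coords (mkSl2 0 1 0))
          (coords ξ)) = r * -(((ε : ℤ) : ℝ) * ξ.1 0 0) := by
        linear_combination ((ε : ℤ) : ℝ) * hv
      linarith

/-- In the frame given by `h` the null vectors of `s^⊥` are those with `a = 0` and `bc = 0`; being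
future-pointing fixes the sign of the remaining entry. -/
theorem mem_hingeDirections_iff (h : SL2) (v : E3) :
    v ∈ hingeDirections (coords (conj h (mkSl2 1 0 0))) ↔ ∃ r : ℝ, 0 < r ∧
      (v = coords (conj h (mkSl2 0 r 0)) ∨ v = coords (conj h (mkSl2 0 0 (-r)))) := by
  constructor
  · obtain ⟨η', rfl⟩ := coords.surjective v
    obtain ⟨η, rfl⟩ := conj_surjective h η'
    rintro ⟨h0, hpos, hs⟩
    rw [lor_coords, adsInner_conj, adsInner_eq] at h0 hs
    simp only [mkSl2_00, mkSl2_01, mkSl2_10, mul_zero, add_zero, mul_one, zero_div] at hs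
    rw [coords_2, conj_01, conj_10, hs] at hpos
    rw [hs] at h0
    have hp : η.1 0 1 * η.1 1 0 = 0 := by linarith
    rcases mul_eq_zero.1 hp with h1 | h1
    · have he : η = mkSl2 0 0 (- -η.1 1 0) := sl2_ext hs h1 (by simp)
      refine ⟨-η.1 1 0, ?_, Or.inr (by rw [← he])⟩
      rw [h1] at hpos
      have h2 := SL2_col_pos h 1
      by_contra hc
      nlinarith [mul_nonneg (by linarith : 0 ≤ η.1 1 0) h2.le]
    · have he : η = mkSl2 0 (η.1 0 1) 0 := sl2_ext hs (by simp) h1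
      refine ⟨η.1 0 1, ?_, Or.inl (by rw [← he])⟩
      rw [h1] at hpos
      have h2 := SL2_col_pos h 0
      by_contra hc
      nlinarith [mul_nonneg (by linarith : 0 ≤ -η.1 0 1) h2.le]
  · rintro ⟨r, hr, rfl | rfl⟩
    · refine ⟨?_, (futurePointing_upper h hr).2, ?_⟩
      all_goals rw [lor_coords, adsInner_conj, adsInner_eq]; simp
    · refine ⟨?_, (futurePointing_lower h hr).2, ?_⟩
      all_goals rw [lor_coords, adsInner_conj, adsInner_eq]; simp

theorem mem_minkCrookedPlane_conj (ε : ℤˣ) (h : SL2) (ξ : sl2) :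
    coords (conj h ξ) ∈ minkCrookedPlane ε 0 (coords (conj h (mkSl2 1 0 0))) ↔
      ξ ∈ crookedCone ε := by
  have hst : lor (coords (conj h ξ)) (coords (conj h (mkSl2 1 0 0))) = ξ.1 0 0 := by
    rw [lor_coords, adsInner_conj, adsInner_eq]; simp
  have hnn : lor (coords (conj h ξ)) (coords (conj h ξ)) =
      ξ.1 0 0 ^ 2 + ξ.1 0 1 * ξ.1 1 0 := by
    rw [lor_coords, adsInner_conj, adsInner_eq]; ring
  simp only [minkCrookedPlane, sub_zero, zero_add, image_id', mem_union, mem_ofPred_eq, hst, hnn,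
    mem_iUnion, crookedCone]
  refine or_congr (and_congr_right fun h0 => by rw [h0]; simp) ⟨?_, ?_⟩
  · rintro ⟨v, hv, hw⟩
    obtain ⟨r, hr, rfl | rfl⟩ := (mem_hingeDirections_iff h v).1 hv
    · exact Or.inl ((mem_nullHalfPlane_upper ε h hr ξ).1 hw)
    · exact Or.inr ((mem_nullHalfPlane_lower ε h hr ξ).1 hw)
  · rintro (hw | hw)
    · exact ⟨_, (mem_hingeDirections_iff h _).2 ⟨1, one_pos, Or.inl rfl⟩,
        (mem_nullHalfPlane_upper ε h one_pos ξ).2 hw⟩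
    · exact ⟨_, (mem_hingeDirections_iff h _).2 ⟨1, one_pos, Or.inr rfl⟩,
        (mem_nullHalfPlane_lower ε h one_pos ξ).2 hw⟩

theorem sl2_smul_apply (t : ℝ) (ξ : sl2) (i j : Fin 2) : (t • ξ).1 i j = t * ξ.1 i j := rfl

/-- The unimodular matrix with given entries. -/
def mkSL2 (a b c d : ℝ) (h : a * d - b * c = 1) : SL2 :=
  ⟨!![a, b; c, d], by rw [Matrix.det_fin_two_of, h]⟩

@[simp] theorem mkSL2_00 (a b c d : ℝ) (h) : (mkSL2 a b c d h).1 0 0 = a := rfl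
@[simp] theorem mkSL2_01 (a b c d : ℝ) (h) : (mkSL2 a b c d h).1 0 1 = b := rfl
@[simp] theorem mkSL2_10 (a b c d : ℝ) (h) : (mkSL2 a b c d h).1 1 0 = c := rfl
@[simp] theorem mkSL2_11 (a b c d : ℝ) (h) : (mkSL2 a b c d h).1 1 1 = d := rfl

/-- Unit spacelike vectors are conjugate to `diag(1,-1)`. -/
theorem exists_conj_eq (s : sl2) (hs : adsInner s s = 1) :
    ∃ h : SL2, conj h (mkSl2 1 0 0) = s := by
  rw [adsInner_eq] at hs
  by_cases ha : s.1 0 0 = -1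
  -- The columns of `h` are eigenvectors of `s` for the eigenvalues `1` and `-1`. When `a = -1` the
  -- general formula below would divide by zero; here `bc = 0`, and `(b, 2)`, `(-1/2, c/4)` serve
  -- instead.
  · refine ⟨mkSL2 (s.1 0 1) (-1 / 2) 2 (s.1 1 0 / 4) ?_, ?_⟩
    · rw [ha] at hs
      linarith
    · have hz : s.1 0 1 * s.1 1 0 = 0 := by rw [ha] at hs; linarith
      apply sl2_ext
      · rw [conj_00]; simp; linarith
      · rw [conj_01]; simp; ring
      · rw [conj_10]; simp; ring
  · have hne : s.1 0 0 + 1 ≠ 0 := fun h => ha (by linarith)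
    -- The first column is a column of `s + 1`. The second is proportional to `(-b, a + 1)`, scaled
    -- so that the determinant is `(a² + bc + 2a + 1) / (2(a + 1)) = 1`.
    refine ⟨mkSL2 (s.1 0 0 + 1) (-s.1 0 1 / (2 * (s.1 0 0 + 1))) (s.1 1 0) (1 / 2) ?_, ?_⟩
    · field_simp
      linarith
    · apply sl2_ext
      · rw [conj_00]; simp; field_simp; linarith
      · rw [conj_01]; simp; field_simp
      · rw [conj_10]; simp; ring

/-! ### The crooked plane as an exponential image -/

theorem adsExp_eq_iff (p : AdS) (ξ η : sl2) :
    adsExp p ξ = adsExp p η ↔ expSL η = expSL ξ ∨ expSL η = -expSL ξ := by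
  unfold adsExp
  rw [mul_right_inj, adsProj_eq_iff]

/-- Both `1` and `η` are trace-orthogonal to `s`, and the exponential lies in their span. Hence
`Exp(s^⊥)` sits in a linear hyperplane section of the group. -/
theorem trace_exp_mul_eq_zero {η s : sl2} (h : adsInner η s = 0) :
    ((expSL η).1 * s.1).trace = 0 := by
  obtain ⟨a, b, hab⟩ := exists_exp_eq η
  have h1 : (η.1 * s.1).trace = 0 := by simpa [adsInner] using h
  have h2 : s.1.trace = 0 := s.2
  change (NormedSpace.exp η.1 * s.1).trace = 0
  rw [hab, add_mul, smul_mul_assoc, smul_mul_assoc, one_mul, Matrix.trace_add, Matrix.trace_smul,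
    Matrix.trace_smul, h1, h2]
  simp

/-- Along the geodesic `tr(exp(tξ) s)` vanishes identically, the sign ambiguity of the lift being
harmless; its derivative at `0` is `tr(ξ s)`. This identifies the geodesics of the stem by their
initial velocities alone. -/
theorem adsInner_eq_zero_of_geodesic_mem (p : AdS) (s ξ : sl2)
    (h : ∀ t, adsGeodesic p ξ t ∈ stemPlane p s) : adsInner ξ s = 0 := by
  have hz : ∀ t : ℝ, (NormedSpace.exp (t • ξ.1) * s.1).trace = 0 := by
    intro t
    obtain ⟨η, hη, he⟩ := h t
    have hη' := trace_exp_mul_eq_zero hη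
    rcases (adsExp_eq_iff p η (t • ξ)).1 he with h1 | h1
    · rw [← h1] at hη'
      exact hη'
    · have : expSL η = -expSL (t • ξ) := by rw [h1, neg_neg]
      rw [this, Matrix.SpecialLinearGroup.coe_neg, neg_mul, Matrix.trace_neg, neg_eq_zero] at hη'
      exact hη'
  have hd : HasDerivAt (fun t : ℝ => (NormedSpace.exp (t • ξ.1) * s.1).trace)
      ((ξ.1 * s.1).trace) 0 := by
    have e := fun i j => hasDerivAt_exp_entry ξ.1 i j 0
    simp only [zero_smul, NormedSpace.exp_zero, one_mul] at e
    simp only [Matrix.trace_fin_two, Matrix.mul_apply, Fin.sum_univ_two]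
    exact (((e 0 0).mul_const _).add ((e 0 1).mul_const _)).add
      (((e 1 0).mul_const _).add ((e 1 1).mul_const _))
  have h0 : HasDerivAt (fun t : ℝ => (NormedSpace.exp (t • ξ.1) * s.1).trace) 0 0 := by
    rw [funext hz]; exact hasDerivAt_const _ _
  rw [adsInner, hd.unique h0, mul_zero]

theorem adsStem_eq (p : AdS) (s : sl2) :
    adsStem p s = adsExp p '' {ξ | adsInner ξ s = 0 ∧ adsInner ξ ξ ≤ 0} := by
  have hsm : ∀ (t : ℝ) (ξ η : sl2), adsInner (t • ξ) η = t * adsInner ξ η := fun t ξ η => by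
    simp only [adsInner_eq, sl2_smul_apply]
    ring
  have hsm' : ∀ (t : ℝ) (ξ : sl2), adsInner (t • ξ) (t • ξ) = t ^ 2 * adsInner ξ ξ := fun t ξ => by
    simp only [adsInner_eq, sl2_smul_apply]
    ring
  ext x
  constructor
  · rintro ⟨ξ, hξ, hg, t, rfl⟩
    refine ⟨t • ξ, ⟨?_, ?_⟩, rfl⟩
    · rw [hsm, adsInner_eq_zero_of_geodesic_mem p s ξ hg, mul_zero]
    · rw [hsm']; exact mul_nonpos_of_nonneg_of_nonpos (sq_nonneg t) hξ
  · rintro ⟨ξ, ⟨h1, h2⟩, rfl⟩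
    refine ⟨ξ, h2, fun t => ⟨t • ξ, ?_, rfl⟩, 1, by rw [adsGeodesic, one_smul]⟩
    show adsInner _ _ = 0
    rw [hsm, h1, mul_zero]

theorem adsCrookedPlane_eq (ε : ℤˣ) (p : AdS) (s : sl2) :
    adsCrookedPlane ε p s = adsExp p '' (coords ⁻¹' minkCrookedPlane ε 0 (coords s)) := by
  rw [adsCrookedPlane, adsStem_eq, minkCrookedPlane, preimage_union, image_union]
  simp only [sub_zero, zero_add, image_id', preimage_iUnion, image_iUnion]
  congr 1
  · congr 1
    ext ξ
    simp only [mem_ofPred_eq, mem_preimage, lor_coords]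
  · ext x
    simp only [mem_iUnion]
    constructor
    · rintro ⟨v, hv, hx⟩
      exact ⟨coords v, hv, hx⟩
    · rintro ⟨v, hv, hx⟩
      obtain ⟨v, rfl⟩ := coords.surjective v
      exact ⟨v, hv, hx⟩

/-! ### The preimage of a crooked plane in `SL(2,ℝ)` -/

/-- The preimage in `SL(2,ℝ)` of the crooked plane with vertex `1` and direction `diag(1,-1)`. -/
def crookedSheet (ε : ℤˣ) : Set SL2 :=
  {M | (M.1 0 0 = M.1 1 1 ∧ M.1 0 1 * M.1 1 0 ≤ 0) ∨
    (M.1 1 0 = 0 ∧ 0 < ((ε : ℤ) : ℝ) * (M.1 0 0 ^ 2 - M.1 1 1 ^ 2)) ∨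
    (M.1 0 1 = 0 ∧ ((ε : ℤ) : ℝ) * (M.1 0 0 ^ 2 - M.1 1 1 ^ 2) < 0)}

theorem SL2_neg_apply (M : SL2) (i j : Fin 2) : (-M).1 i j = -M.1 i j := by
  rw [Matrix.SpecialLinearGroup.coe_neg]; rfl

theorem SL2_ext {A B : SL2} (h00 : A.1 0 0 = B.1 0 0) (h01 : A.1 0 1 = B.1 0 1)
    (h10 : A.1 1 0 = B.1 1 0) (h11 : A.1 1 1 = B.1 1 1) : A = B := by
  apply Subtype.ext
  ext i j
  fin_cases i <;> fin_cases j
  · exact h00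
  · exact h01
  · exact h10
  · exact h11

theorem neg_mem_crookedSheet {ε : ℤˣ} {M : SL2} (h : M ∈ crookedSheet ε) :
    -M ∈ crookedSheet ε := by
  simpa only [crookedSheet, mem_ofPred_eq, SL2_neg_apply, neg_inj, neg_mul_neg, neg_sq,
    neg_eq_zero] using h

theorem sign_mul_pos_iff (ε : ℤˣ) {x y : ℝ} (h : 0 < x ↔ 0 < y) (h' : x < 0 ↔ y < 0) :
    (0 < ((ε : ℤ) : ℝ) * x ↔ 0 < ((ε : ℤ) : ℝ) * y) ∧
      (((ε : ℤ) : ℝ) * x < 0 ↔ ((ε : ℤ) : ℝ) * y < 0) := by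
  rcases Int.units_eq_one_or ε with rfl | rfl <;> simp [h, h']

theorem expSL_apply_of_eq {ξ : sl2} {a b : ℝ}
    (h : NormedSpace.exp ξ.1 = a • (1 : Matrix (Fin 2) (Fin 2) ℝ) + b • ξ.1) :
    (expSL ξ).1 0 0 = a + b * ξ.1 0 0 ∧ (expSL ξ).1 0 1 = b * ξ.1 0 1 ∧
      (expSL ξ).1 1 0 = b * ξ.1 1 0 ∧ (expSL ξ).1 1 1 = a - b * ξ.1 0 0 := by
  simp only [expSL, h, Matrix.add_apply, Matrix.smul_apply, sl2_apply_one_one ξ, smul_eq_mul]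
  simp
  ring

theorem mul_neg_iff_of_left_pos {a b : ℝ} (ha : 0 < a) : a * b < 0 ↔ b < 0 := by
  rw [← neg_pos, ← mul_neg, mul_pos_iff_of_pos_left ha, neg_pos]

/-- The two bracketed terms are the diagonal entries `e^a` and `e^{-a}` of a triangular exponential,
and the difference of their squares is `4 cosh a sinh a`. -/
theorem sinh_cosh_signs (a : ℝ) (ha : a ≠ 0) :
    (0 < (Real.cosh a + Real.sinh a / a * a) ^ 2 - (Real.cosh a - Real.sinh a / a * a) ^ 2 ↔
      0 < a) ∧
    ((Real.cosh a + Real.sinh a / a * a) ^ 2 - (Real.cosh a - Real.sinh a / a * a) ^ 2 < 0 ↔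
      a < 0) := by
  have h1 : (Real.cosh a + Real.sinh a / a * a) ^ 2 - (Real.cosh a - Real.sinh a / a * a) ^ 2 =
      (4 * Real.cosh a) * Real.sinh a := by
    rw [div_mul_cancel₀ _ ha]; ring
  have h2 : 0 < 4 * Real.cosh a := by have := Real.cosh_pos a; linarith
  rw [h1, mul_pos_iff_of_pos_left h2, Real.sinh_pos_iff, mul_neg_iff_of_left_pos h2,
    Real.sinh_neg_iff]
  exact ⟨Iff.rfl, Iff.rfl⟩

theorem expSL_mem_crookedSheet {ε : ℤˣ} {ξ : sl2} (h : ξ ∈ crookedCone ε) :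
    expSL ξ ∈ crookedSheet ε := by
  rcases h with ⟨h0, h1⟩ | ⟨h0, h1⟩ | ⟨h0, h1⟩
  · obtain ⟨a, b, hab⟩ := exists_exp_eq ξ
    obtain ⟨e00, e01, e10, e11⟩ := expSL_apply_of_eq hab
    left
    rw [e00, e01, e10, e11, h0]
    refine ⟨by simp, ?_⟩
    have := mul_nonpos_of_nonneg_of_nonpos (sq_nonneg b) h1
    linarith
  · have hne : ξ.1 0 0 ≠ 0 := by rintro hz; simp [hz] at h1
    obtain ⟨e00, e01, e10, e11⟩ := expSL_apply_of_eq
      (exp_hyperbolic ξ (ξ.1 0 0) hne (by rw [h0]; ring))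
    right; left
    have hs := sinh_cosh_signs _ hne
    rw [e00, e10, e11, h0, (sign_mul_pos_iff ε hs.1 hs.2).1]
    exact ⟨mul_zero _, h1⟩
  · have hne : ξ.1 0 0 ≠ 0 := by rintro hz; simp [hz] at h1
    obtain ⟨e00, e01, e10, e11⟩ := expSL_apply_of_eq
      (exp_hyperbolic ξ (ξ.1 0 0) hne (by rw [h0]; ring))
    right; right
    have hs := sinh_cosh_signs _ hne
    rw [e00, e01, e11, h0, (sign_mul_pos_iff ε hs.1 hs.2).2]
    exact ⟨mul_zero _, h1⟩

/-- The determinant gives `a² = 1 + bc`. If `bc < 0` then `|a| < 1` and the matrix is a rotation by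
`arccos a` in a suitable basis; if `bc = 0` then `a = ±1` and, up to sign, the matrix is unipotent.
-/
theorem exists_expSL_eq_stem (M : SL2) (h0 : M.1 0 0 = M.1 1 1) (h1 : M.1 0 1 * M.1 1 0 ≤ 0) :
    ∃ ξ : sl2, ξ.1 0 0 = 0 ∧ ξ.1 0 1 * ξ.1 1 0 ≤ 0 ∧ (M = expSL ξ ∨ M = -expSL ξ) := by
  have hd := SL2_det M
  rcases eq_or_lt_of_le h1 with h1 | h1
  · have ha : M.1 0 0 * M.1 0 0 = 1 := by rw [h1, ← h0] at hd; linarith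
    have par : ∀ b c : ℝ, b * c = 0 → (expSL (mkSl2 0 b c)).1 0 0 = 1 ∧
        (expSL (mkSl2 0 b c)).1 0 1 = b ∧ (expSL (mkSl2 0 b c)).1 1 0 = c ∧
        (expSL (mkSl2 0 b c)).1 1 1 = 1 := fun b c hbc => by
      have := expSL_apply_of_eq (ξ := mkSl2 0 b c) (a := 1) (b := 1) (by
        rw [exp_parabolic _ (by simpa using hbc), one_smul, one_smul])
      simpa using this
    rcases mul_self_eq_one_iff.1 ha with ha | ha
    · obtain ⟨e00, e01, e10, e11⟩ := par _ _ h1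
      exact ⟨mkSl2 0 (M.1 0 1) (M.1 1 0), rfl, h1.le, Or.inl (SL2_ext (by rw [e00, ha]) e01.symm
        e10.symm (by rw [e11, ← h0, ha]))⟩
    · obtain ⟨e00, e01, e10, e11⟩ := par (-M.1 0 1) (-M.1 1 0) (by linarith)
      refine ⟨mkSl2 0 (-M.1 0 1) (-M.1 1 0), rfl, by simpa using h1.le,
        Or.inr (SL2_ext ?_ ?_ ?_ ?_)⟩
      · rw [SL2_neg_apply, e00, ha]
      · rw [SL2_neg_apply, e01, neg_neg]
      · rw [SL2_neg_apply, e10, neg_neg]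
      · rw [SL2_neg_apply, e11, ← h0, ha]
  · have ha : M.1 0 0 ^ 2 < 1 := by rw [← h0] at hd; nlinarith
    obtain ⟨ha1, ha2⟩ := abs_lt.1 ((sq_lt_one_iff_abs_lt_one _).1 ha)
    have hc := Real.cos_arccos ha1.le ha2.le
    have hs : Real.sin (Real.arccos (M.1 0 0)) ≠ 0 := by
      intro hs
      have := Real.sin_sq_add_cos_sq (Real.arccos (M.1 0 0))
      rw [hc, hs] at this
      linarith
    have hq := Real.sin_sq_add_cos_sq (Real.arccos (M.1 0 0))
    set θ := Real.arccos (M.1 0 0) with hθ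
    have hθ0 : θ ≠ 0 := by rintro h; rw [h, Real.sin_zero] at hs; exact hs rfl
    have hq' : M.1 0 1 * M.1 1 0 = -Real.sin θ ^ 2 := by
      rw [hc] at hq; rw [← h0] at hd; linarith
    -- The factor `θ / sin θ` cancels the coefficient `sin θ / θ` of the elliptic exponential.
    have hm : θ / Real.sin θ * M.1 0 1 * (θ / Real.sin θ * M.1 1 0) = -θ ^ 2 := by
      field_simp
      linear_combination hq'
    obtain ⟨e00, e01, e10, e11⟩ := expSL_apply_of_eq
      (exp_elliptic (mkSl2 0 (θ / Real.sin θ * M.1 0 1) (θ / Real.sin θ * M.1 1 0)) θ hθ0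
        (by simpa using hm))
    refine ⟨mkSl2 0 (θ / Real.sin θ * M.1 0 1) (θ / Real.sin θ * M.1 1 0), rfl, ?_,
      Or.inl (SL2_ext ?_ ?_ ?_ ?_)⟩
    · exact (hm.trans_le (by have := sq_nonneg θ; linarith))
    · rw [e00, hc]; simp
    · rw [e01, mkSl2_01]; field_simp
    · rw [e10, mkSl2_10]; field_simp
    · rw [e11, hc, h0]; simp

/-- A triangular matrix with diagonal `e^κ, e^{-κ}`, `κ ≠ 0`, is a hyperbolic exponential whose
off-diagonal entries are multiplied by `sinh κ / κ`. Both entries are rescaled by the same `r`, so a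
vanishing entry stays zero. -/
theorem exists_expSL_eq_wing (M : SL2) (hpos : 0 < M.1 0 0) (h0 : M.1 0 1 * M.1 1 0 = 0)
    (hne : M.1 0 0 ≠ M.1 1 1) :
    ∃ r : ℝ, M = expSL (mkSl2 (Real.log (M.1 0 0)) (r * M.1 0 1) (r * M.1 1 0)) := by
  have hd := SL2_det M
  rw [h0, sub_zero] at hd
  have hinv : M.1 1 1 = (M.1 0 0)⁻¹ := eq_inv_of_mul_eq_one_right hd
  have hl : Real.log (M.1 0 0) ≠ 0 := by
    intro h
    rcases Real.log_eq_zero.1 h with h | h | h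
    · linarith
    · rw [h] at hinv hne; rw [hinv] at hne; simp at hne
    · linarith
  have hc : Real.cosh (Real.log (M.1 0 0)) + Real.sinh (Real.log (M.1 0 0)) = M.1 0 0 := by
    rw [Real.cosh_add_sinh, Real.exp_log hpos]
  have hc' : Real.cosh (Real.log (M.1 0 0)) - Real.sinh (Real.log (M.1 0 0)) = M.1 1 1 := by
    rw [Real.cosh_sub_sinh, Real.exp_neg, Real.exp_log hpos, hinv]
  set κ := Real.log (M.1 0 0)
  have hs : Real.sinh κ ≠ 0 := fun h => hl (Real.sinh_eq_zero.1 h)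
  obtain ⟨e00, e01, e10, e11⟩ := expSL_apply_of_eq
    (exp_hyperbolic (mkSl2 κ (κ / Real.sinh κ * M.1 0 1) (κ / Real.sinh κ * M.1 1 0)) κ hl (by
      simp only [mkSl2_00, mkSl2_01, mkSl2_10]
      linear_combination (κ / Real.sinh κ) ^ 2 * h0))
  refine ⟨κ / Real.sinh κ, SL2_ext ?_ ?_ ?_ ?_⟩
  · rw [e00, mkSl2_00, div_mul_cancel₀ _ hl, hc]
  · rw [e01, mkSl2_01]; field_simp
  · rw [e10, mkSl2_10]; field_simp
  · rw [e11, mkSl2_00, div_mul_cancel₀ _ hl, hc']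

theorem log_signs {a d : ℝ} (ha : 0 < a) (had : a * d = 1) :
    (0 < Real.log a ↔ 0 < a ^ 2 - d ^ 2) ∧ (Real.log a < 0 ↔ a ^ 2 - d ^ 2 < 0) := by
  have hd : 0 < d := by
    by_contra h; nlinarith
  rw [Real.log_pos_iff ha.le, Real.log_neg_iff ha, sub_pos, sub_neg,
    sq_lt_sq₀ hd.le ha.le, sq_lt_sq₀ ha.le hd.le]
  constructor <;> constructor <;> intro h <;> by_contra hc <;> nlinarith

theorem exists_expSL_eq_of_pos {ε : ℤˣ} {M : SL2} (h : M ∈ crookedSheet ε)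
    (hpos : 0 < M.1 0 0) (hne : M.1 0 0 ≠ M.1 1 1) : ∃ ξ ∈ crookedCone ε, M = expSL ξ := by
  have hd := SL2_det M
  rcases h with ⟨h0, -⟩ | ⟨h0, h1⟩ | ⟨h0, h1⟩
  · exact absurd h0 hne
  · rw [h0, mul_zero, sub_zero] at hd
    obtain ⟨r, hr⟩ := exists_expSL_eq_wing M hpos (by rw [h0, mul_zero]) hne
    have hs := log_signs hpos hd
    exact ⟨_, Or.inr (Or.inl ⟨by rw [mkSl2_10, h0, mul_zero],
      (sign_mul_pos_iff ε hs.1 hs.2).1.2 h1⟩), hr⟩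
  · rw [h0, zero_mul, sub_zero] at hd
    obtain ⟨r, hr⟩ := exists_expSL_eq_wing M hpos (by rw [h0, zero_mul]) hne
    have hs := log_signs hpos hd
    exact ⟨_, Or.inr (Or.inr ⟨by rw [mkSl2_01, h0, mul_zero],
      (sign_mul_pos_iff ε hs.1 hs.2).2.2 h1⟩), hr⟩

/-- The sign is needed because exponentials of wing vectors have positive diagonal, while the full
preimage of a subset of `PSL(2,ℝ)` is invariant under `-1`. -/
theorem mem_crookedSheet_iff (ε : ℤˣ) (M : SL2) :
    M ∈ crookedSheet ε ↔ ∃ ξ ∈ crookedCone ε, M = expSL ξ ∨ M = -expSL ξ := by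
  constructor
  · intro h
    by_cases heq : M.1 0 0 = M.1 1 1
    · have hbc : M.1 0 1 * M.1 1 0 ≤ 0 := by
        rcases h with ⟨-, h1⟩ | ⟨h0, -⟩ | ⟨h0, -⟩
        · exact h1
        · rw [h0, mul_zero]
        · rw [h0, zero_mul]
      obtain ⟨ξ, h0, h1, h2⟩ := exists_expSL_eq_stem M heq hbc
      exact ⟨ξ, Or.inl ⟨h0, h1⟩, h2⟩
    · have hd := SL2_det M
      have hz : M.1 0 0 ≠ 0 := by
        intro hz
        rcases h with ⟨h0, -⟩ | ⟨h0, -⟩ | ⟨h0, -⟩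
        · exact heq h0
        · simp [hz, h0] at hd
        · simp [hz, h0] at hd
      rcases lt_or_gt_of_ne hz with hn | hp
      · obtain ⟨ξ, hξ, he⟩ := exists_expSL_eq_of_pos (neg_mem_crookedSheet h)
          (by rw [SL2_neg_apply]; linarith) (by rwa [SL2_neg_apply, SL2_neg_apply, Ne, neg_inj])
        exact ⟨ξ, hξ, Or.inr (by rw [← he, neg_neg])⟩
      · obtain ⟨ξ, hξ, he⟩ := exists_expSL_eq_of_pos h hp heq
        exact ⟨ξ, hξ, Or.inl he⟩
  · rintro ⟨ξ, hξ, rfl | rfl⟩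
    · exact expSL_mem_crookedSheet hξ
    · exact neg_mem_crookedSheet (expSL_mem_crookedSheet hξ)

theorem expSL_conj (h : SL2) (ξ : sl2) : expSL (conj h ξ) = h * expSL ξ * h⁻¹ := by
  apply Subtype.ext
  have h1 : h.1 * (h⁻¹).1 = 1 := congrArg Subtype.val (mul_inv_cancel h)
  have h2 : (h⁻¹).1 * h.1 = 1 := congrArg Subtype.val (inv_mul_cancel h)
  have := Matrix.exp_units_conj (⟨h.1, (h⁻¹).1, h1, h2⟩ : (Matrix (Fin 2) (Fin 2) ℝ)ˣ) ξ.1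
  rw [Matrix.SpecialLinearGroup.coe_mul, Matrix.SpecialLinearGroup.coe_mul]
  exact this

/-- Combines `g exp(Ad(h) ξ) = (gh) exp(ξ) h⁻¹` with the invariance of the sheet under `M ↦ -M`,
which absorbs the choice of lift. -/
theorem adsProj_mem_adsCrookedPlane_iff (ε : ℤˣ) (g h x : SL2) :
    adsProj x ∈ adsCrookedPlane ε (adsProj g) (conj h (mkSl2 1 0 0)) ↔
      ∃ M ∈ crookedSheet ε, x = g * h * M * h⁻¹ := by
  have hiff : ∀ y, adsProj (g * y) = adsProj x ↔ x = g * y ∨ x = -(g * y) := fun y =>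
    adsProj_eq_iff _ _
  rw [adsCrookedPlane_eq]
  constructor
  · rintro ⟨ξ', hξ, he⟩
    obtain ⟨ξ, rfl⟩ := conj_surjective h ξ'
    have hξ' := (mem_minkCrookedPlane_conj ε h ξ).1 hξ
    change adsProj (g * expSL (conj h ξ)) = adsProj x at he
    rw [expSL_conj] at he
    rcases (hiff _).1 he with he | he
    · exact ⟨expSL ξ, expSL_mem_crookedSheet hξ', by rw [he]; simp only [mul_assoc]⟩
    · exact ⟨-expSL ξ, neg_mem_crookedSheet (expSL_mem_crookedSheet hξ'), by
        rw [he]; simp only [mul_assoc, mul_neg, neg_mul]⟩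
  · rintro ⟨M, hM, hx⟩
    obtain ⟨ξ, hξ, he⟩ := (mem_crookedSheet_iff ε M).1 hM
    refine ⟨conj h ξ, (mem_minkCrookedPlane_conj ε h ξ).2 hξ, ?_⟩
    change adsProj (g * expSL (conj h ξ)) = adsProj x
    rw [expSL_conj, hiff, hx]
    rcases he with rfl | rfl
    · left; simp only [mul_assoc]
    · right; simp only [mul_assoc, mul_neg, neg_mul]

/-! ### The tangent cone -/

theorem contDiff_exp_entry (ξ : Matrix (Fin 2) (Fin 2) ℝ) (i j : Fin 2) :
    ContDiff ℝ ∞ (fun t : ℝ => NormedSpace.exp (t • ξ) i j) := by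
  let _ : NormedRing (Matrix (Fin 2) (Fin 2) ℝ) := Matrix.linftyOpNormedRing
  let _ : NormedAlgebra ℝ (Matrix (Fin 2) (Fin 2) ℝ) := Matrix.linftyOpNormedAlgebra
  have h : ContDiff ℝ ∞ (fun X : Matrix (Fin 2) (Fin 2) ℝ => NormedSpace.exp X) :=
    contDiff_iff_contDiffAt.2 fun X => (NormedSpace.exp_analytic (𝕂 := ℝ) X).contDiffAt
  have h2 : ContDiff ℝ ∞ (fun t : ℝ => NormedSpace.exp (t • ξ)) :=
    h.comp (contDiff_id.smul contDiff_const)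
  exact (LinearMap.toContinuousLinearMap
    (Matrix.entryLinearMap ℝ ℝ i j : Matrix (Fin 2) (Fin 2) ℝ →ₗ[ℝ] ℝ)).contDiff.comp h2

theorem smul_mem_crookedCone {ε : ℤˣ} {ξ : sl2} (hξ : ξ ∈ crookedCone ε) {t : ℝ} (ht : 0 ≤ t) :
    t • ξ ∈ crookedCone ε := by
  rcases ht.eq_or_lt with rfl | ht
  · left; simp
  · simp only [crookedCone, mem_ofPred_eq, sl2_smul_apply] at hξ ⊢
    rcases hξ with ⟨h0, h1⟩ | ⟨h0, h1⟩ | ⟨h0, h1⟩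
    · left
      refine ⟨by rw [h0, mul_zero], ?_⟩
      have := mul_nonpos_of_nonneg_of_nonpos (sq_nonneg t) h1
      linarith
    · right; left
      refine ⟨by rw [h0, mul_zero], ?_⟩
      have := mul_pos ht h1
      linarith
    · right; right
      refine ⟨by rw [h0, mul_zero], ?_⟩
      have := mul_neg_of_pos_of_neg ht h1
      linarith

theorem conj_smul (h : SL2) (t : ℝ) (ξ : sl2) : conj h (t • ξ) = t • conj h ξ := by
  apply sl2_ext <;> simp only [conj_00, conj_01, conj_10, sl2_smul_apply] <;> ring

theorem mem_tangentCone_of_mem_crookedCone {ε : ℤˣ} (g h : SL2) {ξ : sl2}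
    (hξ : ξ ∈ crookedCone ε) :
    conj h ξ ∈ tangentCone (adsCrookedPlane ε (adsProj g) (conj h (mkSl2 1 0 0)))
      (adsProj g) := by
  have hM : ∀ t : ℝ, ∀ i j, (g * expSL (t • conj h ξ)).1 i j =
      g.1 i 0 * NormedSpace.exp (t • (conj h ξ).1) 0 j +
        g.1 i 1 * NormedSpace.exp (t • (conj h ξ).1) 1 j := fun t i j => by
    rw [Matrix.SpecialLinearGroup.coe_mul, Matrix.mul_apply, Fin.sum_univ_two]; rfl
  refine ⟨1, fun t => g * expSL (t • conj h ξ), one_pos, ?_, ?_, ?_, ?_⟩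
  · simp only [zero_smul, expSL_zero, mul_one]
  · intro t ht
    rw [adsProj_mem_adsCrookedPlane_iff]
    refine ⟨expSL (t • ξ), expSL_mem_crookedSheet (smul_mem_crookedCone hξ ht.1), ?_⟩
    simp only [← conj_smul, expSL_conj, mul_assoc]
  · intro i j
    simp only [hM]
    exact ((contDiff_const.mul (contDiff_exp_entry _ _ _)).add
      (contDiff_const.mul (contDiff_exp_entry _ _ _))).contDiffOn
  · intro i j
    simp only [hM, zero_smul, expSL_zero, mul_one]
    have h0 := (hasDerivAt_exp_entry (conj h ξ).1 0 j 0).const_mul (g.1 i 0)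
    have h1 := (hasDerivAt_exp_entry (conj h ξ).1 1 j 0).const_mul (g.1 i 1)
    refine ((h0.add h1).congr_deriv ?_).hasDerivWithinAt
    simp only [zero_smul, NormedSpace.exp_zero, one_mul, Matrix.mul_apply (M := g.1),
      Fin.sum_univ_two]

/-- The crooked cone with its strict inequalities weakened. Nothing is gained by weakening them: a
wing point with `a = 0` has `bc = 0` and already lies in the stem (`mem_crookedCone_of_triple`). -/
theorem isClosed_crookedTriples (ε : ℤˣ) :
    IsClosed {x : ℝ × ℝ × ℝ | (x.1 = 0 ∧ x.2.1 * x.2.2 ≤ 0) ∨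
      (x.2.2 = 0 ∧ 0 ≤ ((ε : ℤ) : ℝ) * x.1) ∨ (x.2.1 = 0 ∧ ((ε : ℤ) : ℝ) * x.1 ≤ 0)} := by
  have hε : Continuous fun x : ℝ × ℝ × ℝ => ((ε : ℤ) : ℝ) * x.1 :=
    continuous_const.mul continuous_fst
  have h1 : Continuous fun x : ℝ × ℝ × ℝ => x.2.1 := by fun_prop
  have h2 : Continuous fun x : ℝ × ℝ × ℝ => x.2.2 := by fun_prop
  exact ((isClosed_eq continuous_fst continuous_const).inter
      (isClosed_le (h1.mul h2) continuous_const)).union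
    (((isClosed_eq h2 continuous_const).inter (isClosed_le continuous_const hε)).union
      ((isClosed_eq h1 continuous_const).inter (isClosed_le hε continuous_const)))

theorem mem_crookedCone_of_triple {ε : ℤˣ} {ξ : sl2}
    (h : (ξ.1 0 0 = 0 ∧ ξ.1 0 1 * ξ.1 1 0 ≤ 0) ∨ (ξ.1 1 0 = 0 ∧ 0 ≤ ((ε : ℤ) : ℝ) * ξ.1 0 0) ∨
      (ξ.1 0 1 = 0 ∧ ((ε : ℤ) : ℝ) * ξ.1 0 0 ≤ 0)) : ξ ∈ crookedCone ε := by
  have hε : ((ε : ℤ) : ℝ) ≠ 0 := by exact_mod_cast ε.ne_zero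
  by_cases hz : ξ.1 0 0 = 0
  · left
    refine ⟨hz, ?_⟩
    rcases h with ⟨-, h1⟩ | ⟨h0, -⟩ | ⟨h0, -⟩
    · exact h1
    · rw [h0, mul_zero]
    · rw [h0, zero_mul]
  · have hm := mul_ne_zero hε hz
    rcases h with ⟨h0, -⟩ | ⟨h0, h1⟩ | ⟨h0, h1⟩
    · exact absurd h0 hz
    · exact Or.inr (Or.inl ⟨h0, lt_of_le_of_ne h1 hm.symm⟩)
    · exact Or.inr (Or.inr ⟨h0, lt_of_le_of_ne h1 hm⟩)

/-- The difference quotients of the entries satisfy the weak cone conditions for all small `t > 0`,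
and these pass to the limit. -/
theorem mem_crookedCone_of_path {ε : ℤˣ} {δ : ℝ} (hδ : 0 < δ) (M : ℝ → SL2) (ξ : sl2)
    (h0 : M 0 = 1) (hM : ∀ t ∈ Ico 0 δ, M t ∈ crookedSheet ε)
    (hd : ∀ i j, HasDerivWithinAt (fun t => (M t).1 i j) (ξ.1 i j) (Ico 0 δ) 0) :
    ξ ∈ crookedCone ε := by
  have hmem : Ico 0 δ ∈ nhdsWithin (0 : ℝ) (Ioi 0) :=
    Filter.mem_of_superset (Ioo_mem_nhdsGT hδ) Ioo_subset_Ico_self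
  have hd' : ∀ i j, HasDerivWithinAt (fun t => (M t).1 i j) (ξ.1 i j) (Ioi 0) 0 := fun i j =>
    ((hd i j).mono Ioo_subset_Ico_self).mono_of_mem_nhdsWithin (Ioo_mem_nhdsGT hδ)
  have hs : ∀ i j, Filter.Tendsto (fun t => ((M t).1 i j - (1 : Matrix (Fin 2) (Fin 2) ℝ) i j) / t)
      (nhdsWithin 0 (Ioi 0)) (nhds (ξ.1 i j)) := fun i j => by
    have := (hasDerivWithinAt_iff_tendsto_slope' (lt_irrefl 0)).1 (hd' i j)
    refine this.congr fun t => ?_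
    rw [slope_def_field, h0, sub_zero]
    rfl
  -- Near the identity `a + d > 0`, so `a² - d²` and `a - d` have the same sign.
  have hpos : ∀ᶠ t in nhdsWithin (0 : ℝ) (Ioi 0), 0 < (M t).1 0 0 + (M t).1 1 1 := by
    have hc := ((hd' 0 0).add (hd' 1 1)).continuousWithinAt
    refine (hc.tendsto).eventually (lt_mem_nhds ?_)
    simp [h0]
  -- The quotient of `(a - d)/2` replaces that of `a - 1`: the limit is the same because `ξ` is
  -- traceless, and it vanishes exactly, not just in the limit, when `a = d`.
  have hlim := ((((hs 0 0).sub (hs 1 1)).div_const 2).prodMk_nhds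
    ((hs 0 1).prodMk_nhds (hs 1 0)))
  have hfin := (isClosed_crookedTriples ε).mem_of_tendsto hlim (by
    filter_upwards [hpos, hmem, self_mem_nhdsWithin] with t ht1 ht2 ht
    have ht : 0 < t := ht
    have hi := inv_pos.2 ht
    simp only [Matrix.one_apply_eq, div_eq_mul_inv,
      Matrix.one_apply_ne (zero_ne_one : (0 : Fin 2) ≠ 1),
      Matrix.one_apply_ne (one_ne_zero : (1 : Fin 2) ≠ 0)]
    rcases hM t ht2 with ⟨e, h1⟩ | ⟨e, h1⟩ | ⟨e, h1⟩
    · left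
      rw [e]
      refine ⟨by ring, ?_⟩
      have := mul_nonpos_of_nonneg_of_nonpos (sq_nonneg t⁻¹) h1
      linarith
    · right; left
      refine ⟨by rw [e, sub_zero, zero_mul], ?_⟩
      have h2 : 0 < ((ε : ℤ) : ℝ) * ((M t).1 0 0 - (M t).1 1 1) := by
        refine (mul_pos_iff_of_pos_left ht1).1 ?_
        linarith
      have := mul_pos h2 hi
      linarith
    · right; right
      refine ⟨by rw [e, sub_zero, zero_mul], ?_⟩
      have h2 : ((ε : ℤ) : ℝ) * ((M t).1 0 0 - (M t).1 1 1) < 0 := by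
        refine (mul_neg_iff_of_left_pos ht1).1 ?_
        linarith
      have := mul_neg_of_neg_of_pos h2 hi
      linarith)
  have e : (ξ.1 0 0 - ξ.1 1 1) / 2 = ξ.1 0 0 := by rw [sl2_apply_one_one]; ring
  simp only [mem_ofPred_eq, e] at hfin
  exact mem_crookedCone_of_triple hfin

theorem SL2_mul_mul_apply (A X B : SL2) (i j : Fin 2) : (A * X * B).1 i j =
    (A.1 i 0 * B.1 0 j) * X.1 0 0 + (A.1 i 0 * B.1 1 j) * X.1 0 1 +
      (A.1 i 1 * B.1 0 j) * X.1 1 0 + (A.1 i 1 * B.1 1 j) * X.1 1 1 := by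
  simp only [Matrix.SpecialLinearGroup.coe_mul, Matrix.mul_apply, Fin.sum_univ_two]
  ring

theorem mem_crookedCone_of_mem_tangentCone {ε : ℤˣ} {p : AdS} (h : SL2) {ξ : sl2}
    (hξ : conj h ξ ∈ tangentCone (adsCrookedPlane ε p (conj h (mkSl2 1 0 0))) p) :
    ξ ∈ crookedCone ε := by
  obtain ⟨δ, g, hδ, rfl, hg, -, hd⟩ := hξ
  -- Left translation by `(g(0)h)⁻¹` and right translation by `h` move the path into the model
  -- sheet, starting at `1` with velocity `ξ`.
  refine mem_crookedCone_of_path hδ (fun t => (g 0 * h)⁻¹ * g t * h) ξ (by group) ?_ ?_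
  · intro t ht
    obtain ⟨M, hM, he⟩ := (adsProj_mem_adsCrookedPlane_iff ε (g 0) h (g t)).1 (hg t ht)
    rw [he]
    convert hM using 1
    group
  · intro i j
    simp only [SL2_mul_mul_apply]
    refine ((((((hd 0 0).const_mul _).add ((hd 0 1).const_mul _)).add
      ((hd 1 0).const_mul _)).add ((hd 1 1).const_mul _))).congr_deriv ?_
    have hm : (((g 0 * h)⁻¹).1 * ((g 0).1 * (conj h ξ).1) * h.1) = ξ.1 := by
      have h1 : ((g 0 * h)⁻¹).1 * ((g 0).1 * h.1) = 1 := congrArg Subtype.val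
        (inv_mul_cancel (g 0 * h))
      have h2 : (h⁻¹).1 * h.1 = 1 := congrArg Subtype.val (inv_mul_cancel h)
      calc _ = ((g 0 * h)⁻¹).1 * ((g 0).1 * h.1) * ξ.1 * ((h⁻¹).1 * h.1) := by
            simp only [conj, mul_assoc]
        _ = _ := by rw [h1, h2, one_mul, mul_one]
    have hm' := congrFun (congrFun hm i) j
    rw [← hm']
    generalize (g 0).1 * (conj h ξ).1 = X
    simp only [Matrix.mul_apply, Fin.sum_univ_two]
    ring

theorem coords_image_tangentCone (ε : ℤˣ) (p : AdS) (s : sl2) (hs : adsInner s s = 1) :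
    coords '' tangentCone (adsCrookedPlane ε p s) p = minkCrookedPlane ε 0 (coords s) := by
  obtain ⟨h, rfl⟩ := exists_conj_eq s hs
  obtain ⟨g, rfl⟩ := adsProj_surjective p
  ext v
  obtain ⟨ξ', rfl⟩ := coords.surjective v
  obtain ⟨ξ, rfl⟩ := conj_surjective h ξ'
  rw [mem_minkCrookedPlane_conj]
  constructor
  · rintro ⟨η, hη, he⟩
    rw [coords.injective he] at hη
    exact mem_crookedCone_of_mem_tangentCone h hη
  · intro hξ
    exact ⟨_, mem_tangentCone_of_mem_crookedCone g h hξ, rfl⟩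

/-! ### The topology of the Einstein universe and its linear isometries -/

namespace Ein3

theorem exists_rep (x : Ein3) : ∃ v hv hQ, x = Ein3.mk v hv hQ := by
  obtain ⟨x, hx⟩ := x
  induction x using Projectivization.ind with
  | h v hv =>
    exact ⟨v, hv, hx v (by
      rw [Projectivization.submodule_mk]; exact Submodule.mem_span_singleton_self v), rfl⟩

theorem submodule_mk (v : R32) (hv hQ) : (Ein3.mk v hv hQ).1.submodule = Submodule.span ℝ {v} :=
  Projectivization.submodule_mk v hv

theorem mk_mem_einSection {v : R32} {hv hQ} {F : Submodule ℝ R32} :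
    Ein3.mk v hv hQ ∈ einSection F ↔ v ∈ F := by
  change (Ein3.mk v hv hQ).1.submodule ≤ F ↔ _
  rw [submodule_mk, Submodule.span_singleton_le_iff_mem]

theorem mk_eq_mk_iff {v w : R32} {hv hQ hw hQ'} :
    Ein3.mk v hv hQ = Ein3.mk w hw hQ' ↔ ∃ a : ℝ, a • w = v := by
  rw [Ein3.mk, Ein3.mk, Subtype.mk.injEq, Projectivization.mk_eq_mk_iff']

theorem continuous_mk {α : Type*} [TopologicalSpace α] {f : α → R32} (hf : Continuous f)
    (h0 : ∀ a, f a ≠ 0) (hQ : ∀ a, einQ (f a) = 0) :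
    Continuous fun a => Ein3.mk (f a) (h0 a) (hQ a) := by
  refine Continuous.subtype_mk ?_ _
  have : Continuous fun a => (⟨f a, h0 a⟩ : {v : R32 // v ≠ 0}) := hf.subtype_mk h0
  exact continuous_quotient_mk'.comp this

/-- The points at which a function of homogeneous coordinates is positive. -/
def posSet (f : R32 → ℝ) : Set Ein3 := {x | ∃ v ∈ x.1.submodule, 0 < f v}

theorem mk_mem_posSet {f : R32 → ℝ} (hf : ∀ (c : ℝ) v, f (c • v) = c ^ 2 * f v) {v : R32} {hv hQ} :
    Ein3.mk v hv hQ ∈ posSet f ↔ 0 < f v := by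
  simp only [posSet, mem_ofPred_eq, submodule_mk, Submodule.mem_span_singleton]
  constructor
  · rintro ⟨_, ⟨c, rfl⟩, h⟩
    rw [hf] at h
    by_contra hc
    have := mul_nonpos_of_nonneg_of_nonpos (sq_nonneg c) (not_lt.1 hc)
    linarith
  · intro h
    exact ⟨v, ⟨1, one_smul _ _⟩, h⟩

theorem isOpen_posSet {f : R32 → ℝ} (hc : Continuous f)
    (hf : ∀ (c : ℝ) v, f (c • v) = c ^ 2 * f v) : IsOpen (posSet f) := by
  have h : IsOpen {x : ℙ ℝ R32 | ∃ v ∈ x.submodule, 0 < f v} := by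
    refine isOpen_coinduced.2 ?_
    have : (Quotient.mk'' ⁻¹' {x : ℙ ℝ R32 | ∃ v ∈ x.submodule, 0 < f v} :
        Set {v : R32 // v ≠ 0}) = {v | 0 < f v.1} := by
      ext ⟨v, hv⟩
      change (∃ w ∈ (Projectivization.mk ℝ v hv).submodule, 0 < f w) ↔ 0 < f v
      simp only [Projectivization.submodule_mk, Submodule.mem_span_singleton]
      constructor
      · rintro ⟨_, ⟨c, rfl⟩, h⟩
        rw [hf] at h
        by_contra hc
        have := mul_nonpos_of_nonneg_of_nonpos (sq_nonneg c) (not_lt.1 hc)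
        linarith
      · intro h
        exact ⟨v, ⟨1, one_smul _ _⟩, h⟩
    exact this ▸ (isOpen_lt continuous_const (hc.comp continuous_subtype_val))
  exact h.preimage continuous_subtype_val

end Ein3

/-- The linear isometries of `ℝ^{3,2}`. -/
abbrev EinIsometry : Type := {T : R32 ≃ₗ[ℝ] R32 // ∀ v, einQ (T v) = einQ v}

namespace EinIsometry

/-- The inverse isometry. -/
def symm (T : EinIsometry) : EinIsometry :=
  ⟨T.1.symm, fun v => by rw [← T.2, LinearEquiv.apply_symm_apply]⟩

/-- The action of a linear isometry on the Einstein universe. -/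
def act (T : EinIsometry) (x : Ein3) : Ein3 :=
  ⟨Projectivization.map T.1.toLinearMap T.1.injective x.1, by
    obtain ⟨v, hv, hQ, rfl⟩ := Ein3.exists_rep x
    exact (Ein3.mk (T.1 v) (T.1.map_ne_zero_iff.2 hv) ((T.2 v).trans hQ)).2⟩

theorem act_mk (T : EinIsometry) (v : R32) (hv hQ) : T.act (Ein3.mk v hv hQ) =
    Ein3.mk (T.1 v) (T.1.map_ne_zero_iff.2 hv) ((T.2 v).trans hQ) := rfl

theorem continuous_act (T : EinIsometry) : Continuous T.act := by
  refine Continuous.subtype_mk ?_ _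
  refine Continuous.comp ?_ continuous_subtype_val
  refine continuous_quot_lift _ ?_
  have : Continuous fun v : {v : R32 // v ≠ 0} =>
      (⟨T.1 v.1, T.1.map_ne_zero_iff.2 v.2⟩ : {v : R32 // v ≠ 0}) :=
    (T.1.toLinearMap.continuous_of_finiteDimensional.comp continuous_subtype_val).subtype_mk _
  exact continuous_quotient_mk'.comp this

theorem symm_act_act (T : EinIsometry) (x : Ein3) : T.symm.act (T.act x) = x := by
  obtain ⟨v, hv, hQ, rfl⟩ := Ein3.exists_rep x
  rw [act_mk, act_mk]
  simp only [symm, LinearEquiv.symm_apply_apply]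

theorem act_symm_act (T : EinIsometry) (x : Ein3) : T.act (T.symm.act x) = x :=
  T.symm.symm_act_act x

/-- The homeomorphism of the Einstein universe given by a linear isometry. -/
def homeo (T : EinIsometry) : Ein3 ≃ₜ Ein3 where
  toFun := T.act
  invFun := T.symm.act
  left_inv := T.symm_act_act
  right_inv := T.act_symm_act
  continuous_toFun := T.continuous_act
  continuous_invFun := T.symm.continuous_act

theorem submodule_act (T : EinIsometry) (x : Ein3) :
    (T.act x).1.submodule = x.1.submodule.map T.1.toLinearMap := by
  obtain ⟨v, hv, hQ, rfl⟩ := Ein3.exists_rep x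
  rw [act_mk, Ein3.submodule_mk, Ein3.submodule_mk, Submodule.map_span, image_singleton]
  rfl

theorem eq_image_of_mem_iff (T : EinIsometry) {A B : Set Ein3} (h : ∀ x, T.act x ∈ A ↔ x ∈ B) :
    A = T.act '' B := by
  ext y
  constructor
  · intro hy
    exact ⟨T.symm.act y, (h _).1 (by rwa [act_symm_act]), T.act_symm_act y⟩
  · rintro ⟨x, hx, rfl⟩
    exact (h x).2 hx

theorem einSection_map (T : EinIsometry) (F : Submodule ℝ R32) :
    einSection (F.map T.1.toLinearMap) = T.act '' einSection F := by
  refine T.eq_image_of_mem_iff fun x => ?_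
  change (T.act x).1.submodule ≤ _ ↔ x.1.submodule ≤ F
  rw [submodule_act]
  exact Submodule.map_le_map_iff_of_injective T.1.injective _ _

theorem isPhoton_image (T : EinIsometry) {φ : Set Ein3} (h : IsPhoton φ) :
    IsPhoton (T.act '' φ) := by
  obtain ⟨P, hP, hQ, rfl⟩ := h
  refine ⟨P.map T.1.toLinearMap, ?_, ?_, (T.einSection_map P).symm⟩
  · rw [← hP]; exact LinearEquiv.finrank_map_eq T.1 P
  · rintro _ ⟨v, hv, rfl⟩
    exact (T.2 v).trans (hQ v hv)

theorem act_mem_photonThrough (T : EinIsometry) {p q x : Ein3} (h : x ∈ photonThrough p q) :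
    T.act x ∈ photonThrough (T.act p) (T.act q) := by
  obtain ⟨φ, hφ, hp, hq, hx⟩ := h
  exact ⟨_, T.isPhoton_image hφ, mem_image_of_mem _ hp, mem_image_of_mem _ hq,
    mem_image_of_mem _ hx⟩

theorem act_mem_lightcone (T : EinIsometry) {p x : Ein3} (h : x ∈ lightcone p) :
    T.act x ∈ lightcone (T.act p) := by
  obtain ⟨φ, hφ, hp, hx⟩ := h
  exact ⟨_, T.isPhoton_image hφ, mem_image_of_mem _ hp, mem_image_of_mem _ hx⟩

theorem act_mem_lightcone_iff (T : EinIsometry) {p x : Ein3} :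
    T.act x ∈ lightcone (T.act p) ↔ x ∈ lightcone p := by
  refine ⟨fun h => ?_, T.act_mem_lightcone⟩
  have := T.symm.act_mem_lightcone h
  rwa [symm_act_act, symm_act_act] at this

theorem photonThrough_act (T : EinIsometry) (p q : Ein3) :
    photonThrough (T.act p) (T.act q) = T.act '' photonThrough p q := by
  refine T.eq_image_of_mem_iff fun x => ⟨fun h => ?_, T.act_mem_photonThrough⟩
  have := T.symm.act_mem_photonThrough h
  rwa [symm_act_act, symm_act_act, symm_act_act] at this

theorem lightcone_act (T : EinIsometry) (p : Ein3) :
    lightcone (T.act p) = T.act '' lightcone p :=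
  T.eq_image_of_mem_iff fun _ => T.act_mem_lightcone_iff

theorem act_bijective (T : EinIsometry) : Function.Bijective T.act := T.homeo.bijective

theorem minkowskiPatch_act (T : EinIsometry) (p : Ein3) :
    minkowskiPatch (T.act p) = T.act '' minkowskiPatch p := by
  rw [minkowskiPatch, lightcone_act, minkowskiPatch, image_compl_eq T.act_bijective]

theorem isTimelikeCircle_image (T : EinIsometry) {K : Set Ein3} (h : IsTimelikeCircle K) :
    IsTimelikeCircle (T.act '' K) := by
  obtain ⟨F, N, hF, hNF, hN, hneg, ⟨v, hv, hpos⟩, rfl⟩ := h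
  refine ⟨F.map T.1.toLinearMap, N.map T.1.toLinearMap, ?_, Submodule.map_mono hNF, ?_, ?_,
    ⟨T.1 v, Submodule.mem_map_of_mem hv, by rwa [T.2]⟩, (T.einSection_map F).symm⟩
  · rw [← hF]; exact LinearEquiv.finrank_map_eq T.1 F
  · rw [← hN]; exact LinearEquiv.finrank_map_eq T.1 N
  · rintro _ ⟨w, hw, rfl⟩ hne
    have : w ≠ 0 := by rintro rfl; exact hne (map_zero _)
    exact (T.2 w).trans_lt (hneg w hw this)

theorem connectedComponentIn_act (T : EinIsometry) {A : Set Ein3} {x : Ein3} (hx : x ∈ A) :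
    connectedComponentIn (T.act '' A) (T.act x) = T.act '' connectedComponentIn A x :=
  (T.homeo.image_connectedComponentIn hx).symm

/-- The action on stem configurations. -/
def mapConfig (T : EinIsometry) (c : StemConfiguration) : StemConfiguration where
  vertex := T.act c.vertex
  covertex := T.act c.covertex
  hingept j := T.act (c.hingept j)
  not_incident h := c.not_incident (T.act_mem_lightcone_iff.1 h)
  hingept_ne h := c.hingept_ne (T.act_bijective.1 h)
  hingept_mem j := ⟨T.act_mem_lightcone (c.hingept_mem j).1, T.act_mem_lightcone (c.hingept_mem j).2⟩

variable (T : EinIsometry) (c : StemConfiguration)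

theorem hinge_mapConfig (j : Fin 2) : (T.mapConfig c).hinge j = T.act '' c.hinge j :=
  T.photonThrough_act _ _

theorem cohinge_mapConfig (j : Fin 2) : (T.mapConfig c).cohinge j = T.act '' c.cohinge j :=
  T.photonThrough_act _ _

theorem edges_mapConfig : (T.mapConfig c).edges = T.act '' c.edges := by
  simp only [StemConfiguration.edges, hinge_mapConfig, cohinge_mapConfig, image_iUnion, image_union]

theorem hypersphere_mapConfig : (T.mapConfig c).hypersphere = T.act '' c.hypersphere := by
  simp only [StemConfiguration.hypersphere, mapConfig, submodule_act]
  rw [← einSection_map, Submodule.map_sup, Submodule.map_sup, Submodule.map_sup]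

theorem isStemSquare_mapConfig {S : Set Ein3} (h : c.IsStemSquare S) :
    (T.mapConfig c).IsStemSquare (T.act '' S) := by
  obtain ⟨⟨x, hx, rfl⟩, K, hK, h0, h1, y, hy, hyK⟩ := h
  refine ⟨⟨T.act x, ?_, ?_⟩, T.act '' K, T.isTimelikeCircle_image hK, mem_image_of_mem _ h0,
    mem_image_of_mem _ h1, T.act y, mem_image_of_mem _ hy, mem_image_of_mem _ hyK⟩
  · rw [hypersphere_mapConfig, edges_mapConfig, ← image_sdiff T.act_bijective.1]
    exact mem_image_of_mem _ hx
  · rw [hypersphere_mapConfig, edges_mapConfig, ← image_sdiff T.act_bijective.1,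
      T.connectedComponentIn_act hx]

theorem symm_mapConfig_mapConfig : T.symm.mapConfig (T.mapConfig c) = c := by
  obtain ⟨_, _, _, _, _, _⟩ := c
  simp only [mapConfig, symm_act_act]

theorem stem_mapConfig : ⋃₀ {S | (T.mapConfig c).IsStemSquare S} =
    T.act '' ⋃₀ {S | c.IsStemSquare S} := by
  ext y
  constructor
  · rintro ⟨S, hS, hy⟩
    -- Transport in one direction suffices: the other inclusion applies it to the inverse isometry.
    have := T.symm.isStemSquare_mapConfig _ hS
    rw [symm_mapConfig_mapConfig] at this
    exact ⟨T.symm.act y, ⟨_, this, mem_image_of_mem _ hy⟩, T.act_symm_act y⟩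
  · rintro ⟨x, ⟨S, hS, hx⟩, rfl⟩
    exact ⟨_, T.isStemSquare_mapConfig c hS, mem_image_of_mem _ hx⟩

theorem isBigon_mapConfig {j : Fin 2} {B : Set Ein3} (h : c.IsBigon j B) :
    (T.mapConfig c).IsBigon j (T.act '' B) := by
  obtain ⟨x, hx, rfl⟩ := h
  have he : lightcone ((T.mapConfig c).hingept j) \
      ((T.mapConfig c).hinge j ∪ (T.mapConfig c).cohinge j) =
      T.act '' (lightcone (c.hingept j) \ (c.hinge j ∪ c.cohinge j)) := by
    rw [image_sdiff T.act_bijective.1, image_union, hinge_mapConfig, cohinge_mapConfig,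
      ← lightcone_act]
    rfl
  exact ⟨T.act x, he ▸ mem_image_of_mem _ hx, by rw [he, T.connectedComponentIn_act hx]⟩

theorem isCrookedSurface_mapConfig {S : Set Ein3} (h : c.IsCrookedSurface S) :
    (T.mapConfig c).IsCrookedSurface (T.act '' S) := by
  obtain ⟨W₁, W₂, h1, h2, hop, rfl⟩ := h
  refine ⟨T.act '' W₁, T.act '' W₂, T.isBigon_mapConfig c h1, T.isBigon_mapConfig c h2, ?_, ?_⟩
  · rintro _ ⟨x, hx, rfl⟩ _ ⟨y, hy, rfl⟩ hxy
    have he : minkowskiPatch (T.mapConfig c).covertex \ (T.mapConfig c).hypersphere =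
        T.act '' (minkowskiPatch c.covertex \ c.hypersphere) := by
      rw [image_sdiff T.act_bijective.1, hypersphere_mapConfig, ← minkowskiPatch_act]
      rfl
    rw [he] at hxy
    -- `connectedComponentIn` is empty at a point outside the set, so that case is separate.
    by_cases hxm : x ∈ minkowskiPatch c.covertex \ c.hypersphere
    · rw [T.connectedComponentIn_act hxm] at hxy
      exact hop x hx y hy ((T.act_bijective.1.mem_set_image).1 hxy)
    · rw [connectedComponentIn_eq_empty] at hxy
      · exact hxy
      · rwa [T.act_bijective.1.mem_set_image]
  · rw [stem_mapConfig, edges_mapConfig, image_union, image_union, image_union]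

end EinIsometry

/-! ### Subsets of the Einstein universe in homogeneous coordinates -/

/-- The polarization of the quadratic form `einQ`. -/
def einB (v w : R32) : ℝ := v 0 * w 0 + v 1 * w 1 - v 2 * w 2 - (v 3 * w 4 + v 4 * w 3) / 2

theorem einQ_combination (a b : ℝ) (v w : R32) :
    einQ (a • v + b • w) = a ^ 2 * einQ v + b ^ 2 * einQ w + 2 * a * b * einB v w := by
  simp [einQ, einB]; ring

theorem einB_eq_zero_of_isPhoton {φ : Set Ein3} (h : IsPhoton φ) {v w : R32} {hv hQ hw hQ'}
    (hvφ : Ein3.mk v hv hQ ∈ φ) (hwφ : Ein3.mk w hw hQ' ∈ φ) : einB v w = 0 := by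
  obtain ⟨P, -, hP, rfl⟩ := h
  rw [Ein3.mk_mem_einSection] at hvφ hwφ
  have := hP _ (P.add_mem (P.smul_mem 1 hvφ) (P.smul_mem 1 hwφ))
  rw [einQ_combination, hQ, hQ'] at this
  linarith

theorem isPhoton_span_pair {v w : R32} (hQ : einQ v = 0) (hQ' : einQ w = 0) (hB : einB v w = 0)
    (hi : LinearIndependent ℝ ![v, w]) : IsPhoton (einSection (Submodule.span ℝ {v, w})) := by
  refine ⟨_, ?_, ?_, rfl⟩
  · have := finrank_span_eq_card hi
    rwa [Matrix.range_cons_cons_empty, Fintype.card_fin] at this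
  · intro u hu
    obtain ⟨a, b, rfl⟩ := Submodule.mem_span_pair.1 hu
    rw [einQ_combination, hQ, hQ', hB]
    ring

namespace Ein3

/-- The points all of whose homogeneous coordinates satisfy a given condition. -/
def homSet (P : R32 → Prop) : Set Ein3 := {x | ∀ v ∈ x.1.submodule, v ≠ 0 → P v}

theorem mk_mem_homSet {P : R32 → Prop} (hP : ∀ (c : ℝ) v, c ≠ 0 → P v → P (c • v)) {v : R32}
    {hv hQ} : Ein3.mk v hv hQ ∈ homSet P ↔ P v := by
  simp only [homSet, mem_ofPred_eq, submodule_mk, Submodule.mem_span_singleton]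
  constructor
  · intro h
    exact h v ⟨1, one_smul _ _⟩ hv
  · rintro h _ ⟨c, rfl⟩ hc
    exact hP c v (by rintro rfl; simp at hc) h

/-- A function homogeneous of degree two has a well-defined sign on projective points, and the sign
is locally constant where it does not vanish. This is the tool for separating connected components.
-/
theorem subset_posSet_of_isPreconnected {f : R32 → ℝ} (hc : Continuous f)
    (hf : ∀ (c : ℝ) v, f (c • v) = c ^ 2 * f v) {A : Set Ein3} (hA : IsPreconnected A)
    (hne : ∀ v hv hQ, Ein3.mk v hv hQ ∈ A → f v ≠ 0) {x : Ein3} (hx : x ∈ A)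
    (hxf : x ∈ posSet f) : A ⊆ posSet f := by
  have hf' : ∀ (c : ℝ) v, (fun v => -f v) (c • v) = c ^ 2 * (fun v => -f v) v := fun c v => by
    simp only [hf]; ring
  refine hA.subset_left_of_subset_union (isOpen_posSet hc hf) (isOpen_posSet hc.neg hf') ?_ ?_
    ⟨x, hx, hxf⟩
  · rw [disjoint_left]
    intro y h1 h2
    obtain ⟨v, hv, hQ, rfl⟩ := exists_rep y
    rw [mk_mem_posSet hf] at h1
    rw [mk_mem_posSet hf'] at h2
    exact absurd h1 (not_lt.2 (neg_pos.1 h2).le)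
  · intro y hy
    obtain ⟨v, hv, hQ, rfl⟩ := exists_rep y
    rcases lt_or_gt_of_ne (hne v hv hQ hy) with h | h
    · right; rw [mk_mem_posSet hf']; exact neg_pos.2 h
    · left; rw [mk_mem_posSet hf]; exact h

theorem mk_smul_eq (c : ℝ) (v : R32) {hv hQ hv' hQ'} :
    Ein3.mk (c • v) hv' hQ' = Ein3.mk v hv hQ := mk_eq_mk_iff.2 ⟨c, rfl⟩

end Ein3

/-! ### The standard stem configuration -/

/-- The signs distinguishing the two hingepoints of the standard configuration. -/
def hingeSign (j : Fin 2) : ℝ := if j = 0 then 1 else -1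

theorem hingeSign_sq (j : Fin 2) : hingeSign j * hingeSign j = 1 := by
  unfold hingeSign; split_ifs <;> norm_num

/-- Homogeneous coordinates of the standard vertex. -/
def vertexVec : R32 := ![0, 0, 0, 0, 1]
/-- Homogeneous coordinates of the standard covertex. -/
def covertexVec : R32 := ![0, 0, 0, 1, 0]
/-- Homogeneous coordinates of the standard hingepoints. -/
def hingeVec (j : Fin 2) : R32 := ![0, hingeSign j, 1, 0, 0]

theorem R32_ext {v w : R32} (h0 : v 0 = w 0) (h1 : v 1 = w 1) (h2 : v 2 = w 2) (h3 : v 3 = w 3)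
    (h4 : v 4 = w 4) : v = w := by
  ext i; fin_cases i <;> assumption

/-- The standard vertex. -/
def stdVertex : Ein3 := Ein3.mk vertexVec (fun h => by simpa [vertexVec] using congrFun h 4)
  (by simp [einQ, vertexVec])
/-- The standard covertex. -/
def stdCovertex : Ein3 := Ein3.mk covertexVec (fun h => by simpa [covertexVec] using congrFun h 3)
  (by simp [einQ, covertexVec])
/-- The standard hingepoints. -/
def stdHingept (j : Fin 2) : Ein3 := Ein3.mk (hingeVec j)
  (fun h => by simpa [hingeVec] using congrFun h 2)
  (by simp [einQ, hingeVec, pow_two, hingeSign_sq])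

theorem linearIndependent_vertex (j : Fin 2) : LinearIndependent ℝ ![vertexVec, hingeVec j] := by
  refine LinearIndependent.pair_iff.2 fun a b h => ?_
  have h4 := congrFun h 4
  have h2 := congrFun h 2
  simp [vertexVec, hingeVec] at h4 h2
  exact ⟨h4, h2⟩

theorem linearIndependent_covertex (j : Fin 2) :
    LinearIndependent ℝ ![covertexVec, hingeVec j] := by
  refine LinearIndependent.pair_iff.2 fun a b h => ?_
  have h3 := congrFun h 3
  have h2 := congrFun h 2
  simp [covertexVec, hingeVec] at h3 h2
  exact ⟨h3, h2⟩

theorem mem_stdHinge_iff (j : Fin 2) {v : R32} {hv hQ} :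
    Ein3.mk v hv hQ ∈ photonThrough stdVertex (stdHingept j) ↔
      v 0 = 0 ∧ v 1 = hingeSign j * v 2 ∧ v 3 = 0 := by
  have hs := hingeSign_sq j
  constructor
  · rintro ⟨φ, hφ, h0, h1, h⟩
    have e0 := einB_eq_zero_of_isPhoton hφ h0 h
    have e1 := einB_eq_zero_of_isPhoton hφ h1 h
    simp [einB, vertexVec, hingeVec] at e0 e1
    have e2 : v 1 = hingeSign j * v 2 := by
      linear_combination hingeSign j * e1 - v 1 * hs
    refine ⟨?_, e2, e0⟩
    simp only [einQ, e0, e2] at hQ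
    have : v 0 ^ 2 = 0 := by linear_combination hQ - v 2 ^ 2 * hs
    simpa using this
  · rintro ⟨h0, h1, h3⟩
    refine ⟨_, isPhoton_span_pair (v := vertexVec) (w := hingeVec j) (by simp [einQ, vertexVec])
      (by simp [einQ, hingeVec, pow_two, hs]) (by simp [einB, vertexVec, hingeVec])
      (linearIndependent_vertex j), ?_, ?_, ?_⟩
    · exact Ein3.mk_mem_einSection.2 (Submodule.subset_span (by simp))
    · exact Ein3.mk_mem_einSection.2 (Submodule.subset_span (by simp))
    · refine Ein3.mk_mem_einSection.2 (Submodule.mem_span_pair.2 ⟨v 4, v 2, ?_⟩)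
      apply R32_ext <;> simp [vertexVec, hingeVec, h0, h1, h3, mul_comm]

theorem mem_stdCohinge_iff (j : Fin 2) {v : R32} {hv hQ} :
    Ein3.mk v hv hQ ∈ photonThrough stdCovertex (stdHingept j) ↔
      v 0 = 0 ∧ v 1 = hingeSign j * v 2 ∧ v 4 = 0 := by
  have hs := hingeSign_sq j
  constructor
  · rintro ⟨φ, hφ, h0, h1, h⟩
    have e0 := einB_eq_zero_of_isPhoton hφ h0 h
    have e1 := einB_eq_zero_of_isPhoton hφ h1 h
    simp [einB, covertexVec, hingeVec] at e0 e1
    have e2 : v 1 = hingeSign j * v 2 := by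
      linear_combination hingeSign j * e1 - v 1 * hs
    refine ⟨?_, e2, e0⟩
    simp only [einQ, e0, e2] at hQ
    have : v 0 ^ 2 = 0 := by linear_combination hQ - v 2 ^ 2 * hs
    simpa using this
  · rintro ⟨h0, h1, h4⟩
    refine ⟨_, isPhoton_span_pair (v := covertexVec) (w := hingeVec j)
      (by simp [einQ, covertexVec]) (by simp [einQ, hingeVec, pow_two, hs])
      (by simp [einB, covertexVec, hingeVec]) (linearIndependent_covertex j), ?_, ?_, ?_⟩
    · exact Ein3.mk_mem_einSection.2 (Submodule.subset_span (by simp))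
    · exact Ein3.mk_mem_einSection.2 (Submodule.subset_span (by simp))
    · refine Ein3.mk_mem_einSection.2 (Submodule.mem_span_pair.2 ⟨v 3, v 2, ?_⟩)
      apply R32_ext <;> simp [covertexVec, hingeVec, h0, h1, h4, mul_comm]

theorem photonThrough_subset_lightcone {p q : Ein3} : photonThrough p q ⊆ lightcone p :=
  fun _ ⟨φ, hφ, hp, _, hx⟩ => ⟨φ, hφ, hp, hx⟩

/-- The standard stem configuration. -/
def stdConfig : StemConfiguration where
  vertex := stdVertex
  covertex := stdCovertex
  hingept := stdHingept
  not_incident := by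
    rintro ⟨φ, hφ, h0, h1⟩
    have := einB_eq_zero_of_isPhoton hφ h0 h1
    simp [einB, vertexVec, covertexVec] at this
  hingept_ne h := by
    obtain ⟨a, ha⟩ := Ein3.mk_eq_mk_iff.1 h
    have h1 := congrFun ha 1
    have h2 := congrFun ha 2
    simp [hingeVec, hingeSign] at h1 h2
    linarith
  hingept_mem j := ⟨photonThrough_subset_lightcone
      ((mem_stdHinge_iff j).2 (by simp [hingeVec])),
    photonThrough_subset_lightcone ((mem_stdCohinge_iff j).2 (by simp [hingeVec]))⟩

theorem mem_stdConfig_hinge (j : Fin 2) {v : R32} {hv hQ} :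
    Ein3.mk v hv hQ ∈ stdConfig.hinge j ↔ v 0 = 0 ∧ v 1 = hingeSign j * v 2 ∧ v 3 = 0 :=
  mem_stdHinge_iff j

theorem mem_stdConfig_cohinge (j : Fin 2) {v : R32} {hv hQ} :
    Ein3.mk v hv hQ ∈ stdConfig.cohinge j ↔ v 0 = 0 ∧ v 1 = hingeSign j * v 2 ∧ v 4 = 0 :=
  mem_stdCohinge_iff j

/-- On the null cone `X = 0` and `Y² = Z²` force `UV = 0`: the factor `U` gives the hinges and `V`
the cohinges. -/
theorem mem_stdConfig_edges {v : R32} {hv hQ} :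
    Ein3.mk v hv hQ ∈ stdConfig.edges ↔ v 0 = 0 ∧ v 1 ^ 2 = v 2 ^ 2 := by
  simp only [StemConfiguration.edges, mem_iUnion, mem_union, mem_stdConfig_hinge,
    mem_stdConfig_cohinge]
  constructor
  · rintro ⟨j, h⟩
    have hs := hingeSign_sq j
    rcases h with ⟨h0, h1, -⟩ | ⟨h0, h1, -⟩
    all_goals exact ⟨h0, by rw [h1]; linear_combination v 2 ^ 2 * hs⟩
  · rintro ⟨h0, h1⟩
    have h34 : v 3 = 0 ∨ v 4 = 0 := by
      simp only [einQ, h0] at hQ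
      refine mul_eq_zero.1 ?_
      linarith
    rcases sq_eq_sq_iff_eq_or_eq_neg.1 h1 with h | h
    · exact ⟨0, h34.imp (fun e => ⟨h0, by simpa [hingeSign] using h, e⟩)
        (fun e => ⟨h0, by simpa [hingeSign] using h, e⟩)⟩
    · exact ⟨1, h34.imp (fun e => ⟨h0, by simpa [hingeSign] using h, e⟩)
        (fun e => ⟨h0, by simpa [hingeSign] using h, e⟩)⟩

theorem mem_stdConfig_hypersphere {v : R32} {hv hQ} :
    Ein3.mk v hv hQ ∈ stdConfig.hypersphere ↔ v 0 = 0 := by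
  have e : stdConfig.hypersphere = einSection (Submodule.span ℝ {vertexVec} ⊔
      Submodule.span ℝ {covertexVec} ⊔ Submodule.span ℝ {hingeVec 0} ⊔
      Submodule.span ℝ {hingeVec 1}) := by
    simp only [StemConfiguration.hypersphere, stdConfig, stdVertex, stdCovertex, stdHingept,
      Ein3.submodule_mk]
  rw [e, Ein3.mk_mem_einSection]
  constructor
  · intro h
    have hle : Submodule.span ℝ {vertexVec} ⊔
      Submodule.span ℝ {covertexVec} ⊔ Submodule.span ℝ {hingeVec 0} ⊔
      Submodule.span ℝ {hingeVec 1} ≤ LinearMap.ker (LinearMap.proj (R := ℝ) (φ := fun _ => ℝ)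
        (0 : Fin 5)) := by
      refine sup_le (sup_le (sup_le ?_ ?_) ?_) ?_ <;>
        rw [Submodule.span_singleton_le_iff_mem] <;> simp [vertexVec, covertexVec, hingeVec]
    simpa using hle h
  · intro h
    have hv : v = v 4 • vertexVec + v 3 • covertexVec + ((v 2 + v 1) / 2) • hingeVec 0 +
        ((v 2 - v 1) / 2) • hingeVec 1 := by
      apply R32_ext <;> simp [vertexVec, covertexVec, hingeVec, hingeSign, h] <;> ring
    rw [hv]
    exact Submodule.add_mem_sup (Submodule.add_mem_sup (Submodule.add_mem_sup
      (Submodule.smul_mem _ _ (Submodule.mem_span_singleton_self _))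
      (Submodule.smul_mem _ _ (Submodule.mem_span_singleton_self _)))
      (Submodule.smul_mem _ _ (Submodule.mem_span_singleton_self _)))
      (Submodule.smul_mem _ _ (Submodule.mem_span_singleton_self _))

/-! ### The bigons of the standard configuration -/

theorem mem_stdConfig_bigonDomain (j : Fin 2) {v : R32} {hv hQ} :
    Ein3.mk v hv hQ ∈ lightcone (stdConfig.hingept j) \ (stdConfig.hinge j ∪ stdConfig.cohinge j) ↔
      v 1 = hingeSign j * v 2 ∧ v 0 ≠ 0 := by
  have hs := hingeSign_sq j
  simp only [mem_sdiff, mem_union, mem_stdConfig_hinge, mem_stdConfig_cohinge]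
  constructor
  · rintro ⟨⟨φ, hφ, h0, h1⟩, h⟩
    have e1 := einB_eq_zero_of_isPhoton hφ (v := hingeVec j)
      (hQ := by simp [einQ, hingeVec, pow_two, hs]) h0 h1
    simp [einB, hingeVec] at e1
    have e2 : v 1 = hingeSign j * v 2 := by linear_combination hingeSign j * e1 - v 1 * hs
    refine ⟨e2, fun e0 => h ?_⟩
    have h34 : v 3 = 0 ∨ v 4 = 0 := by
      simp only [einQ, e0, e2] at hQ
      refine mul_eq_zero.1 ?_
      linear_combination v 2 ^ 2 * hs - hQ
    exact h34.imp (fun e => ⟨e0, e2, e⟩) (fun e => ⟨e0, e2, e⟩)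
  · rintro ⟨h1, h0⟩
    refine ⟨⟨_, isPhoton_span_pair (v := hingeVec j) (w := v) ?_ hQ ?_ ?_, ?_, ?_⟩, ?_⟩
    · simp [einQ, hingeVec, pow_two, hs]
    · simp [einB, hingeVec, h1]; linear_combination v 2 * hs
    · refine LinearIndependent.pair_iff.2 fun a b h => ?_
      have e0 := congrFun h 0
      have e2 := congrFun h 2
      simp [hingeVec, h0] at e0 e2
      rw [e0] at e2
      exact ⟨by simpa using e2, e0⟩
    · exact (Ein3.mk_mem_einSection (v := hingeVec j)
        (hQ := by simp [einQ, hingeVec, pow_two, hs])).2 (Submodule.subset_span (by simp))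
    · exact Ein3.mk_mem_einSection.2 (Submodule.subset_span (by simp))
    · rintro (⟨h, -⟩ | ⟨h, -⟩) <;> exact h0 h

/-- The bigons of the standard configuration. -/
def stdBigon (j : Fin 2) (σ : ℤˣ) : Set Ein3 :=
  Ein3.homSet fun v => v 1 = hingeSign j * v 2 ∧ 0 < ((σ : ℤ) : ℝ) * (v 0 * (v 3 + v 4))

theorem mk_mem_stdBigon {j : Fin 2} {σ : ℤˣ} {v : R32} {hv hQ} :
    Ein3.mk v hv hQ ∈ stdBigon j σ ↔
      v 1 = hingeSign j * v 2 ∧ 0 < ((σ : ℤ) : ℝ) * (v 0 * (v 3 + v 4)) := by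
  refine Ein3.mk_mem_homSet (P := fun v => v 1 = hingeSign j * v 2 ∧
    0 < ((σ : ℤ) : ℝ) * (v 0 * (v 3 + v 4))) fun c v hc h => ?_
  simp only [Pi.smul_apply, smul_eq_mul]
  refine ⟨by rw [h.1]; ring, ?_⟩
  have := mul_pos (pow_pos (abs_pos.2 hc) 2) h.2
  rw [sq_abs] at this
  linarith

theorem sign_sq (σ : ℤˣ) : ((σ : ℤ) : ℝ) * ((σ : ℤ) : ℝ) = 1 := by
  rcases Int.units_eq_one_or σ with rfl | rfl <;> simp

theorem isPreconnected_stdBigon (j : Fin 2) (σ : ℤˣ) : IsPreconnected (stdBigon j σ) := by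
  have hs := hingeSign_sq j
  have hσ := sign_sq σ
  -- On this lightcone `X² = UV`, and on the bigon `X ≠ 0`. Representatives can thus be chosen with
  -- `U, V > 0`; writing `U` and `V` as squares of exponentials makes `X` their signed geometric
  -- mean, so the bigon is a continuous image of `ℝ³`.
  let f : ℝ × ℝ × ℝ → R32 := fun x => ![((σ : ℤ) : ℝ) * (Real.exp x.2.1 * Real.exp x.2.2),
    hingeSign j * x.1, x.1, Real.exp x.2.1 ^ 2, Real.exp x.2.2 ^ 2]
  have hf : Continuous f := by
    refine continuous_pi fun i => ?_
    fin_cases i <;> simp [f] <;> fun_prop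
  have hf0 : ∀ x, f x ≠ 0 := fun x h => by
    have := congrFun h 3
    simp [f] at this
  have hfQ : ∀ x, einQ (f x) = 0 := fun x => by
    simp [einQ, f]
    linear_combination x.1 ^ 2 * hs + (Real.exp x.2.1 * Real.exp x.2.2) ^ 2 * hσ
  have hr : stdBigon j σ = range fun x => Ein3.mk (f x) (hf0 x) (hfQ x) := by
    have key : ∀ v hv hQ, Ein3.mk v hv hQ ∈ stdBigon j σ → 0 < v 3 →
        Ein3.mk v hv hQ ∈ range fun x => Ein3.mk (f x) (hf0 x) (hfQ x) := by
      intro v hv hQ h h3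
      rw [mk_mem_stdBigon] at h
      obtain ⟨h1, h2⟩ := h
      have hq : v 0 ^ 2 = v 3 * v 4 := by
        simp only [einQ, h1] at hQ
        linear_combination hQ - v 2 ^ 2 * hs
      have hv0 : v 0 ≠ 0 := by rintro h; simp [h] at h2
      have h4 : 0 < v 4 := by
        have : 0 < v 3 * v 4 := by rw [← hq]; positivity
        exact (mul_pos_iff_of_pos_left h3).1 this
      refine ⟨(v 2, Real.log (v 3) / 2, Real.log (v 4) / 2), ?_⟩
      have e3 : Real.exp (Real.log (v 3) / 2) ^ 2 = v 3 := by
        rw [← Real.exp_nat_mul]; push_cast; rw [mul_div_cancel₀ _ two_ne_zero, Real.exp_log h3]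
      have e4 : Real.exp (Real.log (v 4) / 2) ^ 2 = v 4 := by
        rw [← Real.exp_nat_mul]; push_cast; rw [mul_div_cancel₀ _ two_ne_zero, Real.exp_log h4]
      have e0 : Real.exp (Real.log (v 3) / 2) * Real.exp (Real.log (v 4) / 2) =
          ((σ : ℤ) : ℝ) * v 0 := by
        have hp : 0 < ((σ : ℤ) : ℝ) * v 0 := by
          have : 0 < (v 3 + v 4) * (((σ : ℤ) : ℝ) * v 0) := by linarith
          exact (mul_pos_iff_of_pos_left (by linarith)).1 this
        rw [← sq_eq_sq₀ (by positivity) hp.le, mul_pow, e3, e4]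
        linear_combination v 0 ^ 2 * (-hσ) - hq
      refine Ein3.mk_eq_mk_iff.2 ⟨1, ?_⟩
      rw [one_smul]
      apply R32_ext
      · simp only [f, Matrix.cons_val_zero, e0]
        linear_combination v 0 * (-hσ)
      · simp [f, h1]
      · simp [f]
      · simp only [f, Matrix.cons_val]; exact e3.symm
      · simp only [f, Matrix.cons_val]; exact e4.symm
    apply Subset.antisymm
    · intro x hx
      obtain ⟨v, hv, hQ, rfl⟩ := Ein3.exists_rep x
      have hx' := mk_mem_stdBigon.1 hx
      have h3 : v 3 ≠ 0 := by
        intro h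
        have hq : v 0 ^ 2 = 0 := by
          simp only [einQ, hx'.1, h] at hQ
          linear_combination hQ - v 2 ^ 2 * hs
        have h0 : v 0 = 0 := by simpa using hq
        simp [h0] at hx'
      rcases lt_or_gt_of_ne h3 with h3 | h3
      · have hv' : (-1 : ℝ) • v ≠ 0 := smul_ne_zero (by norm_num) hv
        have hQ' : einQ ((-1 : ℝ) • v) = 0 := by rw [einQ_smul, hQ, mul_zero]
        rw [← Ein3.mk_smul_eq (-1) v (hv' := hv') (hQ' := hQ')] at hx ⊢
        exact key _ _ _ hx (by simpa using h3)
      · exact key _ _ _ hx h3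
    · rintro _ ⟨x, rfl⟩
      rw [mk_mem_stdBigon]
      refine ⟨by simp [f], ?_⟩
      simp only [f, Matrix.cons_val_zero, Matrix.cons_val]
      rw [← mul_assoc, ← mul_assoc, hσ]
      positivity
  rw [hr]
  exact isPreconnected_range (Ein3.continuous_mk hf hf0 hfQ)

/-- Off the hinge and cohinge `UV = X² > 0`, so `U + V ≠ 0` and the sign of `X(U+V)` is constant on
components; each sign class is connected. -/
theorem connectedComponentIn_bigonDomain {j : Fin 2} {σ : ℤˣ} {x : Ein3}
    (hx : x ∈ stdBigon j σ) :
    connectedComponentIn (lightcone (stdConfig.hingept j) \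
      (stdConfig.hinge j ∪ stdConfig.cohinge j)) x = stdBigon j σ := by
  have hs := hingeSign_sq j
  have hσ := sign_sq σ
  have hsub : stdBigon j σ ⊆ lightcone (stdConfig.hingept j) \
      (stdConfig.hinge j ∪ stdConfig.cohinge j) := by
    intro y hy
    obtain ⟨v, hv, hQ, rfl⟩ := Ein3.exists_rep y
    rw [mk_mem_stdBigon] at hy
    refine (mem_stdConfig_bigonDomain j).2 ⟨hy.1, fun h => ?_⟩
    simp [h] at hy
  apply Subset.antisymm
  · let f : R32 → ℝ := fun v => ((σ : ℤ) : ℝ) * (v 0 * (v 3 + v 4))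
    have hfc : Continuous f := by fun_prop
    have hf : ∀ (c : ℝ) v, f (c • v) = c ^ 2 * f v := fun c v => by simp [f]; ring
    have hxf : x ∈ Ein3.posSet f := by
      obtain ⟨v, hv, hQ, rfl⟩ := Ein3.exists_rep x
      exact (Ein3.mk_mem_posSet hf).2 (mk_mem_stdBigon.1 hx).2
    have hpos := Ein3.subset_posSet_of_isPreconnected hfc hf
      (isPreconnected_connectedComponentIn (F := lightcone (stdConfig.hingept j) \
      (stdConfig.hinge j ∪ stdConfig.cohinge j)) (x := x)) (fun v hv hQ hm h => by
        obtain ⟨h1, h0⟩ := (mem_stdConfig_bigonDomain j).1 (connectedComponentIn_subset _ _ hm)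
        have hq : v 0 ^ 2 = v 3 * v 4 := by
          simp only [einQ, h1] at hQ
          linear_combination hQ - v 2 ^ 2 * hs
        have h34 : v 3 + v 4 = 0 := by
          have : ((σ : ℤ) : ℝ) ≠ 0 := by intro h; rw [h] at hσ; simp at hσ
          simpa [f, this, h0] using h
        have : 0 < v 0 ^ 2 := by positivity
        rw [hq, eq_neg_of_add_eq_zero_left h34] at this
        nlinarith [sq_nonneg (v 4)])
      (mem_connectedComponentIn (hsub hx)) hxf
    intro y hy
    have hy1 := connectedComponentIn_subset _ _ hy
    have hy2 := hpos hy
    obtain ⟨v, hv, hQ, rfl⟩ := Ein3.exists_rep y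
    exact mk_mem_stdBigon.2 ⟨((mem_stdConfig_bigonDomain j).1 hy1).1,
      (Ein3.mk_mem_posSet hf).1 hy2⟩
  · exact (isPreconnected_stdBigon j σ).subset_connectedComponentIn hx hsub

/-- A point of the standard bigon. -/
theorem exists_mem_stdBigon (σ : ℤˣ) : ∃ v hv hQ, v 0 ≠ 0 ∧ v 4 ≠ 0 ∧
    ∀ j, Ein3.mk v hv hQ ∈ stdBigon j σ := by
  have hσ := sign_sq σ
  refine ⟨![((σ : ℤ) : ℝ), 0, 0, 1, 1], fun h => by simpa using congrFun h 4, ?_, ?_, ?_, fun j => ?_⟩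
  · simp [einQ]; linear_combination hσ
  · simp
  · simp
  · rw [mk_mem_stdBigon]
    simp
    rw [← mul_assoc, hσ]; norm_num

theorem isBigon_stdConfig_iff {j : Fin 2} {B : Set Ein3} :
    stdConfig.IsBigon j B ↔ ∃ σ, B = stdBigon j σ := by
  constructor
  · rintro ⟨x, hx, rfl⟩
    obtain ⟨v, hv, hQ, rfl⟩ := Ein3.exists_rep x
    obtain ⟨h1, h0⟩ := (mem_stdConfig_bigonDomain j).1 hx
    have hs := hingeSign_sq j
    have hq : v 0 ^ 2 = v 3 * v 4 := by
      simp only [einQ, h1] at hQ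
      linear_combination hQ - v 2 ^ 2 * hs
    have hne : v 0 * (v 3 + v 4) ≠ 0 := by
      refine mul_ne_zero h0 fun h34 => ?_
      have : 0 < v 0 ^ 2 := by positivity
      rw [hq, eq_neg_of_add_eq_zero_left h34] at this
      nlinarith [sq_nonneg (v 4)]
    rcases lt_or_gt_of_ne hne with h | h
    · exact ⟨-1, connectedComponentIn_bigonDomain (mk_mem_stdBigon.2 ⟨h1, by simpa using h⟩)⟩
    · exact ⟨1, connectedComponentIn_bigonDomain (mk_mem_stdBigon.2 ⟨h1, by simpa using h⟩)⟩
  · rintro ⟨σ, rfl⟩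
    obtain ⟨v, hv, hQ, h0, -, h⟩ := exists_mem_stdBigon σ
    exact ⟨_, (mem_stdConfig_bigonDomain j).2 ⟨(mk_mem_stdBigon.1 (h j)).1, h0⟩,
      (connectedComponentIn_bigonDomain (h j)).symm⟩

/-! ### The stem of the standard configuration -/

/-- The `3`-space spanned by the vertex, the covertex and `(0, Y, Z, 0, 0)` has signature `(1,2)`:
the last vector is negative, and the first two span a hyperbolic plane, negative on their sum and
positive on their difference. -/
theorem exists_isTimelikeCircle {v : R32} {hv hQ} (h0 : v 0 = 0) (h12 : v 1 ^ 2 < v 2 ^ 2) :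
    ∃ K, IsTimelikeCircle K ∧ stdVertex ∈ K ∧ stdCovertex ∈ K ∧ Ein3.mk v hv hQ ∈ K := by
  have h2 : v 2 ≠ 0 := by
    intro h; rw [h] at h12; nlinarith [sq_nonneg (v 1)]
  let w : R32 := ![0, v 1, v 2, 0, 0]
  let b : Fin 3 → R32 := ![vertexVec, covertexVec, w]
  let F : Submodule ℝ R32 := Submodule.span ℝ (range b)
  have hb : ∀ i, b i ∈ F := fun i => Submodule.subset_span (mem_range_self i)
  have hF : finrank ℝ F = 3 := by
    have hi : LinearIndependent ℝ b := by
      refine Fintype.linearIndependent_iff.2 fun g hg => ?_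
      rw [Fin.sum_univ_three] at hg
      have e4 := congrFun hg 4
      have e3 := congrFun hg 3
      have e2 := congrFun hg 2
      simp [b, vertexVec, covertexVec, w, h2] at e4 e3 e2
      intro i
      fin_cases i
      · exact e4
      · exact e3
      · exact e2
    have := finrank_span_eq_card hi
    rwa [Fintype.card_fin] at this
  have hi : LinearIndependent ℝ ![w, vertexVec + covertexVec] := by
    refine LinearIndependent.pair_iff.2 fun x y h => ?_
    have e2 := congrFun h 2
    have e3 := congrFun h 3
    simp [w, vertexVec, covertexVec, h2] at e2 e3
    exact ⟨e2, e3⟩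
  refine ⟨einSection F, ⟨F, Submodule.span ℝ {w, vertexVec + covertexVec}, hF, ?_, ?_, ?_,
    ⟨vertexVec - covertexVec, F.sub_mem (hb 0) (hb 1), by
      simp [einQ, vertexVec, covertexVec]⟩, rfl⟩, ?_, ?_, ?_⟩
  · rw [Submodule.span_le]
    rintro _ (rfl | rfl)
    · exact hb 2
    · exact F.add_mem (hb 0) (hb 1)
  · have := finrank_span_eq_card hi
    rwa [Matrix.range_cons_cons_empty, Fintype.card_fin] at this
  · intro u hu hne
    obtain ⟨x, y, rfl⟩ := Submodule.mem_span_pair.1 hu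
    have e : einQ (x • w + y • (vertexVec + covertexVec)) =
        -(x ^ 2 * (v 2 ^ 2 - v 1 ^ 2) + y ^ 2) := by
      simp [einQ, w, vertexVec, covertexVec]; ring
    rw [e, neg_lt_zero]
    by_cases hx : x = 0
    · have hy : y ≠ 0 := by rintro rfl; simp [hx] at hne
      rw [hx]; positivity
    · have : 0 < x ^ 2 * (v 2 ^ 2 - v 1 ^ 2) := mul_pos (by positivity) (by linarith)
      positivity
  · exact Ein3.mk_mem_einSection.2 (hb 0)
  · exact Ein3.mk_mem_einSection.2 (hb 1)
  · refine Ein3.mk_mem_einSection.2 ?_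
    have : v = v 4 • b 0 + v 3 • b 1 + b 2 := by
      apply R32_ext <;> simp [b, vertexVec, covertexVec, w, h0]
    rw [this]
    exact F.add_mem (F.add_mem (F.smul_mem _ (hb 0)) (F.smul_mem _ (hb 1))) (hb 2)

/-- If `Y² > Z²`, then `(0, Y, Z, 0, 0)` and the difference of vertex and covertex span a positive
definite plane in the `3`-space of the circle. By dimension it meets the negative definite plane
nontrivially, which is absurd. -/
theorem le_of_mem_isTimelikeCircle {K : Set Ein3} (hK : IsTimelikeCircle K) (hK0 : stdVertex ∈ K)
    (hK1 : stdCovertex ∈ K) {v : R32} {hv hQ} (hvK : Ein3.mk v hv hQ ∈ K) (h0 : v 0 = 0) :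
    v 1 ^ 2 ≤ v 2 ^ 2 := by
  obtain ⟨F, N, hF, hNF, hN, hneg, -, rfl⟩ := hK
  have m0 : vertexVec ∈ F := Ein3.mk_mem_einSection.1 hK0
  have m1 : covertexVec ∈ F := Ein3.mk_mem_einSection.1 hK1
  have m2 : v ∈ F := Ein3.mk_mem_einSection.1 hvK
  by_contra! hlt
  let w : R32 := ![0, v 1, v 2, 0, 0]
  have hw : w ∈ F := by
    have : v = v 4 • vertexVec + v 3 • covertexVec + w := by
      apply R32_ext <;> simp [vertexVec, covertexVec, w, h0]
    exact (F.add_mem_iff_right (F.add_mem (F.smul_mem _ m0) (F.smul_mem _ m1))).1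
      (this.subst (motive := (· ∈ F)) m2)
  have h1 : v 1 ≠ 0 := by
    intro h; rw [h] at hlt; nlinarith [sq_nonneg (v 2)]
  have hi : LinearIndependent ℝ ![w, vertexVec - covertexVec] := by
    refine LinearIndependent.pair_iff.2 fun x y h => ?_
    have e1 := congrFun h 1
    have e4 := congrFun h 4
    simp [w, vertexVec, covertexVec, h1] at e1 e4
    exact ⟨e1, e4⟩
  set P : Submodule ℝ R32 := Submodule.span ℝ {w, vertexVec - covertexVec} with hP
  have hPr : finrank ℝ P = 2 := by
    have := finrank_span_eq_card hi
    rwa [Matrix.range_cons_cons_empty, Fintype.card_fin] at this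
  have hPF : P ≤ F := by
    rw [hP, Submodule.span_le]
    rintro _ (rfl | rfl)
    · exact hw
    · exact F.sub_mem m0 m1
  have hne : N ⊓ P ≠ ⊥ := by
    intro hbot
    have h := Submodule.finrank_sup_add_finrank_inf_eq N P
    rw [hbot, finrank_bot, hN, hPr] at h
    have := Submodule.finrank_mono (sup_le hNF hPF)
    omega
  obtain ⟨u, hu, hu0⟩ := Submodule.exists_mem_ne_zero_of_ne_bot hne
  have hq := hneg u hu.1 hu0
  obtain ⟨x, y, rfl⟩ := Submodule.mem_span_pair.1 hu.2
  have e : einQ (x • w + y • (vertexVec - covertexVec)) =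
      x ^ 2 * (v 1 ^ 2 - v 2 ^ 2) + y ^ 2 := by
    simp [einQ, w, vertexVec, covertexVec]; ring
  rw [e] at hq
  have : 0 ≤ x ^ 2 * (v 1 ^ 2 - v 2 ^ 2) := mul_nonneg (by positivity) (by linarith)
  nlinarith [sq_nonneg y]

theorem mem_stdConfig_squareDomain {v : R32} {hv hQ} :
    Ein3.mk v hv hQ ∈ stdConfig.hypersphere \ stdConfig.edges ↔ v 0 = 0 ∧ v 1 ^ 2 ≠ v 2 ^ 2 := by
  rw [mem_sdiff, mem_stdConfig_hypersphere, mem_stdConfig_edges]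
  tauto

/-- Individual squares need not be determined. The sign of `Z² - Y²` is constant on a square,
positive if the square meets a timelike circle through vertex and covertex; and every point with `Y²
< Z²` lies on such a circle. -/
theorem mem_stdConfig_stem {v : R32} {hv hQ} :
    Ein3.mk v hv hQ ∈ ⋃₀ {S | stdConfig.IsStemSquare S} ↔ v 0 = 0 ∧ v 1 ^ 2 < v 2 ^ 2 := by
  constructor
  · rintro ⟨S, ⟨⟨x, hx, rfl⟩, K, hK, hK0, hK1, y, hyS, hyK⟩, hvS⟩
    let f : R32 → ℝ := fun v => v 2 ^ 2 - v 1 ^ 2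
    have hfc : Continuous f := by fun_prop
    have hf : ∀ (c : ℝ) v, f (c • v) = c ^ 2 * f v := fun c v => by simp [f]; ring
    have hdom : ∀ u hu hQu, Ein3.mk u hu hQu ∈
        connectedComponentIn (stdConfig.hypersphere \ stdConfig.edges) x →
        u 0 = 0 ∧ u 1 ^ 2 ≠ u 2 ^ 2 := fun u hu hQu h =>
      mem_stdConfig_squareDomain.1 (connectedComponentIn_subset _ _ h)
    have hyf : y ∈ Ein3.posSet f := by
      obtain ⟨u, hu, hQu, rfl⟩ := Ein3.exists_rep y
      obtain ⟨h0, h12⟩ := hdom _ _ _ hyS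
      rw [Ein3.mk_mem_posSet hf]
      exact sub_pos.2 (lt_of_le_of_ne (le_of_mem_isTimelikeCircle hK hK0 hK1 hyK h0) h12)
    have := Ein3.subset_posSet_of_isPreconnected hfc hf isPreconnected_connectedComponentIn
      (fun u hu hQu h => sub_ne_zero.2 (hdom u hu hQu h).2.symm) hyS hyf hvS
    rw [Ein3.mk_mem_posSet hf] at this
    exact ⟨(hdom _ _ _ hvS).1, sub_pos.1 this⟩
  · rintro ⟨h0, h12⟩
    have hx := (mem_stdConfig_squareDomain (hv := hv) (hQ := hQ)).2 ⟨h0, h12.ne⟩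
    have hx' := mem_connectedComponentIn hx
    obtain ⟨K, hK, hK0, hK1, hvK⟩ := exists_isTimelikeCircle (hv := hv) (hQ := hQ) h0 h12
    exact ⟨_, ⟨⟨_, hx, rfl⟩, K, hK, hK0, hK1, _, hx', hvK⟩, hx'⟩

/-! ### The crooked surfaces of the standard configuration -/

/-- The crooked surfaces of the standard stem configuration. -/
def stdSurface (σ : ℤˣ) : Set Ein3 := Ein3.homSet fun v =>
  (v 0 = 0 ∧ v 1 ^ 2 ≤ v 2 ^ 2) ∨ (v 1 = v 2 ∧ 0 ≤ ((σ : ℤ) : ℝ) * (v 0 * (v 3 + v 4))) ∨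
    (v 1 = -v 2 ∧ ((σ : ℤ) : ℝ) * (v 0 * (v 3 + v 4)) ≤ 0)

theorem mk_mem_stdSurface {σ : ℤˣ} {v : R32} {hv hQ} :
    Ein3.mk v hv hQ ∈ stdSurface σ ↔
      (v 0 = 0 ∧ v 1 ^ 2 ≤ v 2 ^ 2) ∨ (v 1 = v 2 ∧ 0 ≤ ((σ : ℤ) : ℝ) * (v 0 * (v 3 + v 4))) ∨
        (v 1 = -v 2 ∧ ((σ : ℤ) : ℝ) * (v 0 * (v 3 + v 4)) ≤ 0) := by
  refine Ein3.mk_mem_homSet (P := fun v => (v 0 = 0 ∧ v 1 ^ 2 ≤ v 2 ^ 2) ∨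
    (v 1 = v 2 ∧ 0 ≤ ((σ : ℤ) : ℝ) * (v 0 * (v 3 + v 4))) ∨
    (v 1 = -v 2 ∧ ((σ : ℤ) : ℝ) * (v 0 * (v 3 + v 4)) ≤ 0)) fun c v hc h => ?_
  simp only [Pi.smul_apply, smul_eq_mul]
  rcases h with ⟨h1, h2⟩ | ⟨h1, h2⟩ | ⟨h1, h2⟩
  · left
    refine ⟨by rw [h1, mul_zero], ?_⟩
    have := mul_le_mul_of_nonneg_left h2 (sq_nonneg c)
    linarith
  · right; left
    refine ⟨by rw [h1], ?_⟩
    have := mul_nonneg (sq_nonneg c) h2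
    linarith
  · right; right
    refine ⟨by rw [h1, mul_neg], ?_⟩
    have := mul_nonpos_of_nonneg_of_nonpos (sq_nonneg c) h2
    linarith

theorem stdSurface_eq (σ : ℤˣ) : stdSurface σ = ⋃₀ {S | stdConfig.IsStemSquare S} ∪
    stdConfig.edges ∪ stdBigon 0 σ ∪ stdBigon 1 (-σ) := by
  ext x
  obtain ⟨v, hv, hQ, rfl⟩ := Ein3.exists_rep x
  rw [mem_union, mem_union, mem_union, mem_stdConfig_stem, mem_stdConfig_edges, mk_mem_stdBigon,
    mk_mem_stdBigon, mk_mem_stdSurface]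
  have hσ : ((σ : ℤ) : ℝ) ≠ 0 := by exact_mod_cast σ.ne_zero
  -- The boundary cases of the weak wing inequalities: `X ≠ 0` would give `U = -V`, contradicting
  -- `UV = X² > 0`. Such points therefore lie on the edges.
  have hz : (v 1) ^ 2 = v 2 ^ 2 → ((σ : ℤ) : ℝ) * (v 0 * (v 3 + v 4)) = 0 → v 0 = 0 := by
    intro h12 h
    by_contra h0
    have h34 : v 3 + v 4 = 0 := by simpa [hσ, h0] using h
    have hp : 0 < v 0 ^ 2 := by positivity
    simp only [einQ, h12] at hQ
    rw [eq_neg_of_add_eq_zero_left h34] at hQ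
    nlinarith [sq_nonneg (v 4)]
  simp only [hingeSign, if_true, one_mul, one_ne_zero, if_false, Units.val_neg, Int.cast_neg,
    neg_mul, neg_pos]
  constructor
  · rintro (⟨h0, h12⟩ | ⟨h12, h⟩ | ⟨h12, h⟩)
    · rcases h12.lt_or_eq with h12 | h12
      · exact Or.inl (Or.inl (Or.inl ⟨h0, h12⟩))
      · exact Or.inl (Or.inl (Or.inr ⟨h0, h12⟩))
    · rcases h.lt_or_eq with h | h
      · exact Or.inl (Or.inr ⟨h12, h⟩)
      · exact Or.inl (Or.inl (Or.inr ⟨hz (by rw [h12]) h.symm, by rw [h12]⟩))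
    · rcases h.lt_or_eq with h | h
      · exact Or.inr ⟨h12, h⟩
      · exact Or.inl (Or.inl (Or.inr ⟨hz (by rw [h12, neg_sq]) h, by rw [h12, neg_sq]⟩))
  · rintro (((⟨h0, h12⟩ | ⟨h0, h12⟩) | ⟨h12, h⟩) | ⟨h12, h⟩)
    · exact Or.inl ⟨h0, h12.le⟩
    · exact Or.inl ⟨h0, h12.le⟩
    · exact Or.inr (Or.inl ⟨h12, h.le⟩)
    · exact Or.inr (Or.inr ⟨h12, h.le⟩)

theorem ne_zero_of_mem_stdPatch {v : R32} {hv hQ}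
    (h : Ein3.mk v hv hQ ∈ minkowskiPatch stdConfig.covertex \ stdConfig.hypersphere) :
    v 0 ≠ 0 ∧ v 4 ≠ 0 := by
  obtain ⟨h1, h2⟩ := h
  rw [mem_stdConfig_hypersphere] at h2
  refine ⟨h2, fun h4 => h1 ?_⟩
  refine ⟨_, isPhoton_span_pair (v := covertexVec) (w := v) (by simp [einQ, covertexVec]) hQ
    (by simp [einB, covertexVec, h4]) ?_, ?_, ?_⟩
  · refine LinearIndependent.pair_iff.2 fun a b h => ?_
    have e0 := congrFun h 0
    have e3 := congrFun h 3
    simp [covertexVec, h2] at e0 e3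
    rw [e0] at e3
    exact ⟨by simpa using e3, e0⟩
  · exact (Ein3.mk_mem_einSection (v := covertexVec) (hQ := by simp [einQ, covertexVec])).2
      (Submodule.subset_span (by simp))
  · exact Ein3.mk_mem_einSection.2 (Submodule.subset_span (by simp))

theorem mem_stdPatch {v : R32} {hv hQ} (h0 : v 0 ≠ 0) (h4 : v 4 ≠ 0) :
    Ein3.mk v hv hQ ∈ minkowskiPatch stdConfig.covertex \ stdConfig.hypersphere := by
  refine ⟨?_, fun h => h0 (mem_stdConfig_hypersphere.1 h)⟩
  rintro ⟨φ, hφ, hc, hx⟩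
  have := einB_eq_zero_of_isPhoton hφ (v := covertexVec) (hQ := by simp [einQ, covertexVec]) hc hx
  simp [einB, covertexVec, h4] at this

/-- The patch of the covertex is `V ≠ 0`, where the sign of `XV` tells the sides of the hypersphere
apart. On a bigon it agrees with the sign of `X(U+V)`, because `U` and `V` have the same sign. -/
theorem sign_mul_pos_of_mem_stdBigon {j : Fin 2} {σ : ℤˣ} {v : R32} {hv hQ}
    (h : Ein3.mk v hv hQ ∈ stdBigon j σ) : 0 < ((σ : ℤ) : ℝ) * (v 0 * v 4) := by
  have hs := hingeSign_sq j
  obtain ⟨h1, h2⟩ := mk_mem_stdBigon.1 h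
  have hq : v 0 ^ 2 = v 3 * v 4 := by
    simp only [einQ, h1] at hQ
    linear_combination hQ - v 2 ^ 2 * hs
  have h0 : v 0 ≠ 0 := by rintro h; simp [h] at h2
  have hp : 0 < v 0 ^ 2 := by positivity
  have : 0 < (((σ : ℤ) : ℝ) * (v 0 * (v 3 + v 4))) * (((σ : ℤ) : ℝ) * (v 0 * v 4)) := by
    have e : (((σ : ℤ) : ℝ) * (v 0 * (v 3 + v 4))) * (((σ : ℤ) : ℝ) * (v 0 * v 4)) =
        v 0 ^ 2 * (v 0 ^ 2 + v 4 ^ 2) := by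
      linear_combination (v 0 ^ 2 * (v 3 + v 4) * v 4) * sign_sq σ - v 0 ^ 2 * hq
    rw [e]; positivity
  exact (mul_pos_iff_of_pos_left h2).1 this

theorem isCrookedSurface_stdSurface (σ : ℤˣ) : stdConfig.IsCrookedSurface (stdSurface σ) := by
  refine ⟨stdBigon 0 σ, stdBigon 1 (-σ), isBigon_stdConfig_iff.2 ⟨_, rfl⟩,
    isBigon_stdConfig_iff.2 ⟨_, rfl⟩, ?_, stdSurface_eq σ⟩
  intro x hx y hy hxy
  let f : R32 → ℝ := fun v => ((σ : ℤ) : ℝ) * (v 0 * v 4)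
  have hfc : Continuous f := by fun_prop
  have hf : ∀ (c : ℝ) v, f (c • v) = c ^ 2 * f v := fun c v => by simp [f]; ring
  have hσ : ((σ : ℤ) : ℝ) ≠ 0 := by exact_mod_cast σ.ne_zero
  have hxm : x ∈ minkowskiPatch stdConfig.covertex \ stdConfig.hypersphere := by
    by_contra h
    rw [connectedComponentIn_eq_empty h] at hxy
    exact hxy
  have hxf : x ∈ Ein3.posSet f := by
    obtain ⟨v, hv, hQ, rfl⟩ := Ein3.exists_rep x
    exact (Ein3.mk_mem_posSet hf).2 (sign_mul_pos_of_mem_stdBigon hx)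
  have := Ein3.subset_posSet_of_isPreconnected hfc hf isPreconnected_connectedComponentIn
    (fun v hv hQ h => by
      obtain ⟨h0, h4⟩ := ne_zero_of_mem_stdPatch (connectedComponentIn_subset _ _ h)
      exact mul_ne_zero hσ (mul_ne_zero h0 h4)) (mem_connectedComponentIn hxm) hxf hxy
  obtain ⟨v, hv, hQ, rfl⟩ := Ein3.exists_rep y
  have h1 := (Ein3.mk_mem_posSet hf).1 this
  have h2 := sign_mul_pos_of_mem_stdBigon hy
  simp only [Units.val_neg, Int.cast_neg, neg_mul, neg_pos] at h2
  exact absurd h1 (not_lt.2 h2.le)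

/-- Each wing is given by a sign, and the wings lie on opposite sides only if the signs differ, so
one sign determines the surface. -/
theorem exists_eq_stdSurface {S : Set Ein3} (h : stdConfig.IsCrookedSurface S) :
    ∃ σ, S = stdSurface σ := by
  obtain ⟨W₁, W₂, h1, h2, hop, rfl⟩ := h
  obtain ⟨σ, rfl⟩ := isBigon_stdConfig_iff.1 h1
  obtain ⟨τ, rfl⟩ := isBigon_stdConfig_iff.1 h2
  refine ⟨σ, ?_⟩
  have hτ : τ = -σ := by
    by_contra hne
    have he : τ = σ := by
      rcases Int.units_eq_one_or σ with rfl | rfl <;>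
        rcases Int.units_eq_one_or τ with rfl | rfl <;> simp_all
    subst he
    -- Bigons of equal sign share a point of the patch off the hypersphere, and that point is in its
    -- own component.
    obtain ⟨v, hv, hQ, h0, h4, hm⟩ := exists_mem_stdBigon τ
    exact hop _ (hm 0) _ (hm 1) (mem_connectedComponentIn (mem_stdPatch h0 h4))
  rw [hτ, stdSurface_eq]

/-! ### The map `Ψ` -/

/-- The `2 × 2` matrix given by a vector of `ℝ^{3,2}`. -/
def toMat (v : R32) : Matrix (Fin 2) (Fin 2) ℝ :=
  !![(v 0 + (v 3 + v 4) / 2) / 2, (v 1 + v 2) / 2; (v 1 - v 2) / 2, ((v 3 + v 4) / 2 - v 0) / 2]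

/-- The linear function on `ℝ^{3,2}` vanishing on the boundary of `SL(2,ℝ)`. -/
def tau (v : R32) : ℝ := (v 4 - v 3) / 4

/-- The vector of `ℝ^{3,2}` given by a `2 × 2` matrix and a value of `tau`. -/
def ofMat (M : Matrix (Fin 2) (Fin 2) ℝ) (t : ℝ) : R32 :=
  ![M 0 0 - M 1 1, M 0 1 + M 1 0, M 0 1 - M 1 0, M 0 0 + M 1 1 - 2 * t, M 0 0 + M 1 1 + 2 * t]

theorem ofMat_toMat (v : R32) : ofMat (toMat v) (tau v) = v := by
  apply R32_ext <;> simp [ofMat, toMat, tau] <;> ring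

theorem toMat_ofMat (M : Matrix (Fin 2) (Fin 2) ℝ) (t : ℝ) : toMat (ofMat M t) = M := by
  ext i j
  fin_cases i <;> fin_cases j <;> simp [ofMat, toMat]

theorem tau_ofMat (M : Matrix (Fin 2) (Fin 2) ℝ) (t : ℝ) : tau (ofMat M t) = t := by
  simp [ofMat, tau]; ring

theorem einQ_eq (v : R32) : einQ v = 4 * (tau v ^ 2 - (toMat v).det) := by
  simp [einQ, tau, toMat, Matrix.det_fin_two]; ring

theorem psiVec_eq (g : SL2) : psiVec g = ofMat g.1 1 := by
  apply R32_ext <;> simp [ofMat, psiVec]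

theorem swapUV_eq (v : R32) : swapUV v = ofMat (toMat v) (-tau v) := by
  apply R32_ext <;>
    simp [ofMat, toMat, tau, swapUV, LinearEquiv.funCongrLeft, LinearMap.funLeft,
      Equiv.swap_apply_def] <;> ring

theorem toMat_add (v w : R32) : toMat (v + w) = toMat v + toMat w := by
  ext i j
  fin_cases i <;> fin_cases j <;> simp [toMat] <;> ring

theorem toMat_smul (c : ℝ) (v : R32) : toMat (c • v) = c • toMat v := by
  ext i j
  fin_cases i <;> fin_cases j <;> simp [toMat] <;> ring

theorem tau_add (v w : R32) : tau (v + w) = tau v + tau w := by simp [tau]; ring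

theorem tau_smul (c : ℝ) (v : R32) : tau (c • v) = c * tau v := by simp [tau]; ring

theorem ofMat_add (M N : Matrix (Fin 2) (Fin 2) ℝ) (t u : ℝ) :
    ofMat (M + N) (t + u) = ofMat M t + ofMat N u := by
  apply R32_ext <;> simp [ofMat] <;> ring

theorem ofMat_smul (c : ℝ) (M : Matrix (Fin 2) (Fin 2) ℝ) (t : ℝ) :
    ofMat (c • M) (c * t) = c • ofMat M t := by
  apply R32_ext <;> simp [ofMat] <;> ring

theorem continuous_tau : Continuous tau := by unfold tau; fun_prop

theorem continuous_toMat : Continuous toMat := by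
  refine continuous_matrix fun i j => ?_
  fin_cases i <;> fin_cases j <;> simp [toMat] <;> fun_prop

theorem Ein3.mk_congr {v w : R32} (h : v = w) {hv hQ hw hQ'} :
    Ein3.mk v hv hQ = Ein3.mk w hw hQ' := by subst h; rfl

theorem exists_psi_eq {v : R32} {hv hQ} (ht : tau v ≠ 0) : ∃ g : SL2, Ein3.mk v hv hQ = psi g := by
  have hd : (toMat ((tau v)⁻¹ • v)).det = 1 := by
    rw [einQ_eq] at hQ
    have h : (toMat v).det = tau v ^ 2 := by linarith
    rw [toMat_smul, Matrix.det_smul, Fintype.card_fin, h]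
    field_simp
  let g : SL2 := ⟨_, hd⟩
  have hg : psiVec g = ofMat (toMat ((tau v)⁻¹ • v)) 1 := psiVec_eq g
  refine ⟨g, Ein3.mk_eq_mk_iff.2 ⟨tau v, ?_⟩⟩
  rw [hg, ← ofMat_smul, toMat_smul, smul_smul, mul_inv_cancel₀ ht, one_smul, mul_one, ofMat_toMat]

/-! ### The map `Ψ` as a topological embedding -/

theorem continuous_psi : Continuous psi := by
  refine Ein3.continuous_mk ?_ psiVec_ne_zero einQ_psiVec
  have h : ∀ i j, Continuous fun g : SL2 => g.1 i j := fun i j =>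
    continuous_subtype_val.matrix_elem i j
  refine continuous_pi fun i => ?_
  fin_cases i
  · exact (h 0 0).sub (h 1 1)
  · exact (h 0 1).add (h 1 0)
  · exact (h 0 1).sub (h 1 0)
  · exact ((h 0 0).add (h 1 1)).sub continuous_const
  · exact ((h 0 0).add (h 1 1)).add continuous_const

/-- A left inverse of `Ψ`, defined on the projective space. -/
def psiInv : ℙ ℝ R32 → Matrix (Fin 2) (Fin 2) ℝ :=
  Projectivization.lift (fun v => (tau v.1)⁻¹ • toMat v.1) (by
    rintro ⟨a, ha⟩ ⟨b, hb⟩ t h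
    change a = t • b at h
    have ht : t ≠ 0 := by rintro rfl; rw [zero_smul] at h; exact ha h
    simp only [h, tau_smul, toMat_smul, smul_smul, mul_inv]
    congr 1
    field_simp)

theorem psiInv_psi (g : SL2) : psiInv (psi g).1 = g.1 := by
  change (tau (psiVec g))⁻¹ • toMat (psiVec g) = g.1
  rw [psiVec_eq, tau_ofMat, toMat_ofMat, inv_one, one_smul]

/-- Dividing by `tau` is continuous on the open set `tau ≠ 0`, which contains the image of `Ψ`;
continuity descends along the quotient map. -/
theorem continuousAt_psiInv (g : SL2) : ContinuousAt psiInv (psi g).1 := by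
  have hq : Topology.IsQuotientMap (Quotient.mk (projectivizationSetoid ℝ R32)) :=
    isQuotientMap_quot_mk
  let U : Set (ℙ ℝ R32) := {x | ∃ v ∈ x.submodule, tau v ≠ 0}
  have hpre : Quotient.mk (projectivizationSetoid ℝ R32) ⁻¹' U = {v | tau v.1 ≠ 0} := by
    ext ⟨v, hv⟩
    change (∃ w ∈ (Projectivization.mk ℝ v hv).submodule, tau w ≠ 0) ↔ tau v ≠ 0
    simp only [Projectivization.submodule_mk, Submodule.mem_span_singleton]
    constructor
    · rintro ⟨_, ⟨c, rfl⟩, h⟩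
      rw [tau_smul] at h
      exact right_ne_zero_of_mul h
    · intro h
      exact ⟨v, ⟨1, one_smul _ _⟩, h⟩
  have hU : IsOpen U := by
    refine hq.isOpen_preimage.1 ?_
    rw [hpre]
    exact isOpen_ne_fun (continuous_tau.comp continuous_subtype_val) continuous_const
  have hc : ContinuousOn psiInv U := by
    refine (hq.continuousOn_isOpen_iff hU).2 ?_
    rw [hpre]
    exact ((continuous_tau.comp continuous_subtype_val).continuousOn.inv₀ fun _ h => h).smul
      (continuous_toMat.comp continuous_subtype_val).continuousOn
  refine hc.continuousAt (hU.mem_nhds ⟨psiVec g, ?_, ?_⟩)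
  · rw [psi, Ein3.submodule_mk]; exact Submodule.mem_span_singleton_self _
  · rw [psiVec_eq, tau_ofMat]; exact one_ne_zero

theorem isEmbedding_psi : Topology.IsEmbedding psi := by
  refine ⟨Topology.isInducing_iff_nhds.2 fun g => le_antisymm ?_ ?_, fun g g' h => ?_⟩
  · exact Filter.tendsto_iff_comap.1 continuous_psi.continuousAt
  · have h1 : Filter.Tendsto (fun x : Ein3 => psiInv x.1) (nhds (psi g)) (nhds g.1) := by
      have := (continuousAt_psiInv g).comp (f := fun x : Ein3 => x.1)
        continuous_subtype_val.continuousAt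
      rw [ContinuousAt] at this
      simpa only [Function.comp_def, psiInv_psi] using this
    have h2 : nhds g = Filter.comap Subtype.val (nhds g.1) := nhds_subtype_eq_comap
    have h3 : (Subtype.val : SL2 → Matrix (Fin 2) (Fin 2) ℝ) =
        (fun x : Ein3 => psiInv x.1) ∘ psi := funext fun g => (psiInv_psi g).symm
    have h4 : nhds g = Filter.comap psi
        (Filter.comap (fun x : Ein3 => psiInv x.1) (nhds g.1)) := by
      rw [Filter.comap_comap, ← h3]; exact h2
    rw [h4]
    exact Filter.comap_mono (Filter.tendsto_iff_comap.1 h1)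
  · exact Subtype.ext (by rw [← psiInv_psi g, h, psiInv_psi])

/-! ### The closure of the standard sheet -/

/-- For `Ψ(M)` the quantity `X(U+V)` is `2(a² - d²)`. The boundary of a wing causes no discrepancy:
for triangular `M`, `ad = 1` excludes `a = -d`, so `a² = d²` means `a = d`, which is in the stem. -/
theorem psi_mem_stdSurface_iff (ε : ℤˣ) (M : SL2) :
    psi M ∈ stdSurface ε ↔ M ∈ crookedSheet ε := by
  have hd := SL2_det M
  have hε : ((ε : ℤ) : ℝ) ≠ 0 := by exact_mod_cast ε.ne_zero
  rw [psi, mk_mem_stdSurface, psiVec_eq]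
  simp only [ofMat, Matrix.cons_val_zero, Matrix.cons_val_one, Matrix.cons_val, crookedSheet,
    mem_ofPred_eq]
  have e : (M.1 0 0 - M.1 1 1) * (M.1 0 0 + M.1 1 1 - 2 * 1 + (M.1 0 0 + M.1 1 1 + 2 * 1)) =
      2 * (M.1 0 0 ^ 2 - M.1 1 1 ^ 2) := by ring
  have e2 : ((ε : ℤ) : ℝ) * (2 * (M.1 0 0 ^ 2 - M.1 1 1 ^ 2)) =
      2 * (((ε : ℤ) : ℝ) * (M.1 0 0 ^ 2 - M.1 1 1 ^ 2)) := by ring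
  rw [e, e2]
  have hz : M.1 0 1 * M.1 1 0 = 0 → ((ε : ℤ) : ℝ) * (M.1 0 0 ^ 2 - M.1 1 1 ^ 2) = 0 →
      M.1 0 0 = M.1 1 1 := by
    intro h1 h2
    have h3 : M.1 0 0 ^ 2 = M.1 1 1 ^ 2 := by
      have := (mul_eq_zero.1 h2).resolve_left hε
      linarith
    rcases sq_eq_sq_iff_eq_or_eq_neg.1 h3 with h | h
    · exact h
    · rw [h1, h] at hd
      nlinarith [sq_nonneg (M.1 1 1)]
  constructor
  · rintro (⟨h0, h1⟩ | ⟨h0, h1⟩ | ⟨h0, h1⟩)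
    · exact Or.inl ⟨by linarith, by nlinarith⟩
    · have h10 : M.1 1 0 = 0 := by linarith
      have h1' : 0 ≤ ((ε : ℤ) : ℝ) * (M.1 0 0 ^ 2 - M.1 1 1 ^ 2) := by linarith
      rcases h1'.lt_or_eq with h | h
      · exact Or.inr (Or.inl ⟨h10, h⟩)
      · exact Or.inl ⟨hz (by rw [h10, mul_zero]) h.symm, by rw [h10, mul_zero]⟩
    · have h01 : M.1 0 1 = 0 := by linarith
      have h1' : ((ε : ℤ) : ℝ) * (M.1 0 0 ^ 2 - M.1 1 1 ^ 2) ≤ 0 := by linarith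
      rcases h1'.lt_or_eq with h | h
      · exact Or.inr (Or.inr ⟨h01, h⟩)
      · exact Or.inl ⟨hz (by rw [h01, zero_mul]) h, by rw [h01, zero_mul]⟩
  · rintro (⟨h0, h1⟩ | ⟨h0, h1⟩ | ⟨h0, h1⟩)
    · exact Or.inl ⟨by linarith, by nlinarith⟩
    · exact Or.inr (Or.inl ⟨by rw [h0]; ring, by linarith⟩)
    · exact Or.inr (Or.inr ⟨by rw [h0]; ring, by linarith⟩)

theorem isClosed_stdSurface (σ : ℤˣ) : IsClosed (stdSurface σ) := by
  have hcl : ∀ f : R32 → ℝ, Continuous f → (∀ (c : ℝ) v, f (c • v) = c ^ 2 * f v) →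
      IsClosed (Ein3.posSet f)ᶜ := fun f hf h => (Ein3.isOpen_posSet hf h).isClosed_compl
  let f0 : R32 → ℝ := fun v => v 0 ^ 2
  let f1 : R32 → ℝ := fun v => v 1 ^ 2 - v 2 ^ 2
  let f2 : R32 → ℝ := fun v => (v 1 - v 2) ^ 2
  let f3 : R32 → ℝ := fun v => -(((σ : ℤ) : ℝ) * (v 0 * (v 3 + v 4)))
  let f4 : R32 → ℝ := fun v => (v 1 + v 2) ^ 2
  let f5 : R32 → ℝ := fun v => ((σ : ℤ) : ℝ) * (v 0 * (v 3 + v 4))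
  have c0 : Continuous f0 := by fun_prop
  have c1 : Continuous f1 := by fun_prop
  have c2 : Continuous f2 := by fun_prop
  have c3 : Continuous f3 := by fun_prop
  have c4 : Continuous f4 := by fun_prop
  have c5 : Continuous f5 := by fun_prop
  have s0 : ∀ (c : ℝ) v, f0 (c • v) = c ^ 2 * f0 v := fun c v => by simp [f0]; ring
  have s1 : ∀ (c : ℝ) v, f1 (c • v) = c ^ 2 * f1 v := fun c v => by simp [f1]; ring
  have s2 : ∀ (c : ℝ) v, f2 (c • v) = c ^ 2 * f2 v := fun c v => by simp [f2]; ring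
  have s3 : ∀ (c : ℝ) v, f3 (c • v) = c ^ 2 * f3 v := fun c v => by simp [f3]; ring
  have s4 : ∀ (c : ℝ) v, f4 (c • v) = c ^ 2 * f4 v := fun c v => by simp [f4]; ring
  have s5 : ∀ (c : ℝ) v, f5 (c • v) = c ^ 2 * f5 v := fun c v => by simp [f5]; ring
  -- Equations are encoded as non-positivity of squares, so that every condition becomes the
  -- complement of an open positivity set.
  have hsq : ∀ x : ℝ, ¬ 0 < x ^ 2 ↔ x = 0 := fun x => by
    rw [not_lt]; exact sq_nonpos_iff x
  have : stdSurface σ = ((Ein3.posSet f0)ᶜ ∩ (Ein3.posSet f1)ᶜ) ∪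
      (((Ein3.posSet f2)ᶜ ∩ (Ein3.posSet f3)ᶜ) ∪ ((Ein3.posSet f4)ᶜ ∩ (Ein3.posSet f5)ᶜ)) := by
    ext x
    obtain ⟨v, hv, hQ, rfl⟩ := Ein3.exists_rep x
    simp only [mk_mem_stdSurface, mem_union, mem_inter_iff, mem_compl_iff, Ein3.mk_mem_posSet s0,
      Ein3.mk_mem_posSet s1, Ein3.mk_mem_posSet s2, Ein3.mk_mem_posSet s3, Ein3.mk_mem_posSet s4,
      Ein3.mk_mem_posSet s5, f0, f1, f2, f3, f4, f5, hsq, not_lt, sub_nonpos, neg_nonpos,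
      sub_eq_zero, add_eq_zero_iff_eq_neg]
  rw [this]
  exact ((hcl _ c0 s0).inter (hcl _ c1 s1)).union (((hcl _ c2 s2).inter (hcl _ c3 s3)).union
    ((hcl _ c4 s4).inter (hcl _ c5 s5)))

theorem mk_mem_closure_of_path {A : Set Ein3} (f : ℝ → R32) (hf : Continuous f)
    (h0 : ∀ t, 0 ≤ t → f t ≠ 0) (hQ : ∀ t, einQ (f t) = 0)
    (hA : ∀ t (ht : 0 < t), Ein3.mk (f t) (h0 t ht.le) (hQ t) ∈ A) :
    Ein3.mk (f 0) (h0 0 le_rfl) (hQ 0) ∈ closure A := by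
  have hc : Continuous fun t : Ici (0 : ℝ) => Ein3.mk (f t) (h0 t t.2) (hQ t) :=
    Ein3.continuous_mk (hf.comp continuous_subtype_val) _ _
  have hmem : (⟨0, mem_Ici.2 le_rfl⟩ : Ici (0 : ℝ)) ∈ closure {t | 0 < t.1} := by
    rw [Metric.mem_closure_iff]
    intro δ hδ
    refine ⟨⟨δ / 2, mem_Ici.2 (by positivity)⟩, by simpa using hδ, ?_⟩
    rw [Subtype.dist_eq, Real.dist_eq]
    rw [abs_sub_comm, sub_zero, abs_of_pos (by positivity)]
    linarith
  have := image_closure_subset_closure_image hc (mem_image_of_mem _ hmem)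
  refine closure_mono ?_ this
  rintro _ ⟨t, ht, rfl⟩
  exact hA t.1 ht

theorem mem_psi_image_of_mem_stdSurface {ε : ℤˣ} {v : R32} {hv hQ} (ht : tau v ≠ 0)
    (h : Ein3.mk v hv hQ ∈ stdSurface ε) : Ein3.mk v hv hQ ∈ psi '' crookedSheet ε := by
  obtain ⟨M, hM⟩ := exists_psi_eq (hv := hv) (hQ := hQ) ht
  rw [hM] at h ⊢
  exact mem_image_of_mem _ ((psi_mem_stdSurface_iff ε M).1 h)

/-- Points with `tau ≠ 0` come from the sheet itself. Those with `tau = 0` are the hingepoints and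
certain points of the wings, and each is the limit of a path within the surface along which `tau ≠
0`. -/
theorem closure_psi_image_crookedSheet (ε : ℤˣ) :
    closure (psi '' crookedSheet ε) = stdSurface ε := by
  apply Subset.antisymm
  · refine closure_minimal ?_ (isClosed_stdSurface ε)
    rintro _ ⟨M, hM, rfl⟩
    exact (psi_mem_stdSurface_iff ε M).2 hM
  · intro x hx
    obtain ⟨v, hv, hQ, rfl⟩ := Ein3.exists_rep x
    by_cases ht : tau v = 0
    swap
    · exact subset_closure (mem_psi_image_of_mem_stdSurface ht hx)
    have h34 : v 4 = v 3 := by simp only [tau] at ht; linarith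
    have hx' := mk_mem_stdSurface.1 hx
    have hQ' := hQ
    simp only [einQ, h34] at hQ'
    by_cases h0 : v 0 = 0
    · have h12 : v 1 ^ 2 ≤ v 2 ^ 2 := by
        rcases hx' with ⟨-, h⟩ | ⟨h, -⟩ | ⟨h, -⟩
        · exact h
        · rw [h]
        · rw [h, neg_sq]
      have h3 : v 3 = 0 := by
        rw [h0] at hQ'
        nlinarith [sq_nonneg (v 3)]
      rw [h3] at h34
      have h12' : v 1 ^ 2 = v 2 ^ 2 := by rw [h0, h3] at hQ'; linarith
      have h2 : v 2 ≠ 0 := by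
        intro h2
        rw [h2] at h12'
        refine hv (R32_ext h0 ?_ h2 h3 h34)
        simpa using h12'
      -- The point is a hingepoint; it is approached along its hinge, in the direction of the
      -- vertex.
      let f : ℝ → R32 := fun t => ![0, v 1, v 2, 0, t]
      have hf : Continuous f := by
        refine continuous_pi fun i => ?_
        fin_cases i <;> simp [f] <;> fun_prop
      have hf0 : ∀ t, 0 ≤ t → f t ≠ 0 := fun t _ h => h2 (by simpa [f] using congrFun h 2)
      have hfQ : ∀ t, einQ (f t) = 0 := fun t => by simp [einQ, f, h12']
      have e : Ein3.mk v hv hQ = Ein3.mk (f 0) (hf0 0 le_rfl) (hfQ 0) :=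
        Ein3.mk_congr (by apply R32_ext <;> simp [f, h0, h3, h34])
      rw [e]
      refine mk_mem_closure_of_path f hf hf0 hfQ fun t ht' => ?_
      refine mem_psi_image_of_mem_stdSurface ?_ (mk_mem_stdSurface.2 (Or.inl ?_))
      · simp [tau, f, ht'.ne']
      · simp [f, h12']
    · have h12 : v 1 ^ 2 = v 2 ^ 2 := by
        rcases hx' with ⟨h, -⟩ | ⟨h, -⟩ | ⟨h, -⟩
        · exact absurd h h0
        · rw [h]
        · rw [h, neg_sq]
      have hq : v 0 ^ 2 = v 3 ^ 2 := by linarith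
      have h3 : v 3 ≠ 0 := by
        intro h; rw [h] at hq; exact h0 (by simpa using hq)
      -- A wing point with `U = V`: scaling `X` by `1 + t` and `U` by `(1 + t)²` keeps `X² = UV` and
      -- the sign of `X(U+V)`, while making `U ≠ V`.
      let f : ℝ → R32 := fun t => ![v 0 * (1 + t), v 1, v 2, v 3 * (1 + t) ^ 2, v 3]
      have hf : Continuous f := by
        refine continuous_pi fun i => ?_
        fin_cases i <;> simp [f] <;> fun_prop
      have hf0 : ∀ t, 0 ≤ t → f t ≠ 0 := fun t _ h => h3 (by simpa [f] using congrFun h 4)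
      have hfQ : ∀ t, einQ (f t) = 0 := fun t => by
        simp [einQ, f]
        linear_combination (1 + t) ^ 2 * hq + h12
      have e : Ein3.mk v hv hQ = Ein3.mk (f 0) (hf0 0 le_rfl) (hfQ 0) :=
        Ein3.mk_congr (by apply R32_ext <;> simp [f, h34])
      rw [e]
      refine mk_mem_closure_of_path f hf hf0 hfQ fun t ht' => ?_
      have ef : ((ε : ℤ) : ℝ) * (f t 0 * (f t 3 + f t 4)) =
          ((1 + t) * ((1 + t) ^ 2 + 1) / 2) * (((ε : ℤ) : ℝ) * (v 0 * (v 3 + v 4))) := by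
        simp [f, h34]; ring
      have hp : 0 ≤ (1 + t) * ((1 + t) ^ 2 + 1) / 2 := by positivity
      refine mem_psi_image_of_mem_stdSurface ?_ (mk_mem_stdSurface.2 (Or.inr ?_))
      · have : tau (f t) = -(v 3 * (t * (t + 2)) / 4) := by simp [tau, f]; ring
        rw [this]
        have : t * (t + 2) ≠ 0 := by positivity
        exact neg_ne_zero.2 (div_ne_zero (mul_ne_zero h3 this) (by norm_num))
      · rw [ef]
        rcases hx' with ⟨h, -⟩ | ⟨h, h'⟩ | ⟨h, h'⟩
        · exact absurd h h0
        · exact Or.inl ⟨by simpa [f] using h, mul_nonneg hp h'⟩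
        · exact Or.inr ⟨by simpa [f] using h, mul_nonpos_of_nonneg_of_nonpos hp h'⟩

/-! ### The action of `SL(2,ℝ) × SL(2,ℝ)` -/

theorem SL2_inv_mul_val (g : SL2) : (g⁻¹).1 * g.1 = 1 :=
  congrArg Subtype.val (inv_mul_cancel g)

theorem SL2_mul_inv_val (g : SL2) : g.1 * (g⁻¹).1 = 1 :=
  congrArg Subtype.val (mul_inv_cancel g)

/-- The isometry of `ℝ^{3,2}` induced by `M ↦ k M h⁻¹`. -/
def biAct (k h : SL2) : EinIsometry :=
  ⟨{ toFun := fun v => ofMat (k.1 * toMat v * (h⁻¹).1) (tau v)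
     map_add' := fun v w => by rw [toMat_add, tau_add, mul_add, add_mul, ofMat_add]
     map_smul' := fun c v => by
      rw [toMat_smul, tau_smul, mul_smul_comm, smul_mul_assoc, ofMat_smul]; rfl
     invFun := fun v => ofMat ((k⁻¹).1 * toMat v * h.1) (tau v)
     left_inv := fun v => by
      have e : (k⁻¹).1 * (k.1 * toMat v * (h⁻¹).1) * h.1 = toMat v := by
        calc _ = ((k⁻¹).1 * k.1) * toMat v * ((h⁻¹).1 * h.1) := by simp only [mul_assoc]
          _ = _ := by rw [SL2_inv_mul_val, SL2_inv_mul_val, one_mul, mul_one]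
      simp only [toMat_ofMat, tau_ofMat, e, ofMat_toMat]
     right_inv := fun v => by
      have e : k.1 * ((k⁻¹).1 * toMat v * h.1) * (h⁻¹).1 = toMat v := by
        calc _ = (k.1 * (k⁻¹).1) * toMat v * (h.1 * (h⁻¹).1) := by simp only [mul_assoc]
          _ = _ := by rw [SL2_mul_inv_val, SL2_mul_inv_val, one_mul, mul_one]
      simp only [toMat_ofMat, tau_ofMat, e, ofMat_toMat] }, fun v => by
    have hk : k.1.det = 1 := k.2
    have hh : (h⁻¹).1.det = 1 := (h⁻¹).2
    change einQ (ofMat (k.1 * toMat v * (h⁻¹).1) (tau v)) = einQ v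
    rw [einQ_eq, einQ_eq v, toMat_ofMat, tau_ofMat, Matrix.det_mul, Matrix.det_mul, hk, hh,
      one_mul, mul_one]⟩

theorem biAct_apply (k h : SL2) (v : R32) :
    (biAct k h).1 v = ofMat (k.1 * toMat v * (h⁻¹).1) (tau v) := rfl

theorem biAct_psi (k h M : SL2) : (biAct k h).act (psi M) = psi (k * M * h⁻¹) := by
  rw [psi, EinIsometry.act_mk]
  refine Ein3.mk_congr ?_
  rw [biAct_apply, psiVec_eq, psiVec_eq, toMat_ofMat, tau_ofMat,
    Matrix.SpecialLinearGroup.coe_mul, Matrix.SpecialLinearGroup.coe_mul]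

theorem involution_mk (v : R32) (hv hQ) : involution (Ein3.mk v hv hQ) =
    Ein3.mk (swapUV v) (swapUV.map_ne_zero_iff.2 hv) ((einQ_swapUV v).trans hQ) := rfl

theorem involution_psi (M : SL2) : involution (psi M) = psi (-M) := by
  rw [psi, involution_mk, psi, Ein3.mk_eq_mk_iff]
  refine ⟨-1, ?_⟩
  rw [swapUV_eq, psiVec_eq, psiVec_eq, toMat_ofMat, tau_ofMat, ← ofMat_smul,
    Matrix.SpecialLinearGroup.coe_neg, smul_neg, neg_smul, one_smul, neg_neg, mul_one]

theorem stdVertex_eq : stdVertex = psi 1 := by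
  refine Ein3.mk_eq_mk_iff.2 ⟨1 / 4, ?_⟩
  apply R32_ext <;> simp [psiVec, vertexVec] <;> norm_num

theorem stdCovertex_eq : stdCovertex = psi (-1) := by
  refine Ein3.mk_eq_mk_iff.2 ⟨-1 / 4, ?_⟩
  apply R32_ext <;> simp [psiVec, covertexVec] <;> norm_num

theorem psi_image_preimage (ε : ℤˣ) (g h : SL2) :
    psi '' (adsProj ⁻¹' adsCrookedPlane ε (adsProj g) (conj h (mkSl2 1 0 0))) =
      (biAct (g * h) h).act '' (psi '' crookedSheet ε) := by
  ext y
  constructor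
  · rintro ⟨x, hx, rfl⟩
    obtain ⟨M, hM, rfl⟩ := (adsProj_mem_adsCrookedPlane_iff ε g h x).1 hx
    exact ⟨_, mem_image_of_mem _ hM, biAct_psi _ _ _⟩
  · rintro ⟨_, ⟨M, hM, rfl⟩, rfl⟩
    exact ⟨g * h * M * h⁻¹, (adsProj_mem_adsCrookedPlane_iff ε g h _).2 ⟨M, hM, rfl⟩,
      (biAct_psi _ _ _).symm⟩

/-- The isometry induced by `(gh, h)` is a homeomorphism, so it commutes with the closure, and by
`psi_image_preimage` it carries the model sheet to the preimage of the given plane. -/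
theorem completedCrookedPlane_eq (ε : ℤˣ) (g h : SL2) :
    completedCrookedPlane ε (adsProj g) (conj h (mkSl2 1 0 0)) =
      (biAct (g * h) h).act '' stdSurface ε := by
  rw [completedCrookedPlane, psi_image_preimage, ← closure_psi_image_crookedSheet]
  exact ((biAct (g * h) h).homeo.image_closure _).symm

/-- The nilpotent matrix with image and kernel spanned by the vector `(p, r)`. -/
def nilMat (p r : ℝ) : Matrix (Fin 2) (Fin 2) ℝ := !![-(p * r), p ^ 2; -r ^ 2, p * r]

/-- The standard hingepoints are the nilpotents `E₁₂` and `-E₂₁` attached to the two basis vectors;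
conjugation by `h` replaces these by its columns. -/
theorem biAct_hingeVec (g h : SL2) (j : Fin 2) :
    (biAct (g * h) h).1 (hingeVec j) = ofMat (g.1 * nilMat (h.1 0 j) (h.1 1 j)) 0 := by
  have ht : tau (hingeVec j) = 0 := by simp [tau, hingeVec]
  rw [biAct_apply, ht, Matrix.SpecialLinearGroup.coe_mul, mul_assoc, mul_assoc]
  congr 2
  ext a b
  simp only [Matrix.mul_apply, Fin.sum_univ_two]
  fin_cases j <;> fin_cases a <;> fin_cases b <;>
    simp [toMat, hingeVec, hingeSign, nilMat] <;> ring

theorem involution_hingept (g h : SL2) (j : Fin 2) :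
    involution ((biAct (g * h) h).act (stdHingept j)) = (biAct (g * h) h).act (stdHingept j) := by
  rw [stdHingept, EinIsometry.act_mk, involution_mk]
  refine Ein3.mk_congr ?_
  rw [biAct_hingeVec, swapUV_eq, toMat_ofMat, tau_ofMat, neg_zero]

theorem vertex_biAct (g h : SL2) :
    ((biAct (g * h) h).mapConfig stdConfig).vertex = psi g := by
  change (biAct (g * h) h).act stdVertex = psi g
  rw [stdVertex_eq, biAct_psi]
  congr 1
  group

theorem covertex_biAct (g h : SL2) :
    ((biAct (g * h) h).mapConfig stdConfig).covertex = psi (-g) := by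
  change (biAct (g * h) h).act stdCovertex = psi (-g)
  rw [stdCovertex_eq, biAct_psi]
  congr 1
  simp [mul_assoc]

theorem isAdapted_biAct (g h : SL2) : ((biAct (g * h) h).mapConfig stdConfig).IsAdapted := by
  refine ⟨?_, ?_, fun j => involution_hingept g h j⟩
  · rw [vertex_biAct, covertex_biAct, involution_psi]
  · rw [vertex_biAct, covertex_biAct, involution_psi, neg_neg]

theorem isCrookedSurface_completedCrookedPlane (ε : ℤˣ) (g h : SL2) :
    ((biAct (g * h) h).mapConfig stdConfig).IsCrookedSurface
      (completedCrookedPlane ε (adsProj g) (conj h (mkSl2 1 0 0))) := by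
  rw [completedCrookedPlane_eq]
  exact (biAct (g * h) h).isCrookedSurface_mapConfig stdConfig (isCrookedSurface_stdSurface ε)

/-! ### Adapted stem configurations -/

theorem exists_nilMat_eq {N : Matrix (Fin 2) (Fin 2) ℝ} (htr : N.trace = 0) (hdet : N.det = 0) :
    ∃ p r a : ℝ, (p ≠ 0 ∨ r ≠ 0) ∧ a • nilMat p r = N := by
  rw [Matrix.trace_fin_two] at htr
  rw [Matrix.det_fin_two] at hdet
  have h11 : N 1 1 = -N 0 0 := by linarith
  rw [h11] at hdet
  by_cases hb : N 0 1 = 0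
  · have ha : N 0 0 = 0 := by
      rw [hb] at hdet; nlinarith
    refine ⟨0, 1, -N 1 0, Or.inr one_ne_zero, ?_⟩
    ext i j
    fin_cases i <;> fin_cases j <;> simp [nilMat, hb, ha, h11]
  -- The vector `(b, -a)` spans the kernel of `N = (a, b; c, -a)` since `a² + bc = 0`.
  · refine ⟨N 0 1, -N 0 0, (N 0 1)⁻¹, Or.inl hb, ?_⟩
    ext i j
    fin_cases i <;> fin_cases j <;> simp [nilMat, h11]
    · field_simp
    · field_simp
    · field_simp; linarith
    · field_simp

theorem einB_psiVec (w : R32) (g : SL2) : einB w (psiVec g) =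
    4 * tau w - 2 * ((g⁻¹).1 * toMat w).trace := by
  simp only [Matrix.trace_fin_two, Matrix.mul_apply, Fin.sum_univ_two, SL2_inv_00, SL2_inv_01,
    SL2_inv_10, SL2_inv_11]
  simp [einB, psiVec, tau, toMat]
  ring

/-- Once `t = 0`, the null condition reads `det M = 0`, and orthogonality to `Ψ(g)` reads `tr(g⁻¹M)
= 0` (`einB_psiVec`). So `g⁻¹M` is nilpotent. -/
theorem exists_hingept_eq {g : SL2} {q : Ein3} (hq : q ∈ lightcone (psi g))
    (hinv : involution q = q) : ∃ p r : ℝ, ∃ h0 hQ, (p ≠ 0 ∨ r ≠ 0) ∧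
      q = Ein3.mk (ofMat (g.1 * nilMat p r) 0) h0 hQ := by
  obtain ⟨w, hw, hQ, rfl⟩ := Ein3.exists_rep q
  -- A fixed point is an eigenline of `(M, t) ↦ (M, -t)`. If `t ≠ 0` the eigenvalue is `-1`, so `M =
  -- 0`, and the vector is not null.
  have ht : tau w = 0 := by
    rw [involution_mk, Ein3.mk_eq_mk_iff] at hinv
    obtain ⟨c, hc⟩ := hinv
    rw [swapUV_eq] at hc
    have h1 := congrArg tau hc
    have h2 := congrArg toMat hc
    rw [tau_smul, tau_ofMat] at h1
    rw [toMat_smul, toMat_ofMat] at h2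
    by_contra hne
    have hc1 : c = -1 := by
      have : (c + 1) * tau w = 0 := by linarith
      have := (mul_eq_zero.1 this).resolve_right hne
      linarith
    have hz : toMat w = 0 := by
      rw [hc1] at h2
      have h3 : (2 : ℝ) • toMat w = 0 := by
        rw [two_smul]
        nth_rewrite 1 [← h2]
        rw [neg_smul, one_smul, neg_add_cancel]
      exact (smul_eq_zero.1 h3).resolve_left two_ne_zero
    rw [einQ_eq, hz] at hQ
    simp [hne] at hQ
  obtain ⟨φ, hφ, h1, h2⟩ := hq
  have hB := einB_eq_zero_of_isPhoton hφ h2 h1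
  rw [einB_psiVec, ht] at hB
  have hdet : (toMat w).det = 0 := by rw [einQ_eq, ht] at hQ; linarith
  have hg : g.1 * ((g⁻¹).1 * toMat w) = toMat w := by
    rw [← mul_assoc, SL2_mul_inv_val, one_mul]
  obtain ⟨p, r, a, hpr, ha⟩ := exists_nilMat_eq (N := (g⁻¹).1 * toMat w) (by linarith)
    (by rw [Matrix.det_mul, hdet, mul_zero])
  have hwe : w = a • ofMat (g.1 * nilMat p r) 0 := by
    rw [← ofMat_smul, ← mul_smul_comm, ha, hg, mul_zero, ← ht, ofMat_toMat]
  have h0 : ofMat (g.1 * nilMat p r) 0 ≠ 0 := by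
    intro h; rw [h, smul_zero] at hwe; exact hw hwe
  have hgd : g.1.det = 1 := g.2
  refine ⟨p, r, h0, ?_, hpr, Ein3.mk_eq_mk_iff.2 ⟨a, hwe.symm⟩⟩
  rw [einQ_eq, toMat_ofMat, tau_ofMat, Matrix.det_mul, hgd]
  simp [nilMat, Matrix.det_fin_two]
  ring

theorem nilMat_mul (c p r : ℝ) : nilMat (c * p) (c * r) = c ^ 2 • nilMat p r := by
  ext i j
  fin_cases i <;> fin_cases j <;> simp [nilMat] <;> ring

theorem StemConfiguration.ext_of_eq {c c' : StemConfiguration} (h0 : c.vertex = c'.vertex)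
    (h1 : c.covertex = c'.covertex) (h2 : ∀ j, c.hingept j = c'.hingept j) : c = c' := by
  obtain ⟨v, w, q, _, _, _⟩ := c
  obtain ⟨v', w', q', _, _, _⟩ := c'
  obtain rfl : v = v' := h0
  obtain rfl : w = w' := h1
  obtain rfl : q = q' := funext h2
  rfl

theorem exists_biAct_eq {c : StemConfiguration} (hc : c.IsAdapted) :
    ∃ g h : SL2, c = (biAct (g * h) h).mapConfig stdConfig := by
  obtain ⟨hv, -, hq⟩ := hc
  obtain ⟨g, hg⟩ : ∃ g, c.vertex = psi g := by
    obtain ⟨v, hv0, hQ, he⟩ := Ein3.exists_rep c.vertex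
    rw [he]
    -- A vertex with `t = 0` would be fixed by the involution, hence equal to the covertex; the two
    -- would then be incident, through any photon containing the vertex.
    refine exists_psi_eq fun ht => c.not_incident ?_
    have : c.covertex = c.vertex := by
      rw [← hv, he, involution_mk]
      refine Ein3.mk_congr ?_
      rw [swapUV_eq, ht, neg_zero, ← ht, ofMat_toMat]
    obtain ⟨φ, hφ, h1, -⟩ := (c.hingept_mem 0).1
    rw [this]
    exact ⟨φ, hφ, h1, h1⟩
  have hmem : ∀ j, c.hingept j ∈ lightcone (psi g) := fun j => hg ▸ (c.hingept_mem j).1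
  obtain ⟨p, r, hw0, hQ0, hpr, e0⟩ := exists_hingept_eq (hmem 0) (hq 0)
  obtain ⟨q, s, hw1, hQ1, hqs, e1⟩ := exists_hingept_eq (hmem 1) (hq 1)
  have hscale : ∀ a x y : ℝ, ofMat (g.1 * nilMat (a * x) (a * y)) 0 =
      a ^ 2 • ofMat (g.1 * nilMat x y) 0 := fun a x y => by
    rw [nilMat_mul, mul_smul_comm, ← ofMat_smul, mul_zero]
  -- Proportional vectors give proportional nilpotents, hence equal hingepoints.
  have hD : p * s - q * r ≠ 0 := by
    intro hD
    apply c.hingept_ne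
    rw [e0, e1]
    rcases hqs with h | h
    · have hp : p = p / q * q := by field_simp
      have hr : r = p / q * s := by field_simp; linarith
      refine Ein3.mk_eq_mk_iff.2 ⟨(p / q) ^ 2, ?_⟩
      rw [← hscale, ← hp, ← hr]
    · have hp : p = r / s * q := by field_simp; linarith
      have hr : r = r / s * s := by field_simp
      refine Ein3.mk_eq_mk_iff.2 ⟨(r / s) ^ 2, ?_⟩
      rw [← hscale, ← hp, ← hr]
  -- The columns of `h` span the two lines; rescaling the second by the inverse determinant gives
  -- `det h = 1` and changes its nilpotent only by a square factor.
  refine ⟨g, mkSL2 p ((p * s - q * r)⁻¹ * q) r ((p * s - q * r)⁻¹ * s) ?_,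
    StemConfiguration.ext_of_eq ?_ ?_ ?_⟩
  · field_simp
  · rw [vertex_biAct, hg]
  · rw [covertex_biAct, ← hv, hg, involution_psi]
  · intro j
    have hact : ∀ h : SL2, ((biAct (g * h) h).mapConfig stdConfig).hingept j =
        (biAct (g * h) h).act (stdHingept j) := fun h => rfl
    rw [hact, stdHingept, EinIsometry.act_mk]
    fin_cases j
    · refine e0.trans (Ein3.mk_congr ?_)
      rw [biAct_hingeVec]
      simp
    · refine e1.trans (Ein3.mk_eq_mk_iff.2 ⟨(p * s - q * r) ^ 2, ?_⟩)
      rw [biAct_hingeVec]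
      simp only [Fin.mk_one, mkSL2_01, mkSL2_11, hscale, smul_smul]
      rw [inv_pow, mul_inv_cancel₀ (pow_ne_zero 2 hD), one_smul]

theorem adsInner_conj_diag (h : SL2) :
    adsInner (conj h (mkSl2 1 0 0)) (conj h (mkSl2 1 0 0)) = 1 := by
  rw [adsInner_conj, adsInner_eq]; simp

end CrookedSurfaces

end

/-! ### The main theorem -/

open CrookedSurfaces in
theorem mainTheorem1 :
    (∀ (ε : ℤˣ) (p : AdS) (s : TangentAdS p), adsInner s s = 1 →
      coords '' tangentCone (adsCrookedPlane ε p s) p = minkCrookedPlane ε 0 (coords s) ∧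
      adsCrookedPlane ε p s = adsExp p '' (coords ⁻¹' minkCrookedPlane ε 0 (coords s))) ∧
    (Topology.IsEmbedding psi ∧
      ∀ (ε : ℤˣ) (p : AdS) (s : TangentAdS p), adsInner s s = 1 →
        ∀ g : SL2, adsProj g = p →
          ∃ c : StemConfiguration, c.vertex = psi g ∧ c.covertex = psi (-g) ∧
            c.IsCrookedSurface (completedCrookedPlane ε p s) ∧ c.IsAdapted) ∧
    ((∀ (c : StemConfiguration) (S : Set Ein3), c.IsCrookedSurface S → c.IsAdapted →
        ∃ (ε : ℤˣ) (p : AdS) (s : TangentAdS p), adsInner s s = 1 ∧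
          S = completedCrookedPlane ε p s) ∧
      ∀ (ε : ℤˣ) (c : StemConfiguration), c.IsAdapted →
        ∃ (p : AdS) (s : TangentAdS p), adsInner s s = 1 ∧
          c.IsCrookedSurface (completedCrookedPlane ε p s)) := by
  refine ⟨fun ε p s hs => ⟨coords_image_tangentCone ε p s hs, adsCrookedPlane_eq ε p s⟩,
    ⟨isEmbedding_psi, ?_⟩, ?_, ?_⟩
  · rintro ε _ s hs g rfl
    obtain ⟨h, rfl⟩ := exists_conj_eq s hs
    exact ⟨_, vertex_biAct g h, covertex_biAct g h, isCrookedSurface_completedCrookedPlane ε g h,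
      isAdapted_biAct g h⟩
  · intro c S hS hc
    obtain ⟨g, h, rfl⟩ := exists_biAct_eq hc
    -- Pulled back by the inverse isometry, `S` becomes a crooked surface of the standard
    -- configuration, hence one of the two `stdSurface ε`; its sign is the required orientation.
    have hS' := (biAct (g * h) h).symm.isCrookedSurface_mapConfig _ hS
    rw [EinIsometry.symm_mapConfig_mapConfig] at hS'
    obtain ⟨ε, hε⟩ := exists_eq_stdSurface hS'
    refine ⟨ε, adsProj g, conj h (mkSl2 1 0 0), adsInner_conj_diag h, ?_⟩
    rw [completedCrookedPlane_eq, ← hε, image_image]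
    simp only [EinIsometry.act_symm_act, image_id']
  · intro ε c hc
    obtain ⟨g, h, rfl⟩ := exists_biAct_eq hc
    exact ⟨adsProj g, conj h (mkSl2 1 0 0), adsInner_conj_diag h,
      isCrookedSurface_completedCrookedPlane ε g h⟩
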